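/- Let $\mathbb Z^2_{even}=\{(x,t)\in\mathbb Z^2: x+t \text{ even}\}$. To each $z\in\mathbb Z^2_{even}$ attach an arrow, which at dynamical time $\tau=0$ has a direction $\xi^0_z\in\{-1,+1\}$ chosen by a fair coin, and a rate one Poisson clock; whenever the clock at $z$ rings, the direction of the arrow at $z$ is reset by a new fair coin. All clocks and coins are independent. Let $\xi^\tau_z$ (right continuous in $\tau\ge 0$) be the direction of the arrow at $z$ at dynamical time $\tau$, and let $S^\tau_z$ be the piecewise linear path that starts at $z$ and follows the arrows $(x,t)\to(x+\xi^\tau_{(x,t)},t+1)$; write $S^\tau_0$ for the path that starts at $(0,0)$. For $K>0$ let $$\mathcal T(K)=\{\tau\in[0,\infty): S^\tau_0(t)\ge -K\sqrt t \ \text{ for all } t\ge 0\}.$$ For $\gamma>2$ put $K(\gamma)=(\gamma-2)\sqrt{\frac{\gamma+1}{\gamma-1}}$; this is an increasing bijection from $(2,\infty)$ onto $(0,\infty)$, and $\gamma(K)\in(2,\infty)$ denotes the solution of $K(\gamma)=K$. Given $K>0$ and $\gamma=\gamma(K)$, let $d_k=2(\lfloor \gamma^k/2\rfloor+1)$, $x_k=\sum_{i<k}d_i$,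 $t_k=\sum_{i<k}d_i^2$ and $\bar z_k=(x_k,t_k)$ for $k\ge 0$, and let $$A_k(K)=\{S^0_{\bar z_k}(t)>x_k-d_k \ \text{ for all } t\in[t_k,t_{k+1}], \text{ and } S^0_{\bar z_k}(t_{k+1})>x_{k+1}\}.$$ Let $\gamma_0=\sup_{k\ge 0,\,K>0} 1/\mathbb P(A_k(K))$. Then $2<\gamma_0<\infty$, and for every $K>K(\gamma_0)$, almost surely, $$\dim_H(\mathcal T(K))\ \ge\ 1-\frac{\log\gamma_0}{\log\gamma(K)}.$$ Moreover, almost surely, $\lim_{K\uparrow\infty}\dim_H(\mathcal T(K))=1$. -/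

import Mathlib

open MeasureTheory ProbabilityTheory
open scoped ENNReal Topology

namespace DynWeb

noncomputable section

/-- The space-time lattice `{(x, t) ∈ ℤ² : x + t even}`. -/
abbrev Site : Type := {z : ℤ × ℤ // Even (z.1 + z.2)}

/-- The increment of an arrow: `true` points to the right, `false` to the left. -/
def dir (b : Bool) : ℤ := if b then 1 else -1

/-- The endpoint `(x ± 1, t + 1)` of the arrow that starts at `z = (x, t)` in the arrow
configuration `a`. -/
def step (a : Site → Bool) (z : Site) : Site :=
  ⟨(z.1.1 + dir (a z), z.1.2 + 1), by
    have hz := z.2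
    rcases h : a z <;> simp only [dir] <;> grind⟩

/-- The spatial position, after `n` steps, of the walk that starts at `z` and follows the arrows. -/
def pos (a : Site → Bool) (z : Site) (n : ℕ) : ℤ := ((step a)^[n] z).1.1

/-- The path that starts at `z` and follows the arrows, as a piecewise linear function of the real
time `t ≥ z.1.2`. -/
def path (a : Site → Bool) (z : Site) (t : ℝ) : ℝ :=
  let s : ℝ := t - (z.1.2 : ℝ)
  let n : ℕ := ⌊s⌋₊
  (pos a z n : ℝ) + (s - n) * ((pos a z (n + 1) : ℝ) - (pos a z n : ℝ))

/-- The origin of space-time. -/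
def origin : Site := ⟨(0, 0), by simp⟩

section Dynamics

variable {Ω : Type*}

/-- The law of a fair coin. -/
def fairCoin : Measure Bool := (PMF.uniformOfFintype Bool).toMeasure

/-- The randomness of the dynamical discrete web. At each site `z` there is a rate one Poisson
clock, given by its i.i.d. exponential waiting times `W z 0, W z 1, …`, and a sequence of fair
coins: `ε z 0` is the initial direction of the arrow at `z`, and `ε z n` is the direction to which
the arrow is reset when the clock rings for the `n`-th time. All of these are independent. -/
structure IsWebNoise [MeasurableSpace Ω] (P : Measure Ω)
    (W : Site → ℕ → Ω → ℝ) (ε : Site → ℕ → Ω → Bool) : Prop where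
  measurable_wait : ∀ z n, Measurable (W z n)
  measurable_coin : ∀ z n, Measurable (ε z n)
  law : ∀ z n, P.map (fun ω => (W z n ω, ε z n ω)) = (expMeasure 1).prod fairCoin
  indep : iIndepFun (fun (i : Site × ℕ) (ω : Ω) => (W i.1 i.2 ω, ε i.1 i.2 ω)) P

/-- The number of rings of the clock at `z` during the dynamical time interval `[0, τ]`. -/
def rings (W : Site → ℕ → Ω → ℝ) (τ : ℝ) (ω : Ω) (z : Site) : ℕ :=
  Set.ncard {n : ℕ | ∑ i ∈ Finset.range (n + 1), W z i ω ≤ τ}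

/-- The arrow configuration at the dynamical time `τ`. -/
def arrows (W : Site → ℕ → Ω → ℝ) (ε : Site → ℕ → Ω → Bool) (τ : ℝ) (ω : Ω) (z : Site) : Bool :=
  ε z (rings W τ ω z) ω

/-- The set of `K`-exceptional times: those `τ ∈ [0, ∞)` at which the path from the origin does not
cross the moving boundary `t ↦ -K √t`. -/
def exceptionalTimes (W : Site → ℕ → Ω → ℝ) (ε : Site → ℕ → Ω → Bool) (K : ℝ) (ω : Ω) : Set ℝ :=
  {τ | 0 ≤ τ ∧ ∀ t : ℝ, 0 ≤ t → -K * √t ≤ path (arrows W ε τ ω) origin t}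

end Dynamics

/-- The function `γ ↦ K(γ) = (γ - 2) √((γ + 1) / (γ - 1))`. -/
def kOf (γ : ℝ) : ℝ := (γ - 2) * √((γ + 1) / (γ - 1))

theorem exists_kOf_eq {K : ℝ} (hK : 0 < K) : ∃ γ ∈ Set.Ioi (2 : ℝ), kOf γ = K := by
  have hc : ContinuousOn kOf (Set.Icc 2 (K + 2)) := by
    unfold kOf
    refine ContinuousOn.mul (by fun_prop) (ContinuousOn.sqrt (ContinuousOn.div (by fun_prop)
      (by fun_prop) ?_))
    intro x hx
    have := hx.1
    linarith
  have h2 : kOf 2 = 0 := by simp [kOf]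
  have h3 : K ≤ kOf (K + 2) := by
    have : 1 ≤ √((K + 2 + 1) / (K + 2 - 1)) := by
      rw [Real.one_le_sqrt, one_le_div (by linarith)]
      linarith
    unfold kOf
    nlinarith
  obtain ⟨γ, hγ, h⟩ := intermediate_value_Icc (by linarith) hc ⟨by linarith [h2], h3⟩
  refine ⟨γ, ?_, h⟩
  rcases hγ.1.lt_or_eq with h' | h'
  · exact h'
  · subst h'
    linarith

theorem kOf_strictMonoOn : StrictMonoOn kOf (Set.Ioi 2) := by
  intro a ha b hb hab
  simp only [Set.mem_Ioi] at ha hb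
  have hs : ∀ x : ℝ, 2 < x → kOf x = √((x - 2) ^ 2 * ((x + 1) / (x - 1))) := by
    intro x hx
    rw [Real.sqrt_mul (sq_nonneg _), Real.sqrt_sq (by linarith), kOf]
  rw [hs a ha, hs b hb]
  apply Real.sqrt_lt_sqrt
  · have : 0 < a - 1 := by linarith
    have : 0 < a + 1 := by linarith
    positivity
  · rw [← mul_div_assoc, ← mul_div_assoc, div_lt_div_iff₀ (by linarith) (by linarith)]
    obtain ⟨u, rfl⟩ : ∃ u, a = 2 + u := ⟨a - 2, by ring⟩
    obtain ⟨w, rfl⟩ : ∃ w, b = 2 + u + w := ⟨b - (2 + u), by ring⟩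
    have hu : 0 < u := by linarith
    have hw : 0 < w := by linarith
    rw [← sub_pos]
    ring_nf
    positivity

/-- `γ(K)`: for `K > 0`, the solution `γ ∈ (2, ∞)` of `K(γ) = K`. -/
def gammaOf (K : ℝ) : ℝ := Function.invFunOn kOf (Set.Ioi 2) K

theorem gammaOf_spec {K : ℝ} (hK : 0 < K) : 2 < gammaOf K ∧ kOf (gammaOf K) = K :=
  ⟨Function.invFunOn_mem (exists_kOf_eq hK), Function.invFunOn_eq (exists_kOf_eq hK)⟩

theorem eq_gammaOf {K γ : ℝ} (hK : 0 < K) (hγ : 2 < γ) (h : kOf γ = K) : γ = gammaOf K :=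
  kOf_strictMonoOn.injOn hγ (gammaOf_spec hK).1 (h.trans (gammaOf_spec hK).2.symm)

/-- The half-width `d_k = 2 (⌊γ ^ k / 2⌋ + 1)` of the `k`-th box; its height is `d_k ^ 2`. -/
def boxSize (γ : ℝ) (k : ℕ) : ℤ := 2 * (⌊γ ^ k / 2⌋ + 1)

/-- The abscissa `x_k` of the middle point of the lower edge of the `k`-th box. -/
def boxX (γ : ℝ) (k : ℕ) : ℤ := ∑ i ∈ Finset.range k, boxSize γ i

/-- The time `t_k` of the lower edge of the `k`-th box. -/
def boxT (γ : ℝ) (k : ℕ) : ℤ := ∑ i ∈ Finset.range k, boxSize γ i ^ 2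

/-- The middle point `(x_k, t_k)` of the lower edge of the `k`-th box. -/
def boxBase (γ : ℝ) (k : ℕ) : Site :=
  ⟨(boxX γ k, boxT γ k), by
    have h : ∀ i, Even (boxSize γ i) := fun i => even_two_mul _
    simp only [boxX, boxT]
    exact (Finset.even_sum _ fun i _ => h i).add
      (Finset.even_sum _ fun i _ => (h i).pow_of_ne_zero two_ne_zero)⟩

variable {Ω : Type*}

/-- The event `A_k^τ`: the path from `(x_k, t_k)` stays, during `[t_k, t_{k+1}]`, to the right of
the left side of the `k`-th box, and ends to the right of `x_{k+1}`. -/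
def boxEvent (W : Site → ℕ → Ω → ℝ) (ε : Site → ℕ → Ω → Bool) (γ : ℝ) (k : ℕ) (τ : ℝ) : Set Ω :=
  {ω | (∀ t ∈ Set.Icc (boxT γ k : ℝ) (boxT γ (k + 1) : ℝ),
          (boxX γ k : ℝ) - (boxSize γ k : ℝ) < path (arrows W ε τ ω) (boxBase γ k) t) ∧
        (boxX γ (k + 1) : ℝ) < path (arrows W ε τ ω) (boxBase γ k) (boxT γ (k + 1) : ℝ)}

/-- `γ₀ = sup 1 / P(A_k(K))`, over all `k ≥ 0` and `K > 0`, where `A_k(K)` is the event `A_k^0` for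
`γ = γ(K)`. The supremum is taken in `[0, ∞]`. -/
def gammaZero [MeasurableSpace Ω] (P : Measure Ω)
    (W : Site → ℕ → Ω → ℝ) (ε : Site → ℕ → Ω → Bool) : ℝ≥0∞ :=
  ⨆ (k : ℕ) (K : ℝ) (_ : 0 < K), (P (boxEvent W ε (gammaOf K) k 0))⁻¹

end

end DynWeb

/-! Geometry. Call the k-th box good at dynamical time τ when the event A_k holds for the arrows of
time τ. Paths following the same arrows do not cross, so when all boxes are good the path from the
origin is at or to the right of x_k at time t_k and stays right of the left side of the k-th box.
Since (d_k - x_k)/√t_k tends to K(γ), the left sides avoid the moving boundary;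
`sq_boxSize_sub_boxX_le` shows that the rounding in d_k does no harm. Hence the exceptional set
contains the set of times at which all boxes are good (`neg_kOf_mul_sqrt_le_path`), and it is enough
to bound the dimension of the latter.

Correlations. The boxes occupy disjoint rows and are independent, so the normalized two-point
function at times at distance δ is a product of ratios r_k = P(A_k at both times)/P(A_k)². Trivially
r_k ≤ 1/P(A_k) ≤ γ₀. On the other hand the two paths are walks whose steps are correlated, with
correlation exp(-δ), only while they sit at the same site. A Duhamel expansion with source on the
diagonal, together with a bound on the time spent there, gives r_k ≤ 1 + C (δ γ^k)^(-1/3)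
(`pairSurv_le`). Only about log(1/δ)/log γ boxes are strongly correlated, so for δ < 1 the product
is O(δ^(-α)) with α = log γ₀ / log γ (`exists_prod_bounds`).

Dimension. Consequently Lebesgue measure on the times at which the first n boxes are good,
normalized to mean L on [0, L], has bounded expected s-energy when s < 1 - α.
`ofReal_le_dimH_iInter` turns this into a dimension bound by compactness, without a limit measure;
the sets are not closed, but their closures add only countably many ring times.

Probability one. No zero-one law is used. The two-point function tends to 1 as δ grows, so the
variance of the normalized volume is o(L²), and a large L makes the failure probability as small as
desired (`exists_second_moment_bound`, `ae_le_dimH`).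

The constant. γ₀ is finite by a diffusive heat kernel estimate (`le_surv`), and at least 16 because
the first box is good with probability exactly 1/16. -/

namespace DynWeb

noncomputable section

/-! ### The heat kernel of the simple random walk -/

/-- The probability that the simple random walk is at `x` after `j` steps. -/
def srw : ℕ → ℤ → ℝ
  | 0, x => if x = 0 then 1 else 0
  | j + 1, x => (srw j (x + 1) + srw j (x - 1)) / 2

theorem srw_nonneg (j : ℕ) (x : ℤ) : 0 ≤ srw j x := by
  induction j generalizing x with
  | zero => simp only [srw]; split_ifs <;> norm_num
  | succ j ih => simp only [srw]; linarith [ih (x + 1), ih (x - 1)]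

theorem srw_neg (j : ℕ) (x : ℤ) : srw j (-x) = srw j x := by
  induction j generalizing x with
  | zero => simp [srw]
  | succ j ih =>
    simp only [srw]
    rw [← ih (x + 1), ← ih (x - 1)]
    ring_nf

theorem srw_eq_zero_of_lt (j : ℕ) (x : ℤ) (hx : (j : ℤ) < |x|) : srw j x = 0 := by
  induction j generalizing x with
  | zero =>
    have : x ≠ 0 := by rintro rfl; simp at hx
    simp [srw, this]
  | succ j ih =>
    push_cast at hx
    simp only [srw]
    rw [ih _ (by grind), ih _ (by grind)]
    simp

theorem srw_eq_zero_of_odd (j : ℕ) (x : ℤ) (hx : Odd (x + j)) : srw j x = 0 := by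
  induction j generalizing x with
  | zero =>
    have : x ≠ 0 := by rintro rfl; simp at hx
    simp [srw, this]
  | succ j ih =>
    push_cast at hx
    simp only [srw]
    rw [ih _ (by grind), ih _ (by grind)]
    simp

theorem srw_eq_choose (j a : ℕ) : srw j (2 * a - j) = (j.choose a : ℝ) / 2 ^ j := by
  induction j generalizing a with
  | zero => cases a <;> simp [srw]; norm_cast
  | succ j ih =>
    simp only [srw]
    cases a with
    | zero =>
      have h1 := ih 0
      rw [srw_eq_zero_of_lt j ((2 : ℤ) * ((0 : ℕ) : ℤ) - ((j + 1 : ℕ) : ℤ) - 1)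
        (by push_cast; rw [abs_of_neg] <;> lia)]
      rw [show ((2 : ℤ) * ((0 : ℕ) : ℤ) - ((j + 1 : ℕ) : ℤ) + 1) = 2 * ((0 : ℕ) : ℤ) - j by
        push_cast; ring, h1]
      simp only [Nat.choose_zero_right, pow_succ]
      field_simp
      simp
    | succ a =>
      rw [show ((2 : ℤ) * ((a + 1 : ℕ) : ℤ) - ((j + 1 : ℕ) : ℤ) + 1) = 2 * ((a + 1 : ℕ) : ℤ) - j by
        push_cast; ring, ih (a + 1),
        show ((2 : ℤ) * ((a + 1 : ℕ) : ℤ) - ((j + 1 : ℕ) : ℤ) - 1) = 2 * (a : ℤ) - j by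
        push_cast; ring, ih a, Nat.choose_succ_succ]
      push_cast
      field_simp
      ring

/-- Induction on the ratio of consecutive central binomials replaces Stirling's formula; this bound
and the next give both halves of the order √m of the return probability. -/
theorem centralBinom_sq_mul_le (m : ℕ) : (2 * m + 1) * m.centralBinom ^ 2 ≤ 16 ^ m := by
  induction m with
  | zero => simp
  | succ m ih =>
    have h := Nat.succ_mul_centralBinom_succ m
    have h2 : (m + 1) ^ 2 * ((2 * (m + 1) + 1) * (m + 1).centralBinom ^ 2)
        = 4 * (2 * m + 1) * (2 * m + 3) * ((2 * m + 1) * m.centralBinom ^ 2) := by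
      calc _ = (2 * m + 3) * ((m + 1) * (m + 1).centralBinom) ^ 2 := by ring
        _ = _ := by rw [h]; ring
    have h3 : (m + 1) ^ 2 * ((2 * (m + 1) + 1) * (m + 1).centralBinom ^ 2)
        ≤ (m + 1) ^ 2 * 16 ^ (m + 1) := by
      rw [h2, pow_succ 16 m]
      calc _ ≤ 4 * (2 * m + 1) * (2 * m + 3) * 16 ^ m := Nat.mul_le_mul_left _ ih
        _ ≤ (16 * (m + 1) ^ 2) * 16 ^ m := Nat.mul_le_mul_right _ (by nlinarith)
        _ = _ := by ring
    exact Nat.le_of_mul_le_mul_left h3 (by positivity)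

theorem le_centralBinom_sq_mul (m : ℕ) (hm : 0 < m) : 16 ^ m ≤ 4 * m * m.centralBinom ^ 2 := by
  induction m, hm using Nat.le_induction with
  | base => simp [Nat.centralBinom, Nat.choose]
  | succ m hm ih =>
    have h := Nat.succ_mul_centralBinom_succ m
    have h2 : (m + 1) * (4 * (m + 1) * (m + 1).centralBinom ^ 2)
        = 16 * (2 * m + 1) ^ 2 * m.centralBinom ^ 2 := by
      calc _ = 4 * ((m + 1) * (m + 1).centralBinom) ^ 2 := by ring
        _ = _ := by rw [h]; ring
    have h3 : (m * (m + 1)) * 16 ^ (m + 1)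
        ≤ (m * (m + 1)) * (4 * (m + 1) * (m + 1).centralBinom ^ 2) := by
      rw [mul_assoc m, mul_assoc m, h2, pow_succ 16 m]
      calc m * ((m + 1) * (16 ^ m * 16)) = 16 * (m * (m + 1)) * 16 ^ m := by ring
        _ ≤ 16 * (m * (m + 1)) * (4 * m * m.centralBinom ^ 2) := Nat.mul_le_mul_left _ ih
        _ = (16 * (4 * m * (m + 1))) * (m * m.centralBinom ^ 2) := by ring
        _ ≤ (16 * (2 * m + 1) ^ 2) * (m * m.centralBinom ^ 2) :=
            Nat.mul_le_mul_right _ (by nlinarith)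
        _ = _ := by ring
    exact Nat.le_of_mul_le_mul_left h3 (by positivity)

theorem two_mul_choose_middle (m : ℕ) : 2 * (2 * m + 1).choose m = (m + 1).centralBinom := by
  rw [Nat.centralBinom, show 2 * (m + 1) = (2 * m + 1) + 1 by ring, Nat.choose_succ_succ,
    Nat.choose_symm_half]
  ring

theorem succ_mul_choose_middle_sq_le (j : ℕ) : (j + 1) * (j.choose (j / 2)) ^ 2 ≤ 4 ^ j := by
  obtain ⟨m, rfl | rfl⟩ := j.even_or_odd'
  · have := centralBinom_sq_mul_le m
    rw [Nat.mul_div_cancel_left _ (by norm_num : 0 < 2), pow_mul]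
    exact this
  · have h1 := centralBinom_sq_mul_le (m + 1)
    rw [← two_mul_choose_middle, pow_succ 16] at h1
    rw [show (2 * m + 1) / 2 = m by lia, pow_succ 4, pow_mul]
    norm_num
    nlinarith [sq_nonneg ((2 * m + 1).choose m)]

/-- On the support the kernel is a binomial coefficient over 2^j, and the middle coefficient
dominates. -/
theorem srw_le (j : ℕ) (x : ℤ) : srw j x ≤ 1 / √(j + 1) := by
  have hpos : 0 < √((j : ℝ) + 1) := by positivity
  by_cases h1 : (j : ℤ) < |x|
  · rw [srw_eq_zero_of_lt j x h1]; positivity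
  by_cases h2 : Odd (x + j)
  · rw [srw_eq_zero_of_odd j x h2]; positivity
  obtain ⟨b, hb⟩ := Int.not_odd_iff_even.1 h2
  obtain ⟨a, rfl⟩ : ∃ a : ℕ, b = a := Int.eq_ofNat_of_zero_le (by grind)
  rw [show x = 2 * a - j by lia, srw_eq_choose, div_le_div_iff₀ (by positivity) hpos, one_mul]
  have h3 : ((j + 1 : ℕ) * (j.choose (j / 2)) ^ 2 : ℝ) ≤ 4 ^ j := by
    exact_mod_cast succ_mul_choose_middle_sq_le j
  have h4 : (j.choose a : ℝ) ≤ j.choose (j / 2) := by exact_mod_cast Nat.choose_le_middle a j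
  refine le_trans (mul_le_mul_of_nonneg_right h4 hpos.le) ?_
  refine abs_le_of_sq_le_sq' ?_ (by positivity) |>.2
  rw [mul_pow, Real.sq_sqrt (by positivity), ← pow_mul, mul_comm j 2, pow_mul]
  norm_num at h3 ⊢
  linarith

/-- Lower bound on the heat kernel in the diffusive range. -/
theorem le_srw (e a : ℕ) (he : 2 ≤ e) (ha : a ≤ 2 * e) :
    Real.exp (-8) / (3 * e) ≤ srw ((2 * e) ^ 2) (2 * a) := by
  set m : ℕ := 2 * e ^ 2 with hm
  have hm0 : 0 < m := by positivity
  have he0 : (2 : ℝ) ≤ e := by exact_mod_cast he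
  have hsrw : ∀ a : ℕ, srw ((2 * e) ^ 2) (2 * a) = ((2 * m).choose (m + a) : ℝ) / 2 ^ (2 * m) := by
    intro a
    rw [← srw_eq_choose]
    congr 1
    · rw [hm]; ring
    · push_cast; ring
  rw [hsrw]
  -- The ratio of consecutive coefficients is (m - a)/(m + a + 1), which is at least (e - 1)/(e + 1)
  -- as long as a + 1 ≤ 2e; this uses m = 2e².
  have hratio : ∀ a : ℕ, a ≤ 2 * e →
      (((e : ℝ) - 1) / (e + 1)) ^ a * (m.centralBinom : ℝ) ≤ ((2 * m).choose (m + a) : ℝ) := by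
    intro a
    induction a with
    | zero => intro _; simp [Nat.centralBinom]
    | succ a ih =>
      intro ha
      have h1 := ih (by lia)
      have ha' : (a : ℝ) + 1 ≤ 2 * e := by exact_mod_cast ha
      have h2 : ((2 * m).choose (m + (a + 1)) : ℝ) * (m + a + 1)
          = (2 * m).choose (m + a) * ((m : ℝ) - a) := by
        have h3 := Nat.choose_succ_right_eq (2 * m) (m + a)
        have h4 : 2 * m - (m + a) + a = m := by
          have : a ≤ m := by rw [hm]; nlinarith
          lia
        have h5 : ((2 * m - (m + a) : ℕ) : ℝ) = (m : ℝ) - a := by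
          have : ((2 * m - (m + a) : ℕ) : ℝ) + a = m := by exact_mod_cast h4
          linarith
        rw [← h5]
        exact_mod_cast h3
      have hmR : (m : ℝ) = 2 * e ^ 2 := by rw [hm]; push_cast; ring
      have ha0 : (0 : ℝ) ≤ a := by positivity
      have hC : (0 : ℝ) ≤ (2 * m).choose (m + a) := by positivity
      have h6 : ((e : ℝ) - 1) / (e + 1) ≤ ((m : ℝ) - a) / (m + a + 1) := by
        rw [div_le_div_iff₀ (by linarith) (by rw [hmR]; nlinarith), hmR]
        nlinarith
      have h7 : ((2 * m).choose (m + (a + 1)) : ℝ)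
          = ((m : ℝ) - a) / (m + a + 1) * (2 * m).choose (m + a) := by
        have : (m : ℝ) + a + 1 ≠ 0 := by rw [hmR]; nlinarith
        field_simp
        linarith
      have h8 : 0 ≤ ((e : ℝ) - 1) / (e + 1) := div_nonneg (by linarith) (by linarith)
      rw [h7, pow_succ]
      calc _ = ((e : ℝ) - 1) / (e + 1) * ((((e : ℝ) - 1) / (e + 1)) ^ a * m.centralBinom) := by
            ring
        _ ≤ ((e : ℝ) - 1) / (e + 1) * (2 * m).choose (m + a) := by gcongr
        _ ≤ _ := by gcongr
  -- At most 2e factors, each at least exp(-2/(e - 1)); the exponent 4e/(e - 1) is at most 8 because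
  -- e ≥ 2.
  have hexp : Real.exp (-8) ≤ (((e : ℝ) - 1) / (e + 1)) ^ a := by
    have h8 : 0 ≤ ((e : ℝ) - 1) / (e + 1) := div_nonneg (by linarith) (by linarith)
    have h9 : ((e : ℝ) - 1) / (e + 1) ≤ 1 := by
      rw [div_le_one (by linarith)]; linarith
    refine le_trans ?_ (pow_le_pow_of_le_one h8 h9 ha)
    have h10 : Real.exp (-(2 / (e - 1))) ≤ ((e : ℝ) - 1) / (e + 1) := by
      rw [Real.exp_neg, inv_le_comm₀ (Real.exp_pos _) (div_pos (by linarith) (by linarith)),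
        inv_div]
      have := Real.add_one_le_exp (2 / ((e : ℝ) - 1))
      refine le_trans (le_of_eq ?_) this
      have : (e : ℝ) - 1 ≠ 0 := by linarith
      field_simp
      ring
    refine le_trans ?_ (pow_le_pow_left₀ (Real.exp_pos _).le h10 _)
    rw [← Real.exp_nat_mul]
    apply Real.exp_le_exp.2
    push_cast
    have : (e : ℝ) / (e - 1) ≤ 2 := by rw [div_le_iff₀ (by linarith)]; linarith
    calc (-8 : ℝ) ≤ -(4 * (e / (e - 1))) := by linarith
      _ = _ := by ring
  -- Here 4m = 8e² ≤ (3e)².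
  have hcentral : 2 ^ (2 * m) ≤ (3 * (e : ℝ)) * m.centralBinom := by
    have h1 : ((16 : ℝ)) ^ m ≤ 4 * m * m.centralBinom ^ 2 := by
      exact_mod_cast le_centralBinom_sq_mul m hm0
    refine abs_le_of_sq_le_sq' ?_ (by positivity) |>.2
    have hmR : (m : ℝ) = 2 * e ^ 2 := by rw [hm]; push_cast; ring
    calc ((2 : ℝ) ^ (2 * m)) ^ 2 = 16 ^ m := by
          rw [← pow_mul, mul_comm 2 m, mul_assoc, mul_comm m, pow_mul]; norm_num
      _ ≤ _ := h1
      _ = 8 * (e : ℝ) ^ 2 * m.centralBinom ^ 2 := by rw [hmR]; ring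
      _ ≤ (3 * (e : ℝ) * m.centralBinom) ^ 2 := by
        have : 0 ≤ (e : ℝ) ^ 2 * m.centralBinom ^ 2 := by positivity
        nlinarith
  rw [div_le_div_iff₀ (by positivity) (by positivity)]
  calc Real.exp (-8) * 2 ^ (2 * m) ≤ Real.exp (-8) * ((3 * (e : ℝ)) * m.centralBinom) := by gcongr
    _ ≤ (((e : ℝ) - 1) / (e + 1)) ^ a * ((3 * (e : ℝ)) * m.centralBinom) := by gcongr
    _ = ((((e : ℝ) - 1) / (e + 1)) ^ a * m.centralBinom) * (3 * e) := by ring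
    _ ≤ _ := by gcongr; exact hratio a ha

/-! ### The walk killed at zero -/

/-- The probability that the simple random walk from `y` stays positive until it has made all of its
`j` steps and then exceeds `h`. -/
def surv (h : ℤ) : ℕ → ℤ → ℝ
  | 0, y => if h < y then 1 else 0
  | j + 1, y => if y ≤ 0 then 0 else (surv h j (y + 1) + surv h j (y - 1)) / 2

/-- The discrete derivative of `surv`, extended to an even function. -/
def bump (h : ℤ) (j : ℕ) (y : ℤ) : ℝ :=
  srw j (y - h) + srw j (y - h - 1) + srw j (y + h) + srw j (y + h + 1)

theorem bump_succ (h : ℤ) (j : ℕ) (y : ℤ) :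
    bump h (j + 1) y = (bump h j (y + 1) + bump h j (y - 1)) / 2 := by
  simp only [bump, srw]
  ring_nf

theorem bump_nonneg (h : ℤ) (j : ℕ) (y : ℤ) : 0 ≤ bump h j y := by
  have := srw_nonneg j
  unfold bump
  linarith [this (y - h), this (y - h - 1), this (y + h), this (y + h + 1)]

theorem bump_le (h : ℤ) (j : ℕ) (y : ℤ) : bump h j y ≤ 4 * (1 / √(j + 1)) := by
  have := srw_le j
  unfold bump
  linarith [this (y - h), this (y - h - 1), this (y + h), this (y + h + 1)]

theorem bump_neg (h : ℤ) (j : ℕ) (y : ℤ) : bump h j (-y) = bump h j y := by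
  unfold bump
  rw [← srw_neg j (y - h), ← srw_neg j (y - h - 1), ← srw_neg j (y + h), ← srw_neg j (y + h + 1)]
  ring_nf

theorem surv_of_nonpos {h : ℤ} (hh : 0 ≤ h) (j : ℕ) {y : ℤ} (hy : y ≤ 0) : surv h j y = 0 := by
  cases j with
  | zero => simp only [surv]; rw [if_neg (by lia)]
  | succ j => simp [surv, hy]

/-- Reflection principle in differentiated form: the odd extension of `surv` solves the free heat
equation, so its symmetric difference is even and also evolves freely. Its initial value is one at h
and h + 1 and at their mirror images, hence the four kernels. The value at 1 is half the difference
at 0. -/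
theorem surv_sub {h : ℤ} (hh : 0 ≤ h) (j : ℕ) :
    surv h j 1 = bump h j 0 / 2 ∧
      ∀ y : ℤ, 1 ≤ y → surv h j (y + 1) - surv h j (y - 1) = bump h j y := by
  induction j with
  | zero =>
    constructor
    · simp only [surv, bump, srw]
      grind
    · intro y hy
      simp only [surv, bump, srw]
      grind
  | succ j ih =>
    obtain ⟨ih1, ih2⟩ := ih
    have hz : surv h j 0 = 0 := surv_of_nonpos hh j le_rfl
    constructor
    · have h1 := ih2 1 le_rfl
      have h2 := bump_neg h j 1
      rw [bump_succ]
      norm_num [surv] at h1 h2 ⊢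
      linarith
    · intro y hy
      rw [bump_succ]
      rcases hy.eq_or_lt with rfl | hy
      · have h1 := ih2 2 (by norm_num)
        norm_num [surv] at h1 ⊢
        linarith
      · have h1 := ih2 (y + 1) (by lia)
        have h2 := ih2 (y - 1) (by lia)
        simp only [surv]
        rw [if_neg (by lia), if_neg (by lia), ← h1, ← h2]
        ring_nf

theorem surv_even {h : ℤ} (hh : 0 ≤ h) (j e : ℕ) :
    surv h j (2 * e) = ∑ i ∈ Finset.range e, bump h j (2 * i + 1) := by
  induction e with
  | zero => simp [surv_of_nonpos hh]
  | succ e ih =>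
    have := (surv_sub hh j).2 (2 * e + 1) (by lia)
    rw [Finset.sum_range_succ, ← ih, ← this]
    push_cast
    ring_nf

/-- Uniform lower bound on the probability that a walk started in the middle of the lower edge of a
box of half-width `2 e` stays to the right of the left edge and leaves to the right. -/
theorem le_surv (e : ℕ) (he : 1 ≤ e) :
    Real.exp (-8) / 3 ≤ surv (2 * (2 * e)) ((2 * e) ^ 2) (2 * e) := by
  rcases he.eq_or_lt with rfl | he
  -- The case e = 1 is outside the range of `le_srw`. All four steps from 2 must go right to exceed
  -- 4, so the probability is 1/16.
  · norm_num [surv]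
    have : Real.exp (-8) ≤ Real.exp (-1) ^ 3 := by
      rw [← Real.exp_nat_mul]; apply Real.exp_le_exp.2; norm_num
    have h2 : Real.exp (-1) < 0.37 := by
      have := Real.exp_neg_one_lt_d9; linarith
    have h3 : Real.exp (-1) ^ 3 ≤ 0.37 ^ 3 := by gcongr
    norm_num at h3
    linarith
  · rw [surv_even (by positivity)]
    -- Of the four kernels only the one with argument (2i + 1) - 4e - 1 is kept: it has the right
    -- parity and lies within the diffusive range.
    have key : ∀ i ∈ Finset.range e, Real.exp (-8) / (3 * e) ≤
        bump (2 * (2 * e)) ((2 * e) ^ 2) (2 * i + 1) := by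
      intro i hi
      have hi := Finset.mem_range.1 hi
      have h1 := le_srw e (2 * e - i) he (by lia)
      have h2 : (2 * ((2 * e - i : ℕ) : ℤ)) = -(2 * i + 1 - 2 * (2 * e) - 1) := by
        push_cast [show i ≤ 2 * e by lia]; ring
      rw [h2, srw_neg] at h1
      refine h1.trans ?_
      unfold bump
      have := srw_nonneg ((2 * e) ^ 2)
      linarith [this (2 * i + 1 - 2 * (2 * e)), this (2 * i + 1 + 2 * (2 * e)),
        this (2 * i + 1 + 2 * (2 * e) + 1)]
    refine le_trans (le_of_eq ?_) (Finset.card_nsmul_le_sum _ _ _ key)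
    rw [Finset.card_range, nsmul_eq_mul]
    have : (e : ℝ) ≠ 0 := by positivity
    field_simp

/-! ### Two sticky walks killed at zero -/

/-- One step of the pair of walks whose steps are independent fair signs when the walks are at
different places, and fair signs with correlation `ρ` when they are at the same place. -/
def pairStep (ρ : ℝ) (f : ℤ → ℤ → ℝ) (x y : ℤ) : ℝ :=
  (1 + if x = y then ρ else 0) / 4 * (f (x + 1) (y + 1) + f (x - 1) (y - 1)) +
    (1 - if x = y then ρ else 0) / 4 * (f (x + 1) (y - 1) + f (x - 1) (y + 1))

/-- The probability that both walks survive as in `surv`. -/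
def pairSurv (ρ : ℝ) (h : ℤ) : ℕ → ℤ → ℤ → ℝ
  | 0, x, y => if h < x ∧ h < y then 1 else 0
  | j + 1, x, y => if x ≤ 0 ∨ y ≤ 0 then 0 else pairStep ρ (pairSurv ρ h j) x y

theorem pairStep_mono {ρ : ℝ} (h0 : 0 ≤ ρ) (h1 : ρ ≤ 1) {f g : ℤ → ℤ → ℝ}
    (hfg : ∀ x y, f x y ≤ g x y) (x y : ℤ) : pairStep ρ f x y ≤ pairStep ρ g x y := by
  have h2 : 0 ≤ (1 + if x = y then ρ else 0) / 4 := by split_ifs <;> linarith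
  have h3 : 0 ≤ (1 - if x = y then ρ else 0) / 4 := by split_ifs <;> linarith
  exact add_le_add (mul_le_mul_of_nonneg_left (add_le_add (hfg _ _) (hfg _ _)) h2)
    (mul_le_mul_of_nonneg_left (add_le_add (hfg _ _) (hfg _ _)) h3)

/-- The excess of the joint survival probability over the product. -/
def excess (ρ : ℝ) (h : ℤ) (j : ℕ) (x y : ℤ) : ℝ :=
  pairSurv ρ h j x y - surv h j x * surv h j y

theorem excess_zero (ρ : ℝ) (h : ℤ) (x y : ℤ) : excess ρ h 0 x y = 0 := by
  simp only [excess, pairSurv, surv]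
  by_cases h1 : h < x <;> by_cases h2 : h < y <;> simp [h1, h2]

theorem excess_succ_of_nonpos (ρ : ℝ) (h : ℤ) (j : ℕ) (x y : ℤ) (hxy : x ≤ 0 ∨ y ≤ 0) :
    excess ρ h (j + 1) x y = 0 := by
  simp only [excess, pairSurv, surv]
  rcases hxy with h1 | h1 <;> simp [h1]

/-- The Duhamel recursion. Off the diagonal the product of survival probabilities solves the same
equation as the pair; on the diagonal the correlation adds ρ times the squared half-difference of
`surv`. -/
theorem excess_succ (ρ : ℝ) {h : ℤ} (hh : 0 ≤ h) (j : ℕ) (x y : ℤ) (hx : 1 ≤ x) (hy : 1 ≤ y) :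
    excess ρ h (j + 1) x y =
      pairStep ρ (excess ρ h j) x y + (if x = y then ρ else 0) * (bump h j x / 2) ^ 2 := by
  simp only [excess, pairSurv, surv]
  rw [if_neg (by lia), if_neg (by lia), if_neg (by lia)]
  simp only [pairStep, excess]
  by_cases hxy : x = y
  · subst hxy
    rw [← (surv_sub hh j).2 x hx]
    simp only [if_true]
    ring
  · simp only [if_neg hxy]
    ring

theorem sq_bump_le (h : ℤ) (j : ℕ) (x : ℤ) :
    (bump h j x / 2) ^ 2 ≤ 1 / √(j + 1) * bump h j x := by
  nlinarith [bump_nonneg h j x, bump_le h j x]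

/-- Bound by the total fluctuation of the survival probability, useful near the terminal time. -/
theorem excess_le_bump {ρ : ℝ} (h0 : 0 ≤ ρ) (h1 : ρ ≤ 1) {h : ℤ} (hh : 0 ≤ h) (j : ℕ) (x y : ℤ) :
    excess ρ h (j + 1) x y ≤
      ρ * (∑ i ∈ Finset.range (j + 1), 1 / √((i : ℝ) + 1)) * bump h j x := by
  induction j generalizing x y with
  | zero =>
    by_cases hxy : x ≤ 0 ∨ y ≤ 0
    · rw [excess_succ_of_nonpos _ _ _ _ _ hxy]
      have := bump_nonneg h 0 x
      positivity
    · rw [excess_succ ρ hh _ _ _ (by lia) (by lia)]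
      have h2 := sq_bump_le h 0 x
      have h3 : pairStep ρ (excess ρ h 0) x y = 0 := by
        simp [pairStep, excess_zero]
      have h4 := sq_nonneg (bump h 0 x / 2)
      rw [h3]
      simp only [zero_add, Finset.range_one, Finset.sum_singleton]
      rw [mul_assoc]
      split_ifs
      · exact mul_le_mul_of_nonneg_left h2 h0
      · rw [zero_mul]
        exact mul_nonneg h0 (h4.trans h2)
  | succ j ih =>
    by_cases hxy : x ≤ 0 ∨ y ≤ 0
    · rw [excess_succ_of_nonpos _ _ _ _ _ hxy]
      have := bump_nonneg h (j + 1) x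
      positivity
    · rw [excess_succ ρ hh _ _ _ (by lia) (by lia), Finset.sum_range_succ, mul_add, add_mul]
      gcongr ?_ + ?_
      -- Each walk alone is fair whatever ρ is, so on functions of x only the pair step is plain
      -- averaging, and `bump` is propagated exactly.
      · refine (pairStep_mono h0 h1 ih x y).trans (le_of_eq ?_)
        rw [bump_succ]
        simp only [pairStep]
        ring
      · have h2 := sq_bump_le h (j + 1) x
        have h4 := sq_nonneg (bump h (j + 1) x / 2)
        rw [mul_assoc]
        split_ifs
        · exact mul_le_mul_of_nonneg_left h2 h0
        · rw [zero_mul]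
          exact mul_nonneg h0 (h4.trans h2)

/-- A supersolution that controls the expected time which the two walks spend together. -/
def meetBound (q l : ℝ) (i : ℕ) (x y : ℤ) : ℝ :=
  ((l + (((x - y : ℤ) : ℝ) ^ 2 + 2 * i) / l) / 2 - |((x - y : ℤ) : ℝ)|) / q

theorem meetBound_nonneg {q l : ℝ} (hq : 0 < q) (hl : 0 < l) (i : ℕ) (x y : ℤ) :
    0 ≤ meetBound q l i x y := by
  apply div_nonneg _ hq.le
  set a : ℝ := ((x - y : ℤ) : ℝ)
  -- The arithmetic-geometric mean inequality; this is what makes the quadratic term compensate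
  -- -|a|.
  have h1 : 2 * |a| ≤ l + a ^ 2 / l := by
    have : l + a ^ 2 / l - 2 * |a| = (l - |a|) ^ 2 / l := by
      field_simp
      rw [← sq_abs a]
      ring
    have h2 : 0 ≤ (l - |a|) ^ 2 / l := by positivity
    linarith
  have h2 : a ^ 2 / l ≤ (a ^ 2 + 2 * i) / l := by
    gcongr
    have : (0 : ℝ) ≤ i := by positivity
    linarith
  linarith

/-- Off the diagonal the squared difference gains 2 per step on average, which the term 2i absorbs,
and |x - y| does not decrease in mean. On the diagonal |x - y| gains exactly 1 - ρ, so after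
division by 1 - ρ it pays for the unit source. -/
theorem pairStep_meetBound_le {ρ l : ℝ} (h0 : 0 ≤ ρ) (h1 : ρ < 1) (hl : 0 < l) (i : ℕ) (x y : ℤ) :
    pairStep ρ (meetBound (1 - ρ) l i) x y + (if x = y then 1 else 0) ≤
      meetBound (1 - ρ) l (i + 1) x y := by
  have hq : 0 < 1 - ρ := by linarith
  simp only [pairStep, meetBound]
  push_cast
  by_cases hxy : x = y
  · subst hxy
    simp only [if_true]
    rw [← sub_nonneg]
    have e1 : |(x : ℝ) + 1 - (x - 1)| = 2 := by ring_nf; norm_num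
    have e2 : |(x : ℝ) - 1 - (x + 1)| = 2 := by ring_nf; norm_num
    have e3 : |(x : ℝ) + 1 - (x + 1)| = 0 := by ring_nf; norm_num
    have e4 : |(x : ℝ) - 1 - (x - 1)| = 0 := by ring_nf; norm_num
    have e5 : |(x : ℝ) - x| = 0 := by ring_nf; norm_num
    rw [e1, e2, e3, e4, e5]
    have : 0 ≤ ρ / (l * (1 - ρ)) := by positivity
    refine this.trans (le_of_eq ?_)
    field_simp
    ring
  · simp only [if_neg hxy]
    set a : ℝ := (x : ℝ) - y with ha
    have e1 : (x : ℝ) + 1 - (y + 1) = a := by rw [ha]; ring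
    have e2 : (x : ℝ) - 1 - (y - 1) = a := by rw [ha]; ring
    have e3 : (x : ℝ) + 1 - (y - 1) = a + 2 := by rw [ha]; ring
    have e4 : (x : ℝ) - 1 - (y + 1) = a - 2 := by rw [ha]; ring
    rw [e1, e2, e3, e4]
    have h2 : 2 * |a| ≤ |a + 2| + |a - 2| := by
      have := abs_add_le (a + 2) (a - 2)
      rwa [show a + 2 + (a - 2) = 2 * a by ring, abs_mul, abs_two] at this
    rw [← sub_nonneg]
    have : 0 ≤ (|a + 2| + |a - 2| - 2 * |a|) / (4 * (1 - ρ)) :=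
      div_nonneg (by linarith) (by linarith)
    refine this.trans (le_of_eq ?_)
    field_simp
    ring

/-- Two regimes. In the last J + 1 steps the source is large and is controlled by `excess_le_bump`;
in the first i steps it is at most 4ρ/(J + 1), and the meeting time bound counts how often it is
collected. -/
theorem excess_le_add_meetBound {ρ l : ℝ} (h0 : 0 ≤ ρ) (h1 : ρ < 1) (hl : 0 < l) {h : ℤ}
    (hh : 0 ≤ h) (J i : ℕ) (x y : ℤ) :
    excess ρ h (J + 1 + i) x y ≤
      ρ * (∑ i ∈ Finset.range (J + 1), 1 / √((i : ℝ) + 1)) * bump h (J + i) x +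
        ρ * (4 / (J + 1)) * meetBound (1 - ρ) l i x y := by
  have hq : 0 < 1 - ρ := by linarith
  induction i generalizing x y with
  | zero =>
    have := excess_le_bump h0 h1.le hh J x y
    have h2 := meetBound_nonneg hq hl 0 x y
    have h3 : 0 ≤ ρ * (4 / ((J : ℝ) + 1)) * meetBound (1 - ρ) l 0 x y := by positivity
    simp only [add_zero]
    linarith
  | succ i ih =>
    set S := ρ * ∑ i ∈ Finset.range (J + 1), 1 / √((i : ℝ) + 1) with hS
    have hS0 : 0 ≤ S := by positivity
    by_cases hxy : x ≤ 0 ∨ y ≤ 0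
    · rw [← add_assoc, excess_succ_of_nonpos _ _ _ _ _ hxy]
      have h2 := meetBound_nonneg hq hl (i + 1) x y
      have h3 := bump_nonneg h (J + (i + 1)) x
      positivity
    · rw [← add_assoc, excess_succ ρ hh _ _ _ (by lia) (by lia)]
      have h2 := pairStep_mono h0 h1.le ih x y
      have h3 := pairStep_meetBound_le h0 h1 hl i x y
      have h4 : (bump h (J + 1 + i) x / 2) ^ 2 ≤ 4 / (J + 1) := by
        have h5 := bump_le h (J + 1 + i) x
        have h6 : (bump h (J + 1 + i) x / 2) ^ 2 ≤ (2 * (1 / √((J + 1 + i : ℕ) + 1))) ^ 2 := by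
          have := bump_nonneg h (J + 1 + i) x
          gcongr
          linarith
        refine h6.trans ?_
        rw [mul_pow, div_pow, Real.sq_sqrt (by positivity)]
        rw [show (4 : ℝ) / (J + 1) = 2 ^ 2 * (1 ^ 2 / (J + 1)) by ring]
        gcongr
        have : (0 : ℝ) ≤ i := by positivity
        linarith
      have h5 : pairStep ρ (fun x y => S * bump h (J + i) x +
          ρ * (4 / (J + 1)) * meetBound (1 - ρ) l i x y) x y
          = S * bump h (J + (i + 1)) x +
            ρ * (4 / (J + 1)) * pairStep ρ (meetBound (1 - ρ) l i) x y := by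
        rw [← add_assoc, bump_succ]
        simp only [pairStep]
        ring
      have h6 : (if x = y then ρ else 0) * (bump h (J + 1 + i) x / 2) ^ 2 ≤
          ρ * (4 / (J + 1)) * (if x = y then 1 else 0) := by
        split_ifs
        · rw [mul_one]; gcongr
        · simp
      have h7 : ρ * (4 / ((J : ℝ) + 1)) *
          (pairStep ρ (meetBound (1 - ρ) l i) x y + (if x = y then 1 else 0)) ≤
          ρ * (4 / (J + 1)) * meetBound (1 - ρ) l (i + 1) x y := by gcongr
      rw [h5] at h2
      linarith

theorem sum_one_div_sqrt_le (J : ℕ) : ∑ i ∈ Finset.range J, 1 / √((i : ℝ) + 1) ≤ 2 * √J := by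
  induction J with
  | zero => simp
  | succ J ih =>
    rw [Finset.sum_range_succ]
    have h1 : 1 / √((J : ℝ) + 1) ≤ 2 * (√((J : ℝ) + 1) - √J) := by
      have ha : 0 < √((J : ℝ) + 1) := by positivity
      have hb : 0 ≤ √(J : ℝ) := by positivity
      have hc := Real.sq_sqrt (show (0 : ℝ) ≤ J + 1 by positivity)
      have hd := Real.sq_sqrt (show (0 : ℝ) ≤ J by positivity)
      rw [div_le_iff₀ ha]
      nlinarith [sq_nonneg (√((J : ℝ) + 1) - √J)]
    push_cast
    linarith

/-- The free length l in `meetBound` is taken to be d, the diffusive scale of d² steps, and the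
assumption on ρ gives ρ/(1 - ρ) ≤ 1/δ. -/
theorem excess_le_of_split {ρ δ : ℝ} (h0 : 0 ≤ ρ) (hδ : 0 < δ) (hρ : ρ * (1 + δ) ≤ 1)
    {h : ℤ} (hh : 0 ≤ h) (d J : ℕ) (hJ : J + 1 ≤ d ^ 2) (x : ℤ) :
    excess ρ h (d ^ 2) x x ≤ ρ * (8 * √(J + 1) / d) + 6 * d / (δ * (J + 1)) := by
  have hd : 0 < d := by
    rcases Nat.eq_zero_or_pos d with rfl | hd
    · simp at hJ
    · exact hd
  have hdR : (0 : ℝ) < d := by exact_mod_cast hd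
  have h1 : ρ < 1 := by
    by_contra hc
    nlinarith
  have hq : 0 < 1 - ρ := by linarith
  obtain ⟨i, hi⟩ := Nat.exists_eq_add_of_le hJ
  have key := excess_le_add_meetBound h0 h1 hdR hh J i x x
  rw [← hi] at key
  refine key.trans ?_
  have hs := sum_one_div_sqrt_le (J + 1)
  have hb := bump_le h (J + i) x
  have hJi : ((J + i : ℕ) : ℝ) + 1 = d ^ 2 := by
    have : J + i + 1 = d ^ 2 := by lia
    exact_mod_cast this
  rw [hJi, Real.sqrt_sq hdR.le] at hb
  push_cast at hs
  have hm : meetBound (1 - ρ) d i x x ≤ 3 * d / (2 * (1 - ρ)) := by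
    unfold meetBound
    have hi' : (i : ℝ) ≤ d ^ 2 := by
      have : i ≤ d ^ 2 := by lia
      exact_mod_cast this
    have h2 : 2 * (i : ℝ) / d ≤ 2 * d := by
      rw [div_le_iff₀ hdR]; nlinarith
    simp only [sub_self, Int.cast_zero, abs_zero, sub_zero]
    rw [show 3 * (d : ℝ) / (2 * (1 - ρ)) = ((d : ℝ) + 2 * d) / 2 / (1 - ρ) by field_simp; ring]
    gcongr
    norm_num
    exact h2
  have hρq : ρ / (1 - ρ) ≤ 1 / δ := by
    rw [div_le_div_iff₀ hq hδ]; linarith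
  gcongr ?_ + ?_
  · calc _ ≤ ρ * (2 * √((J : ℝ) + 1)) * (4 * (1 / d)) := by
          have := bump_nonneg h (J + i) x
          gcongr
      _ = _ := by ring
  · calc _ ≤ ρ * (4 / ((J : ℝ) + 1)) * (3 * d / (2 * (1 - ρ))) := by gcongr
      _ = (ρ / (1 - ρ)) * (6 * d / (J + 1)) := by field_simp; ring
      _ ≤ (1 / δ) * (6 * d / (J + 1)) := by gcongr
      _ = _ := by field_simp

theorem pairSurv_mem_Icc {ρ : ℝ} (h0 : 0 ≤ ρ) (h1 : ρ ≤ 1) (h : ℤ) (j : ℕ) (x y : ℤ) :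
    0 ≤ pairSurv ρ h j x y ∧ pairSurv ρ h j x y ≤ 1 := by
  induction j generalizing x y with
  | zero => simp only [pairSurv]; split_ifs <;> norm_num
  | succ j ih =>
    simp only [pairSurv]
    split_ifs
    · norm_num
    · constructor
      · have := pairStep_mono h0 h1 (fun x y => (ih x y).1) x y
        simpa [pairStep] using this
      · refine (pairStep_mono h0 h1 (fun x y => (ih x y).2) x y).trans (le_of_eq ?_)
        simp only [pairStep]
        ring

/-- Decorrelation of the survival of two sticky walks at the diffusive scale. -/
theorem pairSurv_le {ρ δ : ℝ} (h0 : 0 ≤ ρ) (hδ : 0 < δ) (hρ : ρ * (1 + δ) ≤ 1)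
    {h : ℤ} (hh : 0 ≤ h) (d : ℕ) (hd : 0 < d) (x : ℤ) :
    pairSurv ρ h (d ^ 2) x x ≤ surv h (d ^ 2) x ^ 2 + 30 * (δ * d) ^ (-(1 / 3) : ℝ) := by
  have hdR : (0 : ℝ) < d := by exact_mod_cast hd
  have hδd : 0 < δ * d := by positivity
  have h1 : ρ ≤ 1 := by nlinarith
  -- For δd < 1 the error term alone exceeds 1.
  rcases lt_or_ge (δ * d) 1 with hlt | hge
  · have h2 := (pairSurv_mem_Icc h0 h1 h (d ^ 2) x x).2
    have h3 : 1 ≤ (δ * d) ^ (-(1 / 3) : ℝ) :=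
      Real.one_le_rpow_of_pos_of_le_one_of_nonpos hδd hlt.le (by norm_num)
    nlinarith [sq_nonneg (surv h (d ^ 2) x)]
  · set r : ℝ := (δ * d) ^ (-(1 / 3) : ℝ) with hr
    have hr0 : 0 < r := Real.rpow_pos_of_pos hδd _
    have hr1 : r ≤ 1 := Real.rpow_le_one_of_one_le_of_nonpos hge (by norm_num)
    have hr3 : r ^ 3 * (δ * d) = 1 := by
      rw [hr, ← Real.rpow_natCast, ← Real.rpow_mul hδd.le]
      norm_num
      rw [Real.rpow_neg_one, inv_mul_cancel₀ hδd.ne']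
    -- The split J ≈ (dr)² balances the two errors √J/d and d/(δJ): both become of order r because
    -- r³ δ d = 1. This is the origin of the exponent 1/3.
    set y : ℝ := d ^ 2 * r ^ 2 with hy
    have hy0 : 0 < y := by positivity
    have hyd : y ≤ d ^ 2 := by
      have : r ^ 2 ≤ 1 := by nlinarith
      rw [hy]; nlinarith [sq_nonneg (d : ℝ)]
    set J : ℕ := ⌈y⌉₊ - 1 with hJ
    have hc : 0 < ⌈y⌉₊ := Nat.ceil_pos.2 hy0
    have hJ1 : J + 1 = ⌈y⌉₊ := by lia
    have hJd : J + 1 ≤ d ^ 2 := by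
      rw [hJ1, Nat.ceil_le]; exact_mod_cast hyd
    have hJR : ((J : ℝ) + 1) = ⌈y⌉₊ := by exact_mod_cast hJ1
    have key := excess_le_of_split h0 hδ hρ hh d J hJd x
    rw [hJR] at key
    have hle : y ≤ ⌈y⌉₊ := Nat.le_ceil y
    have hdr : 1 ≤ δ * d * r ^ 3 := by linarith
    have h2 : 6 * d / (δ * ⌈y⌉₊) ≤ 6 * r := by
      rw [div_le_iff₀ (by positivity)]
      calc 6 * (d : ℝ) = 6 * d * (r ^ 3 * (δ * d)) := by rw [hr3, mul_one]
        _ = 6 * r * (δ * y) := by rw [hy]; ring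
        _ ≤ _ := by gcongr
    by_cases hy1 : 1 ≤ y
    · have h3 : (⌈y⌉₊ : ℝ) ≤ (2 * (d * r)) ^ 2 := by
        have := Nat.ceil_lt_add_one hy0.le
        calc (⌈y⌉₊ : ℝ) ≤ y + 1 := this.le
          _ ≤ 4 * y := by linarith
          _ = _ := by rw [hy]; ring
      have h4 : √(⌈y⌉₊ : ℝ) ≤ 2 * (d * r) := by
        rw [← Real.sqrt_sq (show 0 ≤ 2 * (d * r) by positivity)]
        exact Real.sqrt_le_sqrt h3
      have h5 : 8 * √(⌈y⌉₊ : ℝ) / d ≤ 16 * r := by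
        rw [div_le_iff₀ hdR]
        nlinarith
      have h6 : ρ * (8 * √(⌈y⌉₊ : ℝ) / d) ≤ 16 * r :=
        (mul_le_of_le_one_left (by positivity) h1).trans h5
      unfold excess at key
      nlinarith
    -- Now J = 0 and √(J + 1) is no longer comparable to dr; the bound ρ ≤ 1/δ gives 8/(δd) = 8r³
    -- instead.
    · have h3 : ⌈y⌉₊ = 1 := by
        refine le_antisymm ?_ hc
        rw [Nat.ceil_le]
        push_cast
        linarith
      have h4 : ρ * (8 * √(⌈y⌉₊ : ℝ) / d) ≤ 8 * r := by
        rw [h3]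
        have h5 : ρ ≤ 1 / δ := by rw [le_div_iff₀ hδ]; nlinarith
        have h6 : r ^ 3 ≤ r := by
          have : r ^ 2 ≤ 1 := by nlinarith
          nlinarith
        have h7 : 1 / (δ * d) = r ^ 3 := by field_simp; linarith
        calc ρ * (8 * √((1 : ℕ) : ℝ) / d) ≤ 1 / δ * (8 * √((1 : ℕ) : ℝ) / d) := by gcongr
          _ = 8 * (1 / (δ * d)) := by simp; field_simp
          _ ≤ _ := by rw [h7]; linarith
      unfold excess at key
      nlinarith

/-! ### Measurability and independence of the noise -/

section Noise

variable {Ω : Type*}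

/-- All the waiting times and the coins, as one family of real random variables. -/
def noise (W : Site → ℕ → Ω → ℝ) (ε : Site → ℕ → Ω → Bool) (p : (Site × ℕ) × Bool) (ω : Ω) : ℝ :=
  if p.2 then W p.1.1 p.1.2 ω else if ε p.1.1 p.1.2 ω then 1 else 0

/-- The σ-algebra generated by the part of the noise with index in `S`. -/
@[reducible]
def noiseAlg (W : Site → ℕ → Ω → ℝ) (ε : Site → ℕ → Ω → Bool) (S : Set ((Site × ℕ) × Bool)) :
    MeasurableSpace Ω :=
  ⨆ p ∈ S, MeasurableSpace.comap (noise W ε p) inferInstance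

/-- The time at which the clock at `z` rings for the `n`-th time. -/
def ringTime (W : Site → ℕ → Ω → ℝ) (z : Site) (n : ℕ) (ω : Ω) : ℝ :=
  ∑ i ∈ Finset.range n, W z i ω

theorem ringTime_succ (W : Site → ℕ → Ω → ℝ) (z : Site) (n : ℕ) (ω : Ω) :
    ringTime W z (n + 1) ω = ringTime W z n ω + W z n ω :=
  Finset.sum_range_succ _ _

theorem rings_eq (W : Site → ℕ → Ω → ℝ) (τ : ℝ) (ω : Ω) (z : Site) :
    rings W τ ω z = Set.ncard {n : ℕ | ringTime W z (n + 1) ω ≤ τ} := rfl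

variable {W : Site → ℕ → Ω → ℝ} {ε : Site → ℕ → Ω → Bool}

theorem measurable_noise {S : Set ((Site × ℕ) × Bool)} {p : (Site × ℕ) × Bool} (hp : p ∈ S) :
    Measurable[noiseAlg W ε S] (noise W ε p) :=
  measurable_iff_comap_le.2 (le_biSup (fun p => MeasurableSpace.comap (noise W ε p) _) hp)

theorem noiseAlg_measurable_wait {S : Set ((Site × ℕ) × Bool)} {z : Site} {n : ℕ}
    (h : ((z, n), true) ∈ S) : Measurable[noiseAlg W ε S] (W z n) :=
  measurable_noise h

theorem noiseAlg_measurable_coin {S : Set ((Site × ℕ) × Bool)} {z : Site} {n : ℕ}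
    (h : ((z, n), false) ∈ S) : Measurable[noiseAlg W ε S] (ε z n) := by
  have h1 : Measurable[noiseAlg W ε S] (noise W ε ((z, n), false)) := measurable_noise h
  have h2 : ε z n = (fun x : ℝ => decide (x = 1)) ∘ noise W ε ((z, n), false) := by
    ext ω
    rcases hb : ε z n ω <;> simp [noise, hb]
  rw [h2]
  refine Measurable.comp ?_ h1
  refine measurable_to_bool ?_
  have : (fun x : ℝ => decide (x = 1)) ⁻¹' {true} = {1} := by ext; simp
  rw [this]
  exact measurableSet_singleton _

theorem noiseAlg_measurable_ringTime {S : Set ((Site × ℕ) × Bool)} {z : Site} {n : ℕ}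
    (h : ∀ i < n, ((z, i), true) ∈ S) : Measurable[noiseAlg W ε S] (ringTime W z n) := by
  refine Finset.measurable_fun_sum _ fun i hi => ?_
  exact noiseAlg_measurable_wait (h i (Finset.mem_range.1 hi))

theorem measurable_ncard {α : Type*} [MeasurableSpace α] {s : ℕ → Set α}
    (hs : ∀ n, MeasurableSet (s n)) : Measurable fun a => Set.ncard {n : ℕ | a ∈ s n} := by
  have key : ∀ F : Finset ℕ, MeasurableSet {a | {n : ℕ | a ∈ s n} = (F : Set ℕ)} := by
    intro F
    have : {a | {n : ℕ | a ∈ s n} = (F : Set ℕ)} = ⋂ n, {a | a ∈ s n ↔ n ∈ F} := by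
      ext a
      simp [Set.ext_iff]
    rw [this]
    refine MeasurableSet.iInter fun n => ?_
    by_cases hn : n ∈ F
    · simpa [hn] using hs n
    · have : {a | a ∈ s n ↔ n ∈ F} = (s n)ᶜ := by ext a; simp [hn]
      rw [this]
      exact (hs n).compl
  have hpos : ∀ m : ℕ, m ≠ 0 → MeasurableSet {a | Set.ncard {n : ℕ | a ∈ s n} = m} := by
    intro m hm
    have : {a | Set.ncard {n : ℕ | a ∈ s n} = m}
        = ⋃ F : {F : Finset ℕ // F.card = m}, {a | {n : ℕ | a ∈ s n} = (F.1 : Set ℕ)} := by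
      ext a
      simp only [Set.mem_ofPred_eq, Set.mem_iUnion, Subtype.exists, exists_prop]
      constructor
      · intro h
        have hfin : {n : ℕ | a ∈ s n}.Finite := Set.finite_of_ncard_ne_zero (by rw [h]; exact hm)
        refine ⟨hfin.toFinset, ?_, by simp⟩
        rw [← h, Set.ncard_eq_toFinset_card _ hfin]
      · rintro ⟨F, hF, h⟩
        rw [h, Set.ncard_coe_finset, hF]
    rw [this]
    exact MeasurableSet.iUnion fun F => key F.1
  refine measurable_to_countable' fun m => ?_
  by_cases hm : m = 0
  -- `Set.ncard` is 0 on infinite sets too, so this fibre is obtained as the complement of the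
  -- others.
  · subst hm
    have : (fun a => Set.ncard {n : ℕ | a ∈ s n}) ⁻¹' {0}
        = (⋃ m : ℕ, {a | Set.ncard {n : ℕ | a ∈ s n} = m + 1})ᶜ := by
      ext a
      simp only [Set.mem_preimage, Set.mem_singleton_iff, Set.mem_compl_iff, Set.mem_iUnion,
        Set.mem_ofPred_eq, not_exists]
      constructor
      · intro h m; lia
      · intro h
        by_contra hc
        exact h _ (Nat.succ_pred_eq_of_ne_zero hc).symm
    rw [this]
    exact (MeasurableSet.iUnion fun m => hpos (m + 1) (by lia)).compl
  · exact hpos m hm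

theorem measurable_comp_index {α : Type*} [MeasurableSpace α] {N : α → ℕ} (hN : Measurable N)
    {f : ℕ → α → Bool} (hf : ∀ n, Measurable (f n)) : Measurable fun a => f (N a) a := by
  refine measurable_to_bool ?_
  have : (fun a => f (N a) a) ⁻¹' {true} = ⋃ n, N ⁻¹' {n} ∩ f n ⁻¹' {true} := by
    ext a
    simp
  rw [this]
  exact MeasurableSet.iUnion fun n => (hN (measurableSet_singleton n)).inter
    (hf n (measurableSet_singleton true))

theorem noiseAlg_measurable_rings {S : Set ((Site × ℕ) × Bool)} {z : Site}
    (h : ∀ i, ((z, i), true) ∈ S) (τ : ℝ) :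
    Measurable[noiseAlg W ε S] fun ω => rings W τ ω z := by
  let _ : MeasurableSpace Ω := noiseAlg W ε S
  have h1 : ∀ n, MeasurableSet {ω | ringTime W z (n + 1) ω ≤ τ} := fun n =>
    measurableSet_le (noiseAlg_measurable_ringTime fun i _ => h i) measurable_const
  exact measurable_ncard h1

theorem noiseAlg_measurable_arrows {S : Set ((Site × ℕ) × Bool)} {z : Site}
    (h : ∀ i b, ((z, i), b) ∈ S) (τ : ℝ) :
    Measurable[noiseAlg W ε S] fun ω => arrows W ε τ ω z := by
  let _ : MeasurableSpace Ω := noiseAlg W ε S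
  exact measurable_comp_index (noiseAlg_measurable_rings (fun i => h i true) τ)
    fun n => noiseAlg_measurable_coin (h n false)

/-- The σ-algebra generated by the clocks and coins at the sites in `T`. -/
@[reducible]
def siteAlg (W : Site → ℕ → Ω → ℝ) (ε : Site → ℕ → Ω → Bool) (T : Set Site) :
    MeasurableSpace Ω := noiseAlg W ε {p | p.1.1 ∈ T}

theorem siteAlg_mono {S T : Set Site} (h : S ⊆ T) : siteAlg W ε S ≤ siteAlg W ε T :=
  biSup_mono fun _ hp => h hp

theorem siteAlg_measurable_arrows {T : Set Site} {z : Site} (h : z ∈ T) (τ : ℝ) :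
    Measurable[siteAlg W ε T] fun ω => arrows W ε τ ω z :=
  noiseAlg_measurable_arrows (fun _ _ => h) τ

/-- The almost sure properties of the clocks. -/
def GoodClocks (W : Site → ℕ → Ω → ℝ) (ω : Ω) : Prop :=
  ∀ z, (∀ n, 0 < W z n ω) ∧ ∀ t : ℝ, ∃ n, t < ringTime W z n ω

theorem GoodClocks.strictMono {ω : Ω} (hω : GoodClocks W ω) (z : Site) :
    StrictMono fun n => ringTime W z n ω :=
  strictMono_nat_of_lt_succ fun n => by
    rw [ringTime_succ]
    linarith [(hω z).1 n]

/-- With increasing, unbounded ring times the counted set is an initial segment, so the count is the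
last index rung. -/
theorem GoodClocks.rings_eq_iff {ω : Ω} (hω : GoodClocks W ω) (z : Site) {τ : ℝ} (hτ : 0 ≤ τ)
    (n : ℕ) : rings W τ ω z = n ↔ ringTime W z n ω ≤ τ ∧ τ < ringTime W z (n + 1) ω := by
  classical
  have hmono := hω.strictMono z
  have hex : ∃ n, τ < ringTime W z (n + 1) ω := by
    obtain ⟨n, hn⟩ := (hω z).2 τ
    exact ⟨n, hn.trans (hmono (Nat.lt_succ_self n))⟩
  set N := Nat.find hex with hN
  have hN1 : τ < ringTime W z (N + 1) ω := Nat.find_spec hex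
  have hN0 : ringTime W z N ω ≤ τ := by
    rcases Nat.eq_zero_or_pos N with h0 | h0
    · rw [h0]; simpa [ringTime] using hτ
    · obtain ⟨k, hk⟩ := Nat.exists_eq_succ_of_ne_zero h0.ne'
      have := Nat.find_min hex (m := k) (by rw [← hN, hk]; exact Nat.lt_succ_self k)
      rw [hk]
      exact not_lt.1 this
  have hset : {n : ℕ | ringTime W z (n + 1) ω ≤ τ} = (Finset.range N : Set ℕ) := by
    ext n
    simp only [Set.mem_ofPred_eq, Finset.coe_range, Set.mem_Iio]
    constructor
    · intro hn
      by_contra hc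
      have : ringTime W z (N + 1) ω ≤ ringTime W z (n + 1) ω := hmono.monotone (by lia)
      linarith
    · intro hn
      exact (hmono.monotone (show n + 1 ≤ N by lia)).trans hN0
  have hr : rings W τ ω z = N := by
    rw [rings_eq, hset, Set.ncard_coe_finset, Finset.card_range]
  rw [hr]
  constructor
  · rintro rfl
    exact ⟨hN0, hN1⟩
  · rintro ⟨h1, h2⟩
    have a1 : N < n + 1 := hmono.lt_iff_lt.1 (show ringTime W z N ω < ringTime W z (n + 1) ω by
      linarith)
    have a2 : n < N + 1 := hmono.lt_iff_lt.1 (show ringTime W z n ω < ringTime W z (N + 1) ω by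
      linarith)
    lia

variable [mΩ : MeasurableSpace Ω] {P : Measure Ω}

theorem IsWebNoise.measurable_noise (h : IsWebNoise P W ε) (p : (Site × ℕ) × Bool) :
    Measurable (noise W ε p) := by
  unfold noise
  split_ifs
  · exact h.measurable_wait _ _
  · exact Measurable.ite (h.measurable_coin _ _ (measurableSet_singleton true))
      measurable_const measurable_const

theorem IsWebNoise.noiseAlg_le (h : IsWebNoise P W ε) (S : Set ((Site × ℕ) × Bool)) :
    noiseAlg W ε S ≤ mΩ :=
  iSup₂_le fun p _ => (h.measurable_noise p).comap_le

theorem IsWebNoise.siteAlg_le (h : IsWebNoise P W ε) (T : Set Site) : siteAlg W ε T ≤ mΩ :=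
  h.noiseAlg_le _

theorem measurable_arrows_prod (h : IsWebNoise P W ε) (z : Site) :
    Measurable fun p : ℝ × Ω => arrows W ε p.1 p.2 z := by
  have h1 : ∀ n, MeasurableSet {p : ℝ × Ω | ringTime W z (n + 1) p.2 ≤ p.1} := by
    intro n
    refine measurableSet_le ?_ measurable_fst
    exact Finset.measurable_fun_sum _ fun i _ => (h.measurable_wait z i).comp measurable_snd
  exact measurable_comp_index (measurable_ncard h1)
    fun n => (h.measurable_coin z n).comp measurable_snd

theorem IsWebNoise.law_wait (h : IsWebNoise P W ε) (z : Site) (n : ℕ) :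
    P.map (W z n) = expMeasure 1 := by
  have : IsProbabilityMeasure (expMeasure 1) := isProbabilityMeasure_expMeasure one_pos
  have : IsProbabilityMeasure fairCoin := by unfold fairCoin; infer_instance
  have h1 := congrArg (Measure.map Prod.fst) (h.law z n)
  rwa [Measure.map_map measurable_fst ((h.measurable_wait z n).prodMk (h.measurable_coin z n)),
    Measure.map_fst_prod, measure_univ, one_smul] at h1

theorem IsWebNoise.law_coin (h : IsWebNoise P W ε) (z : Site) (n : ℕ) :
    P.map (ε z n) = fairCoin := by
  have : IsProbabilityMeasure (expMeasure 1) := isProbabilityMeasure_expMeasure one_pos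
  have : IsProbabilityMeasure fairCoin := by unfold fairCoin; infer_instance
  have h1 := congrArg (Measure.map Prod.snd) (h.law z n)
  rwa [Measure.map_map measurable_snd ((h.measurable_wait z n).prodMk (h.measurable_coin z n)),
    Measure.map_snd_prod, measure_univ, one_smul] at h1

/-- Conditioning on a discrete variable: a constant conditional probability can be checked fibre by
fibre. -/
theorem measure_inter_eq_mul_of_fibers {ι : Type*} [Countable ι] [MeasurableSpace ι]
    [MeasurableSingletonClass ι] {X : Ω → ι} (hX : Measurable X) {E A : Set Ω} {c : ℝ≥0∞}
    (hc : ∀ i, P (E ∩ A ∩ X ⁻¹' {i}) = c * P (A ∩ X ⁻¹' {i})) : P (E ∩ A) = c * P A := by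
  have key : ∀ B : Set Ω, P B = ∑' i, P (B ∩ X ⁻¹' {i}) := by
    intro B
    have h1 := measure_iUnion (μ := P.restrict B) (f := fun i => X ⁻¹' {i})
      (fun i j hij => Set.disjoint_left.2 fun ω h1 h2 => hij (by
        simp only [Set.mem_preimage, Set.mem_singleton_iff] at h1 h2
        exact h1.symm.trans h2)) (fun i => hX (measurableSet_singleton i))
    have h2 : ⋃ i, X ⁻¹' {i} = Set.univ := by ext; simp
    rw [h2, Measure.restrict_apply_univ] at h1
    rw [h1]
    refine tsum_congr fun i => ?_
    rw [Measure.restrict_apply (hX (measurableSet_singleton i)), Set.inter_comm]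
  rw [key (E ∩ A), key A, ← ENNReal.tsum_mul_left]
  exact tsum_congr hc

theorem IsWebNoise.measure_coin (h : IsWebNoise P W ε) (z : Site) (n : ℕ) (b : Bool) :
    P {ω | ε z n ω = b} = 2⁻¹ := by
  have h1 : P {ω | ε z n ω = b} = P.map (ε z n) {b} := by
    rw [Measure.map_apply (h.measurable_coin z n) (measurableSet_singleton b)]
    rfl
  rw [h1, h.law_coin, fairCoin, PMF.toMeasure_apply_singleton _ _ (measurableSet_singleton b)]
  simp

variable [IsProbabilityMeasure P]

theorem IsWebNoise.indepFun_wait_coin (h : IsWebNoise P W ε) (z : Site) (n : ℕ) :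
    IndepFun (W z n) (ε z n) P := by
  rw [indepFun_iff_map_prod_eq_prod_map_map (h.measurable_wait z n).aemeasurable
    (h.measurable_coin z n).aemeasurable, h.law, h.law_wait, h.law_coin]

/-- Independence across pairs combined with independence inside each pair. With one flat family, any
two disjoint sets of indices give independent σ-algebras, whether separated by site, by ring number
or by type. -/
theorem IsWebNoise.iIndepFun_noise (h : IsWebNoise P W ε) : iIndepFun (noise W ε) P := by
  have hm : ∀ (i : Site × ℕ) (j : Bool), Measurable (noise W ε (i, j)) :=
    fun i j => h.measurable_noise (i, j)
  refine iIndepFun_uncurry' (X := fun i j => noise W ε (i, j)) hm ?_ ?_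
  · have hg : Measurable fun (p : ℝ × Bool) (j : Bool) => if j then p.1 else
        if p.2 then (1 : ℝ) else 0 := by
      refine measurable_pi_lambda _ fun j => ?_
      cases j
      · simp only [Bool.false_eq_true, if_false]
        exact Measurable.ite (measurable_snd (measurableSet_singleton true))
          measurable_const measurable_const
      · simpa using measurable_fst
    exact h.indep.comp _ fun _ => hg
  · intro i
    have h1 : IndepFun (noise W ε (i, true)) (noise W ε (i, false)) P := by
      have := (h.indepFun_wait_coin i.1 i.2).comp (φ := id)
        (ψ := fun b : Bool => if b then (1 : ℝ) else 0) measurable_id (measurable_of_countable _)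
      exact this
    rw [iIndepFun_iff_measure_inter_preimage_eq_mul]
    intro S sets H
    rw [indepFun_iff_measure_inter_preimage_eq_mul] at h1
    by_cases ht : true ∈ S <;> by_cases hf : false ∈ S
    · have hS : S = {true, false} := by ext b; cases b <;> simp [ht, hf]
      subst hS
      have := h1 _ _ (H true ht) (H false hf)
      rw [Finset.set_biInter_insert, Finset.set_biInter_singleton, Finset.prod_pair (by simp)]
      exact this
    · have hS : S = {true} := by ext b; cases b <;> simp [ht, hf]
      subst hS
      simp
    · have hS : S = {false} := by ext b; cases b <;> simp [ht, hf]
      subst hS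
      simp
    · have hS : S = ∅ := by ext b; cases b <;> simp [ht, hf]
      subst hS
      simp

theorem IsWebNoise.indep_noiseAlg (h : IsWebNoise P W ε) {S T : Set ((Site × ℕ) × Bool)}
    (hST : Disjoint S T) : Indep (noiseAlg W ε S) (noiseAlg W ε T) P :=
  indep_iSup_of_disjoint (fun p => (h.measurable_noise p).comap_le)
    ((iIndepFun_iff_iIndep _ _ _).1 h.iIndepFun_noise) hST

theorem IsWebNoise.measure_inter_of_disjoint (h : IsWebNoise P W ε) {S T : Set ((Site × ℕ) × Bool)}
    (hST : Disjoint S T) {A B : Set Ω} (hA : MeasurableSet[noiseAlg W ε S] A)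
    (hB : MeasurableSet[noiseAlg W ε T] B) : P (A ∩ B) = P A * P B :=
  (Indep_iff _ _ _).1 (h.indep_noiseAlg hST) A B hA hB

theorem IsWebNoise.measure_inter_of_disjoint_sites (h : IsWebNoise P W ε) {S T : Set Site}
    (hST : Disjoint S T) {A B : Set Ω} (hA : MeasurableSet[siteAlg W ε S] A)
    (hB : MeasurableSet[siteAlg W ε T] B) : P (A ∩ B) = P A * P B :=
  h.measure_inter_of_disjoint
    (Set.disjoint_left.2 fun _ h1 h2 => Set.disjoint_left.1 hST h1 h2) hA hB

/-! ### The clocks -/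

theorem expMeasure_Iic (x : ℝ) :
    (expMeasure 1) (Set.Iic x) = ENNReal.ofReal (if 0 ≤ x then 1 - Real.exp (-x) else 0) := by
  have : IsProbabilityMeasure (expMeasure 1) := isProbabilityMeasure_expMeasure one_pos
  rw [← ofReal_cdf, cdf_expMeasure_eq one_pos, one_mul]

theorem expMeasure_Ioi {x : ℝ} (hx : 0 ≤ x) :
    (expMeasure 1) (Set.Ioi x) = ENNReal.ofReal (Real.exp (-x)) := by
  have : IsProbabilityMeasure (expMeasure 1) := isProbabilityMeasure_expMeasure one_pos
  rw [← Set.compl_Iic, prob_compl_eq_one_sub measurableSet_Iic, expMeasure_Iic, if_pos hx,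
    ← ENNReal.ofReal_one, ← ENNReal.ofReal_sub _ (by simp [hx])]
  congr 1
  ring

theorem IsWebNoise.ae_goodClocks (h : IsWebNoise P W ε) : ∀ᵐ ω ∂P, GoodClocks W ω := by
  unfold GoodClocks
  rw [ae_all_iff]
  intro z
  have hpos : ∀ᵐ ω ∂P, ∀ n, 0 < W z n ω := by
    rw [ae_all_iff]
    intro n
    have h1 : P (W z n ⁻¹' Set.Iic 0) = 0 := by
      rw [← Measure.map_apply (h.measurable_wait z n) measurableSet_Iic, h.law_wait,
        expMeasure_Iic]
      simp
    filter_upwards [measure_eq_zero_iff_ae_notMem.1 h1] with ω hω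
    simpa using hω
  -- Unbounded ring times follow from a single long waiting time, and all waits staying below t has
  -- probability zero by independence.
  have hdiv : ∀ᵐ ω ∂P, ∀ t : ℕ, ∃ n, (t : ℝ) < W z n ω := by
    rw [ae_all_iff]
    intro t
    have hle : ∀ n, P (W z n ⁻¹' Set.Iic (t : ℝ)) = ENNReal.ofReal (1 - Real.exp (-t)) := by
      intro n
      rw [← Measure.map_apply (h.measurable_wait z n) measurableSet_Iic, h.law_wait,
        expMeasure_Iic, if_pos (by positivity)]
    have h1 : ∀ m : ℕ, P (⋂ n ∈ Finset.range m, W z n ⁻¹' Set.Iic (t : ℝ)) =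
        ENNReal.ofReal (1 - Real.exp (-t)) ^ m := by
      intro m
      have hw : iIndepFun (fun n : ℕ => noise W ε ((z, n), true)) P :=
        h.iIndepFun_noise.precomp (g := fun n : ℕ => (((z, n), true) : (Site × ℕ) × Bool))
          (fun a b hab => by simpa using hab)
      have := (iIndepFun_iff_measure_inter_preimage_eq_mul.1 hw) (Finset.range m)
        (sets := fun _ => Set.Iic (t : ℝ)) (fun _ _ => measurableSet_Iic)
      have h2 : ∀ n : ℕ, noise W ε ((z, n), true) = W z n := fun n => rfl
      simp only [h2] at this
      rw [this]
      simp [hle]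
    have h3 : P {ω | ∀ n, W z n ω ≤ t} = 0 := by
      have h4 : ∀ m : ℕ, P {ω | ∀ n, W z n ω ≤ t} ≤ ENNReal.ofReal (1 - Real.exp (-t)) ^ m := by
        intro m
        rw [← h1 m]
        refine measure_mono fun ω hω => ?_
        simp only [Set.mem_iInter]
        exact fun n _ => hω n
      have h5 : Filter.Tendsto (fun m : ℕ => ENNReal.ofReal (1 - Real.exp (-t)) ^ m)
          Filter.atTop (𝓝 0) := by
        apply ENNReal.tendsto_pow_atTop_nhds_zero_of_lt_one
        rw [ENNReal.ofReal_lt_one]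
        linarith [Real.exp_pos (-(t : ℝ))]
      exact le_antisymm (ge_of_tendsto' h5 h4) zero_le
    filter_upwards [measure_eq_zero_iff_ae_notMem.1 h3] with ω hω
    simpa using hω
  filter_upwards [hpos, hdiv] with ω h1 h2
  refine ⟨h1, fun t => ?_⟩
  obtain ⟨k, hk⟩ := exists_nat_ge t
  obtain ⟨n, hn⟩ := h2 k
  refine ⟨n + 1, ?_⟩
  rw [ringTime_succ]
  have : 0 ≤ ringTime W z n ω := Finset.sum_nonneg fun i _ => (h1 i).le
  linarith

/-- Lack of memory of the exponential law, integrated over the n-th ring time, which is independent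
of the next wait. -/
theorem IsWebNoise.measure_ringTime (h : IsWebNoise P W ε) (z : Site) (n : ℕ) {τ δ : ℝ}
    (hδ : 0 ≤ δ) :
    P {ω | ringTime W z n ω ≤ τ ∧ τ + δ < ringTime W z (n + 1) ω} =
      ENNReal.ofReal (Real.exp (-δ)) *
        P {ω | ringTime W z n ω ≤ τ ∧ τ < ringTime W z (n + 1) ω} := by
  have : IsProbabilityMeasure (expMeasure 1) := isProbabilityMeasure_expMeasure one_pos
  have hS : Measurable (ringTime W z n) := Finset.measurable_fun_sum _ fun i _ =>
    h.measurable_wait z i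
  have hind : IndepFun (ringTime W z n) (W z n) P := by
    rw [IndepFun_iff_Indep]
    have h1 : Disjoint {p : (Site × ℕ) × Bool | p.1.2 < n} {p | p.1.2 = n} :=
      Set.disjoint_left.2 fun p h1 h2 => by
        simp only [Set.mem_ofPred_eq] at h1 h2
        lia
    refine indep_of_indep_of_le_left (indep_of_indep_of_le_right (h.indep_noiseAlg h1) ?_) ?_
    · exact (noiseAlg_measurable_wait (by simp)).comap_le
    · exact (noiseAlg_measurable_ringTime (by simp)).comap_le
  have hlaw := hind.map_prod_eq_prod_map_map hS.aemeasurable (h.measurable_wait z n).aemeasurable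
  rw [h.law_wait] at hlaw
  have key : ∀ t : ℝ, P {ω | ringTime W z n ω ≤ τ ∧ t < ringTime W z (n + 1) ω} =
      ∫⁻ s, (expMeasure 1) {w | s ≤ τ ∧ t < s + w} ∂(P.map (ringTime W z n)) := by
    intro t
    have hset : MeasurableSet {p : ℝ × ℝ | p.1 ≤ τ ∧ t < p.1 + p.2} :=
      (measurableSet_le measurable_fst measurable_const).inter
        (measurableSet_lt measurable_const (measurable_fst.add measurable_snd))
    have h2 : P {ω | ringTime W z n ω ≤ τ ∧ t < ringTime W z (n + 1) ω} =
        P.map (fun ω => (ringTime W z n ω, W z n ω)) {p : ℝ × ℝ | p.1 ≤ τ ∧ t < p.1 + p.2} := by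
      rw [Measure.map_apply (hS.prodMk (h.measurable_wait z n)) hset]
      simp only [ringTime_succ]
      rfl
    rw [h2, hlaw, Measure.prod_apply hset]
    rfl
  rw [key, key, ← lintegral_const_mul' _ _ ENNReal.ofReal_ne_top]
  refine lintegral_congr fun s => ?_
  by_cases hs : s ≤ τ
  · have h3 : ∀ t, {w | s ≤ τ ∧ t < s + w} = Set.Ioi (t - s) := by
      intro t; ext w; simp only [Set.mem_ofPred_eq, Set.mem_Ioi, hs, true_and]
      constructor <;> intro h <;> linarith
    rw [h3, h3, expMeasure_Ioi (by linarith), expMeasure_Ioi (by linarith),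
      ← ENNReal.ofReal_mul (Real.exp_pos _).le, ← Real.exp_add]
    congr 2
    ring
  · simp [hs]

/-- The probability that the clock at `z` does not ring during `(τ, τ + δ]`. -/
theorem IsWebNoise.measure_rings_eq (h : IsWebNoise P W ε) (z : Site) {τ δ : ℝ} (hτ : 0 ≤ τ)
    (hδ : 0 ≤ δ) :
    P {ω | rings W τ ω z = rings W (τ + δ) ω z} = ENNReal.ofReal (Real.exp (-δ)) := by
  have hN : Measurable fun ω => rings W τ ω z :=
    (noiseAlg_measurable_rings (ε := ε) (S := Set.univ) (fun _ => trivial) τ).mono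
      (h.noiseAlg_le _) le_rfl
  have := measure_inter_eq_mul_of_fibers (P := P) hN
    (E := {ω | rings W τ ω z = rings W (τ + δ) ω z}) (A := Set.univ)
    (c := ENNReal.ofReal (Real.exp (-δ))) ?_
  · simpa using this
  · intro n
    simp only [Set.inter_univ, Set.univ_inter]
    have h1 : P ((fun ω => rings W τ ω z) ⁻¹' {n}) =
        P {ω | ringTime W z n ω ≤ τ ∧ τ < ringTime W z (n + 1) ω} := by
      refine measure_congr ?_
      filter_upwards [h.ae_goodClocks] with ω hω
      exact propext (hω.rings_eq_iff z hτ n)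
    have h2 : P ({ω | rings W τ ω z = rings W (τ + δ) ω z} ∩ (fun ω => rings W τ ω z) ⁻¹' {n}) =
        P {ω | ringTime W z n ω ≤ τ ∧ τ + δ < ringTime W z (n + 1) ω} := by
      refine measure_congr ?_
      filter_upwards [h.ae_goodClocks] with ω hω
      refine propext ?_
      have a1 := hω.rings_eq_iff z hτ n
      have a2 := hω.rings_eq_iff z (show 0 ≤ τ + δ by linarith) n
      change (rings W τ ω z = rings W (τ + δ) ω z ∧ rings W τ ω z = n) ↔ _ ∧ _
      constructor
      · rintro ⟨b1, b2⟩
        exact ⟨(a1.1 b2).1, (a2.1 (b1 ▸ b2)).2⟩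
      · rintro ⟨b1, b2⟩
        have c1 := a1.2 ⟨b1, by linarith⟩
        have c2 := a2.2 ⟨by linarith, b2⟩
        exact ⟨c1.trans c2.symm, c1⟩
    rw [h1, h2]
    exact h.measure_ringTime z n hδ

theorem IsWebNoise.measure_two_coins (h : IsWebNoise P W ε) (z : Site) {m n : ℕ} (hmn : m ≠ n)
    (b c : Bool) : P {ω | ε z m ω = b ∧ ε z n ω = c} = 4⁻¹ := by
  have h1 : Disjoint {p : (Site × ℕ) × Bool | p.1.2 = m} {p | p.1.2 = n} :=
    Set.disjoint_left.2 fun p h1 h2 => hmn (by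
      simp only [Set.mem_ofPred_eq] at h1 h2
      lia)
  have h2 := h.measure_inter_of_disjoint h1 (A := {ω | ε z m ω = b}) (B := {ω | ε z n ω = c})
    (noiseAlg_measurable_coin (by simp) (measurableSet_singleton b))
    (noiseAlg_measurable_coin (by simp) (measurableSet_singleton c))
  rw [h.measure_coin, h.measure_coin] at h2
  refine h2.trans ?_
  rw [← ENNReal.mul_inv (by simp) (by simp)]
  norm_num

/-- The joint law of the arrow at `z` at two dynamical times. -/
theorem IsWebNoise.measure_arrows_pair (h : IsWebNoise P W ε) (z : Site) {τ δ : ℝ} (hτ : 0 ≤ τ)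
    (hδ : 0 ≤ δ) (b c : Bool) :
    P.real {ω | arrows W ε τ ω z = b ∧ arrows W ε (τ + δ) ω z = c} =
      (1 + (if b = c then 1 else -1) * Real.exp (-δ)) / 4 := by
  set D : Set Ω := {ω | rings W τ ω z = rings W (τ + δ) ω z} with hD
  set E : Set Ω := {ω | arrows W ε τ ω z = b ∧ arrows W ε (τ + δ) ω z = c} with hE
  have hNS : ∀ σ, Measurable[noiseAlg W ε {p | p.2 = true}] fun ω => rings W σ ω z :=
    fun σ => noiseAlg_measurable_rings (fun _ => rfl) σ
  have hN : ∀ σ, Measurable fun ω => rings W σ ω z :=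
    fun σ => (hNS σ).mono (h.noiseAlg_le _) le_rfl
  have hDm : MeasurableSet D := measurableSet_eq_fun (hN τ) (hN (τ + δ))
  have hX : Measurable fun ω => (rings W τ ω z, rings W (τ + δ) ω z) := (hN τ).prodMk (hN (τ + δ))
  have hdisj : Disjoint {p : (Site × ℕ) × Bool | p.2 = false} {p | p.2 = true} :=
    Set.disjoint_left.2 fun p h1 h2 => by
      simp only [Set.mem_ofPred_eq] at h1 h2
      simp [h1] at h2
  have hcoin : ∀ m n, MeasurableSet[noiseAlg W ε {p | p.2 = false}]
      {ω | ε z m ω = b ∧ ε z n ω = c} := fun m n =>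
    MeasurableSet.inter (noiseAlg_measurable_coin (by simp) (measurableSet_singleton b))
      (noiseAlg_measurable_coin (by simp) (measurableSet_singleton c))
  have hfib : ∀ m n, MeasurableSet[noiseAlg W ε {p | p.2 = true}]
      {ω | rings W τ ω z = m ∧ rings W (τ + δ) ω z = n} := fun m n =>
    MeasurableSet.inter (hNS τ (measurableSet_singleton m))
      (hNS (τ + δ) (measurableSet_singleton n))
  have hprod : ∀ m n, P ({ω | ε z m ω = b ∧ ε z n ω = c} ∩
      {ω | rings W τ ω z = m ∧ rings W (τ + δ) ω z = n}) =
      P {ω | ε z m ω = b ∧ ε z n ω = c} * P {ω | rings W τ ω z = m ∧ rings W (τ + δ) ω z = n} :=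
    fun m n => h.measure_inter_of_disjoint hdisj (hcoin m n) (hfib m n)
  -- Without a ring both times read the same coin; after a ring they read two independent ones. The
  -- ring counts depend on the waits only, so they may be fixed first.
  have h1 : P (E ∩ D) = (if b = c then 2⁻¹ else 0) * P D := by
    refine measure_inter_eq_mul_of_fibers hX ?_
    rintro ⟨m, n⟩
    by_cases hmn : m = n
    · subst hmn
      have e1 : E ∩ D ∩ (fun ω => (rings W τ ω z, rings W (τ + δ) ω z)) ⁻¹' {(m, m)} =
          {ω | ε z m ω = b ∧ ε z m ω = c} ∩
            {ω | rings W τ ω z = m ∧ rings W (τ + δ) ω z = m} := by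
        ext ω
        simp only [hE, hD, arrows, Set.mem_inter_iff, Set.mem_ofPred_eq, Set.mem_preimage,
          Set.mem_singleton_iff, Prod.mk.injEq]
        grind
      have e2 : D ∩ (fun ω => (rings W τ ω z, rings W (τ + δ) ω z)) ⁻¹' {(m, m)} =
          {ω | rings W τ ω z = m ∧ rings W (τ + δ) ω z = m} := by
        ext ω
        simp only [hD, Set.mem_inter_iff, Set.mem_ofPred_eq, Set.mem_preimage,
          Set.mem_singleton_iff, Prod.mk.injEq]
        grind
      rw [e1, e2, hprod]
      congr 1
      split_ifs with hbc
      · subst hbc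
        simpa using h.measure_coin z m b
      · have : {ω | ε z m ω = b ∧ ε z m ω = c} = ∅ := by
          ext ω
          simp only [Set.mem_ofPred_eq, Set.mem_empty_iff_false, iff_false]
          rintro ⟨a1, a2⟩
          exact hbc (a1.symm.trans a2)
        rw [this, measure_empty]
    · have e2 : D ∩ (fun ω => (rings W τ ω z, rings W (τ + δ) ω z)) ⁻¹' {(m, n)} = ∅ := by
        ext ω
        simp only [hD, Set.mem_inter_iff, Set.mem_ofPred_eq, Set.mem_preimage,
          Set.mem_singleton_iff, Prod.mk.injEq, Set.mem_empty_iff_false, iff_false]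
        grind
      rw [Set.inter_assoc, e2]
      simp
  have h2 : P (E ∩ Dᶜ) = 4⁻¹ * P Dᶜ := by
    refine measure_inter_eq_mul_of_fibers hX ?_
    rintro ⟨m, n⟩
    by_cases hmn : m = n
    · have e2 : Dᶜ ∩ (fun ω => (rings W τ ω z, rings W (τ + δ) ω z)) ⁻¹' {(m, n)} = ∅ := by
        ext ω
        simp only [hD, Set.mem_inter_iff, Set.mem_compl_iff, Set.mem_ofPred_eq, Set.mem_preimage,
          Set.mem_singleton_iff, Prod.mk.injEq, Set.mem_empty_iff_false, iff_false]
        grind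
      rw [Set.inter_assoc, e2]
      simp
    · have e1 : E ∩ Dᶜ ∩ (fun ω => (rings W τ ω z, rings W (τ + δ) ω z)) ⁻¹' {(m, n)} =
          {ω | ε z m ω = b ∧ ε z n ω = c} ∩
            {ω | rings W τ ω z = m ∧ rings W (τ + δ) ω z = n} := by
        ext ω
        simp only [hE, hD, arrows, Set.mem_inter_iff, Set.mem_compl_iff, Set.mem_ofPred_eq,
          Set.mem_preimage, Set.mem_singleton_iff, Prod.mk.injEq]
        grind
      have e2 : Dᶜ ∩ (fun ω => (rings W τ ω z, rings W (τ + δ) ω z)) ⁻¹' {(m, n)} =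
          {ω | rings W τ ω z = m ∧ rings W (τ + δ) ω z = n} := by
        ext ω
        simp only [hD, Set.mem_inter_iff, Set.mem_compl_iff, Set.mem_ofPred_eq, Set.mem_preimage,
          Set.mem_singleton_iff, Prod.mk.injEq]
        grind
      rw [e1, e2, hprod, h.measure_two_coins z hmn]
  have hPD : P.real D = Real.exp (-δ) := by
    rw [Measure.real, hD, h.measure_rings_eq z hτ hδ, ENNReal.toReal_ofReal (Real.exp_pos _).le]
  have h3 := measureReal_inter_add_sdiff (μ := P) (s := E) hDm
  rw [← h3, Set.sdiff_eq, Measure.real, Measure.real, h1, h2, ENNReal.toReal_mul, ENNReal.toReal_mul,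
    ← Measure.real, ← Measure.real, probReal_compl_eq_one_sub hDm, hPD]
  split_ifs <;> simp <;> ring

theorem IsWebNoise.measure_arrows (h : IsWebNoise P W ε) (z : Site) {τ : ℝ} (hτ : 0 ≤ τ)
    (b : Bool) : P.real {ω | arrows W ε τ ω z = b} = 1 / 2 := by
  have := h.measure_arrows_pair z hτ le_rfl b b
  simp only [add_zero, and_self, if_true, neg_zero, Real.exp_zero] at this
  rw [this]
  norm_num

end Noise

/-! ### The box events -/

/-- The endpoint of the arrow at `z` that has direction `b`. -/
def nbr (z : Site) (b : Bool) : Site := step (fun _ => b) z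

theorem step_eq_nbr (a : Site → Bool) (z : Site) : step a z = nbr z (a z) := rfl

theorem nbr_fst (z : Site) (b : Bool) : (nbr z b).1.1 = z.1.1 + dir b := rfl

theorem nbr_snd (z : Site) (b : Bool) : (nbr z b).1.2 = z.1.2 + 1 := rfl

/-- The walk from `z` stays to the right of `lo` before the `n`-th step, and is to the right of `hi`
after the `n`-th step. -/
def Survives (a : Site → Bool) (lo hi : ℤ) : ℕ → Site → Prop
  | 0, z => hi < z.1.1
  | n + 1, z => lo < z.1.1 ∧ Survives a lo hi n (step a z)

theorem survives_iff {a : Site → Bool} {lo hi : ℤ} (h : lo ≤ hi) (n : ℕ) (z : Site) :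
    Survives a lo hi n z ↔ (∀ i ≤ n, lo < pos a z i) ∧ hi < pos a z n := by
  induction n generalizing z with
  | zero =>
    simp only [Survives, pos, nonpos_iff_eq_zero, forall_eq, Function.iterate_zero, id]
    exact ⟨fun h' => ⟨h.trans_lt h', h'⟩, fun h' => h'.2⟩
  | succ n ih =>
    simp only [Survives, ih]
    constructor
    · rintro ⟨h1, h2, h3⟩
      refine ⟨fun i hi => ?_, h3⟩
      cases i with
      | zero => exact h1
      | succ i => exact h2 i (by lia)
    · rintro ⟨h1, h2⟩
      exact ⟨h1 0 (by lia), fun i hi => h1 (i + 1) (by lia), h2⟩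

theorem measurableSet_survives {α : Type*} [MeasurableSpace α] {A : α → Site → Bool} (lo hi : ℤ)
    (n : ℕ) (z : Site)
    (hA : ∀ y : Site, z.1.2 ≤ y.1.2 → y.1.2 < z.1.2 + n → Measurable fun x => A x y) :
    MeasurableSet {x | Survives (A x) lo hi n z} := by
  induction n generalizing z with
  | zero => exact MeasurableSet.const _
  | succ n ih =>
    have : {x | Survives (A x) lo hi (n + 1) z} = {x | lo < z.1.1} ∩
        ⋃ b : Bool, (fun x => A x z) ⁻¹' {b} ∩ {x | Survives (A x) lo hi n (nbr z b)} := by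
      ext x
      simp only [Survives, step_eq_nbr]
      simp
    rw [this]
    refine (MeasurableSet.const _).inter (MeasurableSet.iUnion fun b => ?_)
    refine (hA z le_rfl (by push_cast; lia) (measurableSet_singleton b)).inter (ih _ ?_)
    intro y h1 h2
    rw [nbr_snd] at h1 h2
    exact hA y (by lia) (by push_cast; lia)

/-- The sites with time coordinate in `[s, t)`. -/
def rows (s t : ℤ) : Set Site := {z | s ≤ z.1.2 ∧ z.1.2 < t}

theorem rows_disjoint {s t u v : ℤ} (h : t ≤ u) : Disjoint (rows s t) (rows u v) :=
  Set.disjoint_left.2 fun z h1 h2 => by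
    have := h1.2
    have := h2.1
    lia

section

variable {Ω : Type*} {W : Site → ℕ → Ω → ℝ} {ε : Site → ℕ → Ω → Bool}

theorem siteAlg_measurableSet_survives (τ : ℝ) (lo hi : ℤ) (n : ℕ) (z : Site) :
    MeasurableSet[siteAlg W ε (rows z.1.2 (z.1.2 + n))]
      {ω | Survives (arrows W ε τ ω) lo hi n z} := by
  let _ : MeasurableSpace Ω := siteAlg W ε (rows z.1.2 (z.1.2 + n))
  exact measurableSet_survives lo hi n z fun y h1 h2 =>
    siteAlg_measurable_arrows (T := rows z.1.2 (z.1.2 + n)) ⟨h1, h2⟩ τ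

variable [mΩ : MeasurableSpace Ω] {P : Measure Ω} [IsProbabilityMeasure P]

theorem IsWebNoise.real_inter_of_disjoint_sites (h : IsWebNoise P W ε) {S T : Set Site}
    (hST : Disjoint S T) {A B : Set Ω} (hA : MeasurableSet[siteAlg W ε S] A)
    (hB : MeasurableSet[siteAlg W ε T] B) : P.real (A ∩ B) = P.real A * P.real B := by
  rw [Measure.real, h.measure_inter_of_disjoint_sites hST hA hB, ENNReal.toReal_mul]
  rfl

/-- First-step analysis: the first arrow lies in one row and the rest of the walk uses only later
rows, which are independent of it. -/
theorem IsWebNoise.survives_prob (h : IsWebNoise P W ε) {τ : ℝ} (hτ : 0 ≤ τ) (lo hi : ℤ) (n : ℕ)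
    (z : Site) :
    P.real {ω | Survives (arrows W ε τ ω) lo hi n z} = surv (hi - lo) n (z.1.1 - lo) := by
  induction n generalizing z with
  | zero =>
    simp only [Survives, surv, sub_lt_sub_iff_right]
    split_ifs with h1 <;> simp [h1]
  | succ n ih =>
    simp only [surv]
    split_ifs with h1
    · have : {ω | Survives (arrows W ε τ ω) lo hi (n + 1) z} = ∅ := by
        ext ω
        simp only [Survives, Set.mem_ofPred_eq, Set.mem_empty_iff_false, iff_false]
        lia
      simp [this]
    · set B : Bool → Set Ω := fun b =>
        {ω | arrows W ε τ ω z = b} ∩ {ω | Survives (arrows W ε τ ω) lo hi n (nbr z b)} with hB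
      have hunion : {ω | Survives (arrows W ε τ ω) lo hi (n + 1) z} = B true ∪ B false := by
        ext ω
        simp only [Survives, step_eq_nbr, hB, Set.mem_union, Set.mem_inter_iff, Set.mem_ofPred_eq]
        cases arrows W ε τ ω z <;> simp <;> lia
      have hm : ∀ b, MeasurableSet[siteAlg W ε (rows z.1.2 (z.1.2 + 1))]
          {ω | arrows W ε τ ω z = b} := fun b =>
        siteAlg_measurable_arrows (T := rows z.1.2 (z.1.2 + 1)) ⟨le_rfl, by lia⟩ τ
          (measurableSet_singleton b)
      have hm' : ∀ b, MeasurableSet {ω | Survives (arrows W ε τ ω) lo hi n (nbr z b)} := fun b =>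
        h.siteAlg_le _ _ (siteAlg_measurableSet_survives τ lo hi n (nbr z b))
      have hBP : ∀ b, P.real (B b) = 1 / 2 * surv (hi - lo) n (z.1.1 + dir b - lo) := by
        intro b
        rw [hB]
        simp only
        rw [h.real_inter_of_disjoint_sites (rows_disjoint (by rw [nbr_snd])) (hm b)
          (siteAlg_measurableSet_survives τ lo hi n (nbr z b)), h.measure_arrows z hτ, ih, nbr_fst]
      have hdisj : Disjoint (B true) (B false) := Set.disjoint_left.2 fun ω h1 h2 => by
        have a1 : arrows W ε τ ω z = true := h1.1
        have a2 : arrows W ε τ ω z = false := h2.1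
        rw [a1] at a2
        exact Bool.noConfusion a2
      rw [hunion, measureReal_union hdisj ((h.siteAlg_le _ _ (hm false)).inter (hm' false)),
        hBP, hBP]
      simp only [dir, if_true, Bool.false_eq_true, if_false]
      ring_nf

theorem IsWebNoise.measure_arrows_pair_sites (h : IsWebNoise P W ε) (z y : Site) {τ δ : ℝ}
    (hτ : 0 ≤ τ) (hδ : 0 ≤ δ) (b c : Bool) :
    P.real {ω | arrows W ε τ ω z = b ∧ arrows W ε (τ + δ) ω y = c} =
      (1 + (if b = c then 1 else -1) * (if z = y then Real.exp (-δ) else 0)) / 4 := by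
  by_cases hzy : z = y
  · subst hzy
    simpa using h.measure_arrows_pair z hτ hδ b c
  · have h1 : Disjoint {z} {y} := Set.disjoint_singleton.2 hzy
    have h2 := h.real_inter_of_disjoint_sites h1
      (A := {ω | arrows W ε τ ω z = b}) (B := {ω | arrows W ε (τ + δ) ω y = c})
      (siteAlg_measurable_arrows (Set.mem_singleton z) τ (measurableSet_singleton b))
      (siteAlg_measurable_arrows (Set.mem_singleton y) (τ + δ)
        (measurableSet_singleton c))
    rw [h.measure_arrows z hτ, h.measure_arrows y (by linarith)] at h2
    refine h2.trans ?_
    simp only [if_neg hzy]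
    ring

/-- The two walks are always in the same row, so they share an arrow site exactly when their
positions agree; the two readings then have correlation exp(-δ), and otherwise they are independent.
-/
theorem IsWebNoise.survives_pair_prob (h : IsWebNoise P W ε) {τ δ : ℝ} (hτ : 0 ≤ τ) (hδ : 0 ≤ δ)
    (lo hi : ℤ) (n : ℕ) (z y : Site) (hzy : z.1.2 = y.1.2) :
    P.real ({ω | Survives (arrows W ε τ ω) lo hi n z} ∩
      {ω | Survives (arrows W ε (τ + δ) ω) lo hi n y}) =
      pairSurv (Real.exp (-δ)) (hi - lo) n (z.1.1 - lo) (y.1.1 - lo) := by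
  induction n generalizing z y with
  | zero =>
    simp only [Survives, pairSurv, sub_lt_sub_iff_right]
    by_cases h1 : hi < z.1.1 <;> by_cases h2 : hi < y.1.1 <;> simp [h1, h2]
  | succ n ih =>
    simp only [pairSurv]
    split_ifs with h1
    · have : {ω | Survives (arrows W ε τ ω) lo hi (n + 1) z} ∩
        {ω | Survives (arrows W ε (τ + δ) ω) lo hi (n + 1) y} = ∅ := by
        ext ω
        simp only [Survives, Set.mem_inter_iff, Set.mem_ofPred_eq, Set.mem_empty_iff_false,
          iff_false]
        lia
      simp [this]
    · set V : Bool → Bool → Set Ω := fun b c =>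
        {ω | Survives (arrows W ε τ ω) lo hi n (nbr z b)} ∩
          {ω | Survives (arrows W ε (τ + δ) ω) lo hi n (nbr y c)} with hV
      set A : Bool → Bool → Set Ω := fun b c =>
        {ω | arrows W ε τ ω z = b ∧ arrows W ε (τ + δ) ω y = c} with hA
      have hunion : {ω | Survives (arrows W ε τ ω) lo hi (n + 1) z} ∩
          {ω | Survives (arrows W ε (τ + δ) ω) lo hi (n + 1) y} =
          ⋃ p ∈ (Finset.univ : Finset (Bool × Bool)), A p.1 p.2 ∩ V p.1 p.2 := by
        ext ω
        simp only [Survives, step_eq_nbr, hA, hV, Set.mem_inter_iff, Set.mem_ofPred_eq,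
          Finset.mem_univ, Set.mem_iUnion, Prod.exists, exists_prop, true_and]
        constructor
        · rintro ⟨⟨a1, a2⟩, a3, a4⟩
          exact ⟨_, _, ⟨rfl, rfl⟩, a2, a4⟩
        · rintro ⟨b, c, ⟨rfl, rfl⟩, a2, a4⟩
          exact ⟨⟨by lia, a2⟩, by lia, a4⟩
      have hmA : ∀ b c, MeasurableSet[siteAlg W ε (rows z.1.2 (z.1.2 + 1))] (A b c) := fun b c =>
        MeasurableSet.inter
          (siteAlg_measurable_arrows (T := rows z.1.2 (z.1.2 + 1)) ⟨le_rfl, by lia⟩ τ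
            (measurableSet_singleton b))
          (siteAlg_measurable_arrows (T := rows z.1.2 (z.1.2 + 1)) ⟨hzy.le, by lia⟩ (τ + δ)
            (measurableSet_singleton c))
      have hmV : ∀ b c, MeasurableSet[siteAlg W ε (rows (z.1.2 + 1) (z.1.2 + 1 + n))] (V b c) := by
        intro b c
        have a1 := siteAlg_measurableSet_survives (W := W) (ε := ε) τ lo hi n (nbr z b)
        have a2 := siteAlg_measurableSet_survives (W := W) (ε := ε) (τ + δ) lo hi n (nbr y c)
        rw [nbr_snd] at a1 a2
        rw [← hzy] at a2
        exact MeasurableSet.inter a1 a2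
      have hAV : ∀ b c, P.real (A b c ∩ V b c) =
          (1 + (if b = c then 1 else -1) * (if z = y then Real.exp (-δ) else 0)) / 4 *
            pairSurv (Real.exp (-δ)) (hi - lo) n (z.1.1 + dir b - lo) (y.1.1 + dir c - lo) := by
        intro b c
        rw [h.real_inter_of_disjoint_sites (rows_disjoint le_rfl) (hmA b c) (hmV b c),
          h.measure_arrows_pair_sites z y hτ hδ, ih _ _ (by rw [nbr_snd, nbr_snd, hzy]),
          nbr_fst, nbr_fst]
      rw [hunion, measureReal_biUnion_finset]
      · simp only [hAV]
        rw [Fintype.sum_prod_type]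
        simp only [Fintype.sum_bool, dir, if_true, Bool.false_eq_true, if_false, pairStep]
        have hiff : (z.1.1 - lo = y.1.1 - lo) ↔ z = y := by
          constructor
          · intro h1
            exact Subtype.ext (Prod.ext (by lia) hzy)
          · rintro rfl; rfl
        simp only [hiff, reduceCtorEq, if_false]
        ring_nf
      · intro p _ q _ hpq
        refine Set.disjoint_left.2 fun ω a1 a2 => hpq ?_
        have b1 : arrows W ε τ ω z = p.1 ∧ arrows W ε (τ + δ) ω y = p.2 := a1.1
        have b2 : arrows W ε τ ω z = q.1 ∧ arrows W ε (τ + δ) ω y = q.2 := a2.1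
        exact Prod.ext (b1.1.symm.trans b2.1) (b1.2.symm.trans b2.2)
      · intro p _
        exact (h.siteAlg_le _ _ (hmA p.1 p.2)).inter (h.siteAlg_le _ _ (hmV p.1 p.2))

end

/-! ### Geometry of the paths -/

theorem iterate_step_snd (a : Site → Bool) (z : Site) (n : ℕ) :
    ((step a)^[n] z).1.2 = z.1.2 + n := by
  induction n with
  | zero => simp
  | succ n ih =>
    rw [Function.iterate_succ_apply', step_eq_nbr, nbr_snd, ih]
    push_cast
    ring

theorem pos_add (a : Site → Bool) (z : Site) (m n : ℕ) :
    pos a z (m + n) = pos a ((step a)^[m] z) n := by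
  unfold pos
  rw [add_comm, Function.iterate_add_apply]

theorem pos_succ (a : Site → Bool) (z : Site) (n : ℕ) :
    pos a z (n + 1) = pos a z n + dir (a ((step a)^[n] z)) := by
  unfold pos
  rw [Function.iterate_succ_apply', step_eq_nbr, nbr_fst]

theorem dir_bounds (b : Bool) : -1 ≤ dir b ∧ dir b ≤ 1 := by
  cases b <;> simp [dir]

theorem sub_le_pos (a : Site → Bool) (z : Site) (n : ℕ) : z.1.1 - n ≤ pos a z n := by
  induction n with
  | zero => simp [pos]
  | succ n ih =>
    rw [pos_succ]
    have := (dir_bounds (a ((step a)^[n] z))).1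
    push_cast
    lia

/-- Paths that follow the same arrows do not cross. -/
theorem pos_mono (a : Site → Bool) {z y : Site} (ht : z.1.2 = y.1.2) (hx : z.1.1 ≤ y.1.1) (n : ℕ) :
    pos a z n ≤ pos a y n := by
  induction n with
  | zero => exact hx
  | succ n ih =>
    rw [pos_succ, pos_succ]
    have h1 := iterate_step_snd a z n
    have h2 := iterate_step_snd a y n
    have p1 := ((step a)^[n] z).2
    have p2 := ((step a)^[n] y).2
    rcases ih.eq_or_lt with he | hlt
    · have : (step a)^[n] z = (step a)^[n] y := Subtype.ext (Prod.ext he (by rw [h1, h2, ht]))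
      rw [this, he]
    · have b1 := (dir_bounds (a ((step a)^[n] z))).2
      have b2 := (dir_bounds (a ((step a)^[n] y))).1
      have hlt' : ((step a)^[n] z).1.1 < ((step a)^[n] y).1.1 := hlt
      have e1 : pos a z n = ((step a)^[n] z).1.1 := rfl
      have e2 : pos a y n = ((step a)^[n] y).1.1 := rfl
      rw [h1] at p1
      rw [h2] at p2
      rw [e1, e2]
      -- Sites in the same row have abscissas of equal parity, so distinct paths are two apart and
      -- can meet but not cross.
      have : ((step a)^[n] z).1.1 + 2 ≤ ((step a)^[n] y).1.1 := by
        rcases p1 with ⟨r, hr⟩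
        rcases p2 with ⟨s, hs⟩
        lia
      lia

theorem path_add_natCast (a : Site → Bool) (z : Site) (n : ℕ) :
    path a z ((z.1.2 : ℝ) + n) = pos a z n := by
  simp [path]

/-- At a time between two integers a path is a convex combination of its neighbouring positions. -/
theorem path_eq (a : Site → Bool) (z : Site) (s : ℝ) :
    path a z ((z.1.2 : ℝ) + s) =
      (1 - (s - ⌊s⌋₊)) * pos a z ⌊s⌋₊ + (s - ⌊s⌋₊) * pos a z (⌊s⌋₊ + 1) := by
  simp only [path, add_sub_cancel_left]
  ring

theorem boxSize_eq_toNat {γ : ℝ} (hγ : 0 < γ) (k : ℕ) :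
    ((boxSize γ k).toNat : ℤ) = boxSize γ k ∧ 0 < (boxSize γ k).toNat := by
  have h0 : 0 ≤ ⌊γ ^ k / 2⌋ := Int.floor_nonneg.2 (by positivity)
  have : 0 < boxSize γ k := by unfold boxSize; lia
  constructor
  · exact Int.toNat_of_nonneg this.le
  · lia

/-- The event `A_k` for the arrow configuration `a`, in terms of the positions of the walk. -/
def BoxSurvives (γ : ℝ) (k : ℕ) (a : Site → Bool) : Prop :=
  Survives a (boxX γ k - boxSize γ k) (boxX γ (k + 1)) ((boxSize γ k).toNat ^ 2) (boxBase γ k)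

theorem boxX_succ (γ : ℝ) (k : ℕ) : boxX γ (k + 1) = boxX γ k + boxSize γ k :=
  Finset.sum_range_succ _ _

theorem boxT_succ (γ : ℝ) (k : ℕ) : boxT γ (k + 1) = boxT γ k + boxSize γ k ^ 2 :=
  Finset.sum_range_succ _ _

theorem boxT_succ' {γ : ℝ} (hγ : 0 < γ) (k : ℕ) :
    boxT γ (k + 1) = boxT γ k + ((boxSize γ k).toNat ^ 2 : ℕ) := by
  rw [boxT_succ]
  push_cast
  rw [(boxSize_eq_toNat hγ k).1]

theorem boxSurvives_iff {γ : ℝ} (hγ : 0 < γ) (k : ℕ) (a : Site → Bool) :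
    BoxSurvives γ k a ↔
      (∀ i ≤ (boxSize γ k).toNat ^ 2, boxX γ k - boxSize γ k < pos a (boxBase γ k) i) ∧
        boxX γ (k + 1) < pos a (boxBase γ k) ((boxSize γ k).toNat ^ 2) := by
  refine survives_iff ?_ _ _
  have := (boxSize_eq_toNat hγ k)
  rw [boxX_succ]
  lia

/-- Linear interpolation preserves a strict lower bound at the integers, so the continuum condition
is a condition on the walk. -/
theorem mem_boxEvent_iff {Ω : Type*} (W : Site → ℕ → Ω → ℝ) (ε : Site → ℕ → Ω → Bool) {γ : ℝ}
    (hγ : 0 < γ) (k : ℕ) (τ : ℝ) (ω : Ω) :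
    ω ∈ boxEvent W ε γ k τ ↔ BoxSurvives γ k (arrows W ε τ ω) := by
  rw [boxSurvives_iff hγ]
  set a := arrows W ε τ ω
  set n := (boxSize γ k).toNat ^ 2 with hn
  have hT : (boxT γ (k + 1) : ℝ) = ((boxBase γ k).1.2 : ℝ) + n := by
    rw [boxT_succ' hγ, ← hn]
    push_cast
    rfl
  have hT0 : (boxT γ k : ℝ) = ((boxBase γ k).1.2 : ℝ) := rfl
  have hlast : path a (boxBase γ k) (boxT γ (k + 1) : ℝ) = pos a (boxBase γ k) n := by
    rw [hT, path_add_natCast]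
  simp only [boxEvent, Set.mem_ofPred_eq]
  change (_ ∧ (boxX γ (k + 1) : ℝ) < path a (boxBase γ k) (boxT γ (k + 1) : ℝ)) ↔ _
  rw [hlast, Int.cast_lt, and_congr_left_iff]
  intro _
  constructor
  · intro h i hi
    have := h ((boxBase γ k).1.2 + i) ⟨by rw [hT0]; linarith [Nat.cast_nonneg (α := ℝ) i], by
      rw [hT]; gcongr⟩
    change _ < path a _ _ at this
    rw [path_add_natCast] at this
    exact_mod_cast this
  · intro h t ht
    change _ < path a _ _
    obtain ⟨s, rfl⟩ : ∃ s, t = ((boxBase γ k).1.2 : ℝ) + s := ⟨t - (boxBase γ k).1.2, by ring⟩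
    rw [hT0, hT] at ht
    have hs0 : 0 ≤ s := by linarith [ht.1]
    have hsn : s ≤ n := by linarith [ht.2]
    have f0 := Nat.floor_le hs0
    have f1 := Nat.lt_floor_add_one s
    have hfn : ⌊s⌋₊ ≤ n := by
      have : ((⌊s⌋₊ : ℕ) : ℝ) ≤ n := f0.trans hsn
      exact_mod_cast this
    have p0 : ((boxX γ k : ℝ) - boxSize γ k) < pos a (boxBase γ k) ⌊s⌋₊ := by
      exact_mod_cast h _ hfn
    rw [path_eq]
    rcases hfn.eq_or_lt with he | hlt
    · have : s = ⌊s⌋₊ := le_antisymm (by rw [he]; exact hsn) f0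
      rw [show s - (⌊s⌋₊ : ℝ) = 0 by linarith]
      linarith
    · have p1 : ((boxX γ k : ℝ) - boxSize γ k) < pos a (boxBase γ k) (⌊s⌋₊ + 1) := by
        exact_mod_cast h _ hlt
      nlinarith

theorem boxSize_bounds (γ : ℝ) (k : ℕ) :
    γ ^ k < boxSize γ k ∧ (boxSize γ k : ℝ) ≤ γ ^ k + 2 := by
  have h1 := Int.floor_le (γ ^ k / 2)
  have h2 := Int.lt_floor_add_one (γ ^ k / 2)
  unfold boxSize
  push_cast
  constructor <;> linarith

theorem boxSize_zero (γ : ℝ) : boxSize γ 0 = 2 := by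
  have : ⌊(1 : ℝ) / 2⌋ = 0 := by rw [Int.floor_eq_zero_iff]; constructor <;> norm_num
  simp only [boxSize, pow_zero, this]
  norm_num

theorem boxX_lower {γ : ℝ} (hγ : 1 < γ) (k : ℕ) :
    γ ^ (k + 1) - γ ≤ (γ - 1) * (boxX γ (k + 1) - 2) := by
  induction k with
  | zero => simp [boxX, boxSize_zero]
  | succ k ih =>
    rw [boxX_succ γ (k + 1)]
    have := (boxSize_bounds γ (k + 1)).1
    push_cast
    have h2 : (γ - 1) * γ ^ (k + 1) ≤ (γ - 1) * boxSize γ (k + 1) := by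
      gcongr
    calc γ ^ (k + 1 + 1) - γ = (γ ^ (k + 1) - γ) + (γ - 1) * γ ^ (k + 1) := by ring
      _ ≤ _ := by linarith

theorem boxT_lower {γ : ℝ} (hγ : 1 < γ) (k : ℕ) :
    (γ ^ (k + 1)) ^ 2 - γ ^ 2 ≤ (γ ^ 2 - 1) * (boxT γ (k + 1) - 4) := by
  have hq : 0 < γ ^ 2 - 1 := by nlinarith
  induction k with
  | zero => norm_num [boxT, boxSize_zero]
  | succ k ih =>
    rw [boxT_succ γ (k + 1)]
    have := (boxSize_bounds γ (k + 1)).1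
    push_cast
    have h2 : (γ ^ 2 - 1) * (γ ^ (k + 1)) ^ 2 ≤ (γ ^ 2 - 1) * (boxSize γ (k + 1) : ℝ) ^ 2 := by
      gcongr
    calc (γ ^ (k + 1 + 1)) ^ 2 - γ ^ 2
        = ((γ ^ (k + 1)) ^ 2 - γ ^ 2) + (γ ^ 2 - 1) * (γ ^ (k + 1)) ^ 2 := by ring
      _ ≤ _ := by linarith

theorem boxX_nonneg {γ : ℝ} (hγ : 0 < γ) (k : ℕ) : 0 ≤ boxX γ k :=
  Finset.sum_nonneg fun i _ => by
    have := boxSize_eq_toNat hγ i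
    lia

theorem natCast_le_boxT {γ : ℝ} (hγ : 0 < γ) (k : ℕ) : (k : ℤ) ≤ boxT γ k := by
  induction k with
  | zero => simp [boxT]
  | succ k ih =>
    have := boxSize_eq_toNat hγ k
    rw [boxT_succ]
    push_cast
    nlinarith

theorem sq_kOf {γ : ℝ} (hγ : 1 < γ) : (γ - 1) ^ 2 * kOf γ ^ 2 = (γ - 2) ^ 2 * (γ ^ 2 - 1) := by
  unfold kOf
  have h1 : 0 < γ - 1 := by linarith
  rw [mul_pow, Real.sq_sqrt (div_nonneg (by linarith) h1.le)]
  field_simp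
  ring

/-- The left sides of the boxes lie to the right of the moving boundary. -/
theorem sq_boxSize_sub_boxX_le {γ : ℝ} (hγ : 4 ≤ γ) (k : ℕ)
    (h : boxX γ k ≤ boxSize γ k) :
    ((boxSize γ k : ℝ) - boxX γ k) ^ 2 ≤ kOf γ ^ 2 * (boxT γ k + boxSize γ k) := by
  have hK := sq_kOf (show 1 < γ by linarith)
  cases k with
  | zero =>
    simp only [boxSize_zero, boxX, boxT, Finset.range_zero, Finset.sum_empty]
    push_cast
    have h1 : (γ - 1) ^ 2 * 4 ≤ (γ - 1) ^ 2 * (2 * kOf γ ^ 2) := by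
      have : (γ - 1) ^ 2 * (2 * kOf γ ^ 2) = 2 * ((γ - 2) ^ 2 * (γ ^ 2 - 1)) := by
        rw [← hK]; ring
      rw [this]
      have h2 : (4 : ℝ) ≤ (γ - 2) ^ 2 := by nlinarith
      have h3 : (γ - 1) ^ 2 ≤ γ ^ 2 - 1 := by nlinarith
      nlinarith [sq_nonneg (γ - 1)]
    have := le_of_mul_le_mul_left h1 (by nlinarith : 0 < (γ - 1) ^ 2)
    linarith
  | succ k =>
    have h1 := boxX_lower (show 1 < γ by linarith) k
    have h2 := boxT_lower (show 1 < γ by linarith) k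
    have h3 := boxSize_bounds γ (k + 1)
    set G := γ ^ (k + 1) with hG
    have hG0 : 0 < G := by positivity
    have hle : (boxX γ (k + 1) : ℝ) ≤ boxSize γ (k + 1) := by exact_mod_cast h
    set x : ℝ := ((boxX γ (k + 1) : ℤ) : ℝ)
    set d : ℝ := ((boxSize γ (k + 1) : ℤ) : ℝ)
    set t : ℝ := ((boxT γ (k + 1) : ℤ) : ℝ)
    have hg1 : 0 < γ - 1 := by linarith
    -- The rounding error of at most 2 in d is cancelled by the initial box size 2 contained in x.
    have a1 : (γ - 1) * (d - x) ≤ (γ - 2) * G + γ := by nlinarith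
    have a2 : ((γ - 1) * (d - x)) ^ 2 ≤ ((γ - 2) * G + γ) ^ 2 := by
      have : 0 ≤ (γ - 1) * (d - x) := mul_nonneg hg1.le (by linarith)
      gcongr
    have hq : 0 < γ ^ 2 - 1 := by nlinarith
    have a3 : G ^ 2 + 3 * γ ^ 2 - 4 + (γ ^ 2 - 1) * G ≤ (γ ^ 2 - 1) * (t + d) := by nlinarith
    -- The leading terms agree, which is what fixes K(γ). The cross term is absorbed by the extra
    -- time d, and γ² by the constant term.
    have a4 : ((γ - 2) * G + γ) ^ 2 ≤
        (γ - 2) ^ 2 * (G ^ 2 + 3 * γ ^ 2 - 4 + (γ ^ 2 - 1) * G) := by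
      have b1 : 2 * γ ≤ γ ^ 2 - 1 := by nlinarith
      have b2 : 2 * γ * (γ - 2) ≤ (γ - 2) ^ 2 * (γ ^ 2 - 1) := by
        calc 2 * γ * (γ - 2) ≤ (γ ^ 2 - 1) * (γ - 2) := by gcongr; linarith
          _ ≤ (γ ^ 2 - 1) * (γ - 2) ^ 2 := by gcongr; nlinarith
          _ = _ := by ring
      have b3 : 2 * γ * (γ - 2) * G ≤ (γ - 2) ^ 2 * (γ ^ 2 - 1) * G := by gcongr
      have b4 : γ ^ 2 ≤ (γ - 2) ^ 2 * (3 * γ ^ 2 - 4) := by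
        have : (1 : ℝ) ≤ (γ - 2) ^ 2 := by nlinarith
        nlinarith
      nlinarith
    have a5 : (γ - 1) ^ 2 * (d - x) ^ 2 ≤ (γ - 1) ^ 2 * (kOf γ ^ 2 * (t + d)) := by
      calc (γ - 1) ^ 2 * (d - x) ^ 2 = ((γ - 1) * (d - x)) ^ 2 := by ring
        _ ≤ _ := a2
        _ ≤ _ := a4
        _ ≤ (γ - 2) ^ 2 * ((γ ^ 2 - 1) * (t + d)) := by gcongr
        _ = ((γ - 1) ^ 2 * kOf γ ^ 2) * (t + d) := by rw [hK]; ring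
        _ = _ := by ring
    exact le_of_mul_le_mul_left a5 (by positivity)

/-- By induction the path from the origin starts each box at or right of its base point, so it stays
right of the path from there, which ends beyond x_{k+1}. -/
theorem boxX_le_iterate {γ : ℝ} (hγ : 0 < γ) {a : Site → Bool} (h : ∀ k, BoxSurvives γ k a)
    (k : ℕ) : boxX γ k ≤ pos a origin (boxT γ k).toNat := by
  induction k with
  | zero => simp [boxX, boxT, pos, origin]
  | succ k ih =>
    have hT := natCast_le_boxT hγ k
    have hn : (boxT γ (k + 1)).toNat = (boxT γ k).toNat + (boxSize γ k).toNat ^ 2 := by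
      rw [boxT_succ' hγ]
      lia
    rw [hn, pos_add]
    refine (((boxSurvives_iff hγ k a).1 (h k)).2).le.trans (pos_mono a ?_ ih _)
    rw [iterate_step_snd]
    simp only [boxBase, origin]
    lia

/-- If all the box events occur, then the path from the origin does not cross the moving
boundary. -/
theorem neg_kOf_mul_sqrt_le_path {γ : ℝ} (hγ : 4 ≤ γ) {a : Site → Bool}
    (h : ∀ k, BoxSurvives γ k a) {t : ℝ} (ht : 0 ≤ t) : -kOf γ * √t ≤ path a origin t := by
  have hγ0 : 0 < γ := by linarith
  have hK0 : 0 ≤ kOf γ := mul_nonneg (by linarith) (Real.sqrt_nonneg _)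
  have hbox : ∀ k, ∀ i ≤ (boxSize γ k).toNat ^ 2,
      -kOf γ * √(((boxT γ k).toNat + i : ℕ) : ℝ) ≤ pos a origin ((boxT γ k).toNat + i) := by
    intro k i hi
    have hT := natCast_le_boxT hγ0 k
    have hTR : (((boxT γ k).toNat : ℕ) : ℝ) = boxT γ k := by
      have : (((boxT γ k).toNat : ℕ) : ℤ) = boxT γ k := Int.toNat_of_nonneg (by lia)
      exact_mod_cast this
    have hX := boxX_nonneg hγ0 k
    have hd := boxSize_eq_toNat hγ0 k
    set d := (boxSize γ k).toNat with hdd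
    set y := (step a)^[(boxT γ k).toNat] origin with hy
    have hx := boxX_le_iterate hγ0 h k
    have hpos : pos a origin ((boxT γ k).toNat + i) = pos a y i := pos_add _ _ _ _
    have hy1 : boxX γ k ≤ y.1.1 := hx
    have hytime : (boxBase γ k).1.2 = y.1.2 := by
      rw [hy, iterate_step_snd]
      simp only [boxBase, origin]
      lia
    have l1 : boxX γ k - i ≤ pos a y i := by
      have := sub_le_pos a y i
      lia
    have l2 : boxX γ k - boxSize γ k ≤ pos a y i :=
      ((((boxSurvives_iff hγ0 k a).1 (h k)).1 i hi).trans_le (pos_mono a hytime hy1 i)).le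
    rw [hpos]
    -- After i steps the path has lost at most i by unit speed and at most d by the box event. Both
    -- are needed: the lower left corner of the first box lies beyond the boundary, so the left side
    -- is compared with it only from time t_k + d_k on.
    set j := min i d with hj
    have l3 : boxX γ k - j ≤ pos a y i := by
      rcases le_total i d with hid | hid
      · rw [hj, min_eq_left hid]; exact l1
      · rw [hj, min_eq_right hid, hd.1]; exact l2
    have l3R : (boxX γ k : ℝ) - j ≤ pos a y i := by exact_mod_cast l3
    have hji : (j : ℝ) ≤ i := by exact_mod_cast min_le_left i d
    have hjd : (j : ℝ) ≤ d := by exact_mod_cast min_le_right i d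
    have hdR : (d : ℝ) = boxSize γ k := by exact_mod_cast hd.1
    have hd0 : (0 : ℝ) < d := by exact_mod_cast hd.2
    have hXR : (0 : ℝ) ≤ boxX γ k := by exact_mod_cast hX
    have hT0 : (0 : ℝ) ≤ boxT γ k := by rw [← hTR]; positivity
    have hj0 : (0 : ℝ) ≤ j := by positivity
    have main : (j : ℝ) - boxX γ k ≤ kOf γ * √(((boxT γ k).toNat + i : ℕ) : ℝ) := by
      rcases le_or_gt (j : ℝ) (boxX γ k) with hjx | hjx
      · have : 0 ≤ kOf γ * √(((boxT γ k).toNat + i : ℕ) : ℝ) := by positivity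
        linarith
      · have key := sq_boxSize_sub_boxX_le hγ k (by
          have : (boxX γ k : ℝ) ≤ boxSize γ k := by rw [← hdR]; linarith
          exact_mod_cast this)
        rw [← hdR] at key
        push_cast
        rw [hTR]
        refine abs_le_of_sq_le_sq' ?_ (by positivity) |>.2
        rw [mul_pow, Real.sq_sqrt (by positivity)]
        set x : ℝ := ((boxX γ k : ℤ) : ℝ)
        set T : ℝ := ((boxT γ k : ℤ) : ℝ)
        -- Uses x ≥ 0 and j ≤ d; it reduces the estimate to its worst case j = d.
        have m1 : ((j : ℝ) - x) * d ≤ j * (d - x) := by nlinarith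
        have m2 : (((j : ℝ) - x) * d) ^ 2 ≤ (j * (d - x)) ^ 2 := by
          have : 0 ≤ ((j : ℝ) - x) * d := mul_nonneg (by linarith) hd0.le
          gcongr
        have m3 : (j : ℝ) ^ 2 * (T + d) ≤ d ^ 2 * (T + i) := by
          have e1 : (j : ℝ) ^ 2 * T ≤ d ^ 2 * T := by gcongr
          have e2 : (j : ℝ) ^ 2 * d ≤ d ^ 2 * i := by
            calc (j : ℝ) ^ 2 * d = j * d * j := by ring
              _ ≤ d * d * i := by gcongr
              _ = _ := by ring
          linarith
        have m4 : (d : ℝ) ^ 2 * (j - x) ^ 2 ≤ d ^ 2 * (kOf γ ^ 2 * (T + i)) := by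
          calc (d : ℝ) ^ 2 * (j - x) ^ 2 = (((j : ℝ) - x) * d) ^ 2 := by ring
            _ ≤ (j * (d - x)) ^ 2 := m2
            _ = j ^ 2 * (d - x) ^ 2 := by ring
            _ ≤ j ^ 2 * (kOf γ ^ 2 * (T + d)) := by gcongr
            _ = kOf γ ^ 2 * (j ^ 2 * (T + d)) := by ring
            _ ≤ kOf γ ^ 2 * (d ^ 2 * (T + i)) := by gcongr
            _ = _ := by ring
        exact le_of_mul_le_mul_left m4 (by positivity)
    linarith
  have hlow : ∀ m : ℕ, -kOf γ * √(m : ℝ) ≤ pos a origin m := by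
    have aux : ∀ k m : ℕ, m ≤ (boxT γ k).toNat → -kOf γ * √(m : ℝ) ≤ pos a origin m := by
      intro k
      induction k with
      | zero =>
        intro m hm
        have : m = 0 := by simpa [boxT] using hm
        subst this
        simp [pos, origin]
      | succ k ih =>
        intro m hm
        rcases le_total m (boxT γ k).toNat with h1 | h1
        · exact ih m h1
        · obtain ⟨i, rfl⟩ := Nat.exists_eq_add_of_le h1
          refine hbox k i ?_
          have hT := natCast_le_boxT hγ0 k
          rw [boxT_succ' hγ0] at hm
          lia
    intro m
    have := natCast_le_boxT hγ0 m
    exact aux m m (by lia)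
  have hpath : path a origin t = (1 - (t - ⌊t⌋₊)) * pos a origin ⌊t⌋₊ +
      (t - ⌊t⌋₊) * pos a origin (⌊t⌋₊ + 1) := by
    have := path_eq a origin t
    simpa [origin] using this
  rw [hpath]
  have f0 := Nat.floor_le ht
  have f1 := Nat.lt_floor_add_one t
  set θ : ℝ := t - ⌊t⌋₊ with hθ
  -- By concavity a chord of the square root lies below it, so the bound at integer times passes to
  -- the interpolated path.
  have hc := Real.strictConcaveOn_sqrt.concaveOn.2 (x := (⌊t⌋₊ : ℝ)) (y := ((⌊t⌋₊ + 1 : ℕ) : ℝ))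
    (by simp) (by simp; positivity) (show 0 ≤ 1 - θ by linarith) (show 0 ≤ θ by linarith)
    (by ring)
  simp only [smul_eq_mul] at hc
  have e : (1 - θ) * (⌊t⌋₊ : ℝ) + θ * ((⌊t⌋₊ + 1 : ℕ) : ℝ) = t := by
    push_cast
    rw [hθ]
    ring
  rw [e] at hc
  have i1 := mul_le_mul_of_nonneg_left (hlow ⌊t⌋₊) (show 0 ≤ 1 - θ by linarith)
  have i2 := mul_le_mul_of_nonneg_left (hlow (⌊t⌋₊ + 1)) (show 0 ≤ θ by linarith)
  have i3 := mul_le_mul_of_nonneg_left hc hK0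
  nlinarith

/-! ### The energy method -/

/-- A weighted Cauchy-Schwarz inequality, term by term: x will be the mass of a covering piece and δ
the s-th power of its diameter. -/
theorem le_mul_sq_add_div (x : ℝ≥0∞) {δ θ : ℝ≥0∞} (hδ : δ ≠ 0) (hδ' : δ ≠ ⊤) (hθ : θ ≠ 0)
    (hθ' : θ ≠ ⊤) : x ≤ θ * (x * x * δ⁻¹) + δ / θ := by
  rcases le_or_gt x (δ / θ) with h | h
  · exact h.trans le_add_self
  · have h1 : δ ≤ x * θ := (ENNReal.div_le_iff hθ hθ').1 h.le
    have h2 : 1 ≤ x * θ * δ⁻¹ := by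
      rw [← ENNReal.mul_inv_cancel hδ hδ']
      gcongr
    calc x = x * 1 := (mul_one x).symm
      _ ≤ x * (x * θ * δ⁻¹) := by gcongr
      _ = θ * (x * x * δ⁻¹) := by ring
      _ ≤ _ := le_self_add

/-- A subset of the real line of small Hausdorff content has an open cover with small content. -/
theorem exists_open_cover {C : Set ℝ} {s : ℝ} (hs : 0 < s) (h : Measure.hausdorffMeasure s C = 0)
    {η : ℝ≥0∞} (hη : 0 < η) :
    ∃ U : ℕ → Set ℝ, (∀ n, IsOpen (U n)) ∧ C ⊆ ⋃ n, U n ∧ (∀ n, Metric.ediam (U n) ≠ ⊤) ∧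
      ∑' n, Metric.ediam (U n) ^ s ≤ η := by
  have hη2 : 0 < η / 2 := ENNReal.half_pos hη.ne'
  rw [Measure.hausdorffMeasure_apply] at h
  have h1 : (⨅ (t : ℕ → Set ℝ) (_ : C ⊆ ⋃ n, t n) (_ : ∀ n, Metric.ediam (t n) ≤ 1),
      ∑' n, ⨆ _ : (t n).Nonempty, Metric.ediam (t n) ^ s) < η / 2 := by
    refine lt_of_le_of_lt ?_ hη2
    rw [← h]
    exact le_iSup₂ (f := fun (r : ℝ≥0∞) (_ : 0 < r) =>
      ⨅ (t : ℕ → Set ℝ) (_ : C ⊆ ⋃ n, t n) (_ : ∀ n, Metric.ediam (t n) ≤ r),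
      ∑' n, ⨆ _ : (t n).Nonempty, Metric.ediam (t n) ^ s) 1 one_pos
  simp only [iInf_lt_iff] at h1
  obtain ⟨t, ht, htd, hsum⟩ := h1
  obtain ⟨e, he, hesum⟩ := ENNReal.exists_pos_sum_of_countable' hη2.ne' ℕ
  have key : ∀ n, ∃ V : Set ℝ, IsOpen V ∧ t n ⊆ V ∧ Metric.ediam V ≠ ⊤ ∧
      Metric.ediam V ^ s ≤ (⨆ _ : (t n).Nonempty, Metric.ediam (t n) ^ s) + e n := by
    intro n
    rcases (t n).eq_empty_or_nonempty with h0 | hne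
    · refine ⟨∅, isOpen_empty, h0.subset, by simp, ?_⟩
      simp [ENNReal.zero_rpow_of_pos hs]
    · have hfin : Metric.ediam (t n) ≠ ⊤ := ((htd n).trans_lt ENNReal.one_lt_top).ne
      have hcont : Filter.Tendsto
          (fun δ : NNReal => (Metric.ediam (t n) + 2 * (δ : ℝ≥0∞)) ^ s) (𝓝 0)
          (𝓝 (Metric.ediam (t n) ^ s)) := by
        have : Continuous fun δ : NNReal => (Metric.ediam (t n) + 2 * (δ : ℝ≥0∞)) ^ s := by
          refine ENNReal.continuous_rpow_const.comp (continuous_const.add ?_)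
          exact (ENNReal.continuous_const_mul (by simp)).comp ENNReal.continuous_coe
        simpa using this.tendsto 0
      have hlt : Metric.ediam (t n) ^ s < Metric.ediam (t n) ^ s + e n :=
        ENNReal.lt_add_right (ENNReal.rpow_ne_top_of_nonneg hs.le hfin) (he n).ne'
      have hev := (hcont.mono_left (nhdsWithin_le_nhds (s := Set.Ioi 0))).eventually
        (gt_mem_nhds hlt)
      obtain ⟨δ, hδ, hδ0⟩ := (hev.and self_mem_nhdsWithin).exists
      have hd := Metric.ediam_thickening_le (s := t n) δ
      refine ⟨Metric.thickening δ (t n), Metric.isOpen_thickening,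
        Metric.self_subset_thickening (by exact_mod_cast hδ0) _, ?_, ?_⟩
      · refine (hd.trans_lt ?_).ne
        exact ENNReal.add_lt_top.2 ⟨hfin.lt_top, ENNReal.mul_lt_top (by simp) (by simp)⟩
      · simp only [hne, iSup_pos]
        exact (ENNReal.rpow_le_rpow hd hs.le).trans hδ.le
  choose V hV1 hV2 hV3 hV4 using key
  refine ⟨V, hV1, ht.trans (Set.iUnion_mono hV2), hV3, ?_⟩
  calc ∑' n, Metric.ediam (V n) ^ s
      ≤ ∑' n, ((⨆ _ : (t n).Nonempty, Metric.ediam (t n) ^ s) + e n) := ENNReal.tsum_le_tsum hV4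
    _ = (∑' n, ⨆ _ : (t n).Nonempty, Metric.ediam (t n) ^ s) + ∑' n, e n := ENNReal.tsum_add
    _ ≤ η / 2 + η / 2 := by gcongr
    _ = η := ENNReal.add_halves η

/-- The `s`-energy of Lebesgue measure on `E`. -/
def energy (s : ℝ) (E : Set ℝ) : ℝ≥0∞ := ∫⁻ x in E, ∫⁻ y in E, edist x y ^ (-s)

/-- Cutting E into disjoint pieces of the cover, the energy is at least the sum of |D_n|²/(diam
U_n)^s, since the kernel is at least (diam U_n)^(-s) inside a piece. Small energy and a cheap cover
thus exclude large mass. -/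
theorem volume_le_energy {s : ℝ} (hs : 0 < s) {E : Set ℝ} (hE : MeasurableSet E) {U : ℕ → Set ℝ}
    (hU : ∀ n, IsOpen (U n)) (hEU : E ⊆ ⋃ n, U n) (hUd : ∀ n, Metric.ediam (U n) ≠ ⊤)
    {c θ : ℝ≥0∞} (hθ : θ ≠ 0) (hθ' : θ ≠ ⊤) :
    c * volume E ≤ θ * (c ^ 2 * energy s E) + (∑' n, Metric.ediam (U n) ^ s) / θ := by
  set D : ℕ → Set ℝ := fun n => E ∩ disjointed U n with hD
  have hDm : ∀ n, MeasurableSet (D n) := fun n =>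
    hE.inter (MeasurableSet.disjointed (fun n => (hU n).measurableSet) n)
  have hDd : Pairwise (Function.onFun Disjoint D) := fun i j hij =>
    (disjoint_disjointed U hij).mono Set.inter_subset_right Set.inter_subset_right
  have hDU : E = ⋃ n, D n := by
    rw [hD, ← Set.inter_iUnion, iUnion_disjointed, Set.inter_eq_left.2 hEU]
  have hDE : ∀ n, D n ⊆ E := fun n => Set.inter_subset_left
  have hDsub : ∀ n, D n ⊆ U n := fun n => Set.inter_subset_right.trans (disjointed_subset U n)
  have hvol : volume E = ∑' n, volume (D n) := by
    conv_lhs => rw [hDU]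
    exact measure_iUnion hDd hDm
  have hen : ∑' n, volume (D n) * volume (D n) * (Metric.ediam (U n) ^ s)⁻¹ ≤ energy s E := by
    have h1 : energy s E = ∑' n, ∫⁻ x in D n, ∫⁻ y in E, edist x y ^ (-s) := by
      unfold energy
      conv_lhs => enter [1, 2]; rw [hDU]
      rw [lintegral_iUnion hDm hDd]
    rw [h1]
    refine ENNReal.tsum_le_tsum fun n => ?_
    have h2 : ∀ x ∈ D n, (Metric.ediam (U n) ^ s)⁻¹ * volume (D n) ≤
        ∫⁻ y in E, edist x y ^ (-s) := by
      intro x hx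
      calc (Metric.ediam (U n) ^ s)⁻¹ * volume (D n)
          = ∫⁻ _ in D n, (Metric.ediam (U n) ^ s)⁻¹ := by rw [setLIntegral_const]
        _ ≤ ∫⁻ y in D n, edist x y ^ (-s) := by
          refine setLIntegral_mono' (hDm n) fun y hy => ?_
          rw [ENNReal.rpow_neg]
          exact ENNReal.inv_le_inv.2 (ENNReal.rpow_le_rpow
            (Metric.edist_le_ediam_of_mem (hDsub n hx) (hDsub n hy)) hs.le)
        _ ≤ _ := lintegral_mono_set (hDE n)
    calc volume (D n) * volume (D n) * (Metric.ediam (U n) ^ s)⁻¹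
        = ∫⁻ _ in D n, (Metric.ediam (U n) ^ s)⁻¹ * volume (D n) := by
          rw [setLIntegral_const]; ring
      _ ≤ _ := setLIntegral_mono' (hDm n) h2
  have hpt : ∀ n, c * volume (D n) ≤
      θ * (c ^ 2 * (volume (D n) * volume (D n) * (Metric.ediam (U n) ^ s)⁻¹)) +
        Metric.ediam (U n) ^ s / θ := by
    intro n
    by_cases h0 : Metric.ediam (U n) = 0
    · have : volume (D n) = 0 :=
        measure_mono_null (hDsub n) ((Metric.ediam_eq_zero_iff.1 h0).measure_zero _)
      simp [this]
    · have h1 : Metric.ediam (U n) ^ s ≠ 0 := by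
        simp [ENNReal.rpow_eq_zero_iff, h0, hUd n]
      have h2 := le_mul_sq_add_div (c * volume (D n)) h1
        (ENNReal.rpow_ne_top_of_nonneg hs.le (hUd n)) hθ hθ'
      refine h2.trans (le_of_eq ?_)
      ring
  calc c * volume E = ∑' n, c * volume (D n) := by rw [hvol, ENNReal.tsum_mul_left]
    _ ≤ ∑' n, (θ * (c ^ 2 * (volume (D n) * volume (D n) * (Metric.ediam (U n) ^ s)⁻¹)) +
        Metric.ediam (U n) ^ s / θ) := ENNReal.tsum_le_tsum hpt
    _ = θ * (c ^ 2 * ∑' n, volume (D n) * volume (D n) * (Metric.ediam (U n) ^ s)⁻¹) +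
        (∑' n, Metric.ediam (U n) ^ s) / θ := by
      rw [ENNReal.tsum_add, ENNReal.tsum_mul_left, ENNReal.tsum_mul_left]
      simp only [div_eq_mul_inv, ENNReal.tsum_mul_right]
    _ ≤ _ := by gcongr

/-- Lower bound on the Hausdorff dimension of a decreasing intersection by means of the energies of
normalized Lebesgue measures on the approximating sets. -/
theorem ofReal_le_dimH_iInter {s L : ℝ} (hs : 0 < s) {E : ℕ → Set ℝ} (hanti : Antitone E)
    (hsub : ∀ n, E n ⊆ Set.Icc 0 L) (hmeas : ∀ n, MeasurableSet (E n))
    (hcl : ∀ n, (closure (E n) \ E n).Countable) {c : ℕ → ℝ≥0∞} {a M : ℝ≥0∞} (ha : a ≠ 0)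
    (ha' : a ≠ ⊤) (hM : M ≠ ⊤)
    (h : ∃ᶠ n in Filter.atTop, a ≤ c n * volume (E n) ∧ c n ^ 2 * energy s (E n) ≤ M) :
    ENNReal.ofReal s ≤ dimH (⋂ n, E n) := by
  by_contra hlt
  rw [not_le] at hlt
  -- Passing to closures makes compactness available and costs only a countable set, which has
  -- dimension zero.
  set C : Set ℝ := ⋂ n, closure (E n) with hC
  have hCsub : C ⊆ (⋂ n, E n) ∪ ⋃ n, (closure (E n) \ E n) := by
    intro x hx
    by_cases hxE : ∀ n, x ∈ E n
    · exact Or.inl (Set.mem_iInter.2 hxE)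
    · push Not at hxE
      obtain ⟨n, hn⟩ := hxE
      exact Or.inr (Set.mem_iUnion.2 ⟨n, Set.mem_iInter.1 hx n, hn⟩)
  have hdim : dimH C < ENNReal.ofReal s := by
    refine (dimH_mono hCsub).trans_lt ?_
    rw [dimH_union, dimH_countable (Set.countable_iUnion hcl)]
    simpa using hlt
  have hnull : Measure.hausdorffMeasure s C = 0 := by
    have := hausdorffMeasure_of_dimH_lt (d := s.toNNReal) hdim
    rwa [Real.coe_toNNReal s hs.le] at this
  set M' : ℝ≥0∞ := M + 1
  have hM' : M' ≠ ⊤ := by simp [M', hM]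
  have hM0 : M' ≠ 0 := by simp [M']
  -- With this θ and a cover of content at most θ a/4, both terms of `volume_le_energy` are at most
  -- a/4, against a mass of at least a.
  set θ : ℝ≥0∞ := a / 4 / M' with hθ
  have ha4 : a / 4 ≠ 0 := ENNReal.div_ne_zero.2 ⟨ha, by simp⟩
  have ha4' : a / 4 ≠ ⊤ := ENNReal.div_ne_top ha' (by simp)
  have hθ0 : θ ≠ 0 := ENNReal.div_ne_zero.2 ⟨ha4, hM'⟩
  have hθ' : θ ≠ ⊤ := ENNReal.div_ne_top ha4' hM0
  obtain ⟨U, hUo, hCU, hUd, hUs⟩ := exists_open_cover hs hnull (η := θ * (a / 4))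
    (pos_iff_ne_zero.2 (mul_ne_zero hθ0 ha4))
  -- A decreasing sequence of compact sets enters every open neighbourhood of its intersection, so
  -- the cover of the limit already covers a finite stage.
  obtain ⟨i, hi⟩ := exists_subset_nhds_of_isCompact' (V := fun n => closure (E n))
    (directed_of_isDirected_le fun m n hmn => closure_mono (hanti hmn))
    (fun n => isCompact_Icc.of_isClosed_subset isClosed_closure
      (closure_minimal (hsub n) isClosed_Icc)) (fun n => isClosed_closure)
    (U := ⋃ n, U n) (fun x hx => (isOpen_iUnion hUo).mem_nhds (hCU hx))
  obtain ⟨n, hn, hn1, hn2⟩ := (Filter.frequently_atTop.1 h) i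
  have hEU : E n ⊆ ⋃ n, U n := subset_closure.trans ((closure_mono (hanti hn)).trans hi)
  have key := volume_le_energy hs (hmeas n) hUo hEU hUd (c := c n) hθ0 hθ'
  have k1 : θ * (c n ^ 2 * energy s (E n)) ≤ a / 4 := by
    calc _ ≤ θ * M' := by
          gcongr
          exact hn2.trans le_self_add
      _ = a / 4 := ENNReal.div_mul_cancel hM0 hM'
  have k2 : (∑' n, Metric.ediam (U n) ^ s) / θ ≤ a / 4 := by
    rw [ENNReal.div_le_iff hθ0 hθ', mul_comm]
    exact hUs
  have k3 : a ≤ a / 4 + a / 4 := (hn1.trans key).trans (add_le_add k1 k2)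
  have k4 : a / 4 + a / 4 = a / 2 := by
    rw [← two_mul, show (4 : ℝ≥0∞) = 2 * 2 by norm_num, div_eq_mul_inv, div_eq_mul_inv,
      ENNReal.mul_inv (by simp) (by simp)]
    calc 2 * (a * (2⁻¹ * 2⁻¹)) = (2 * 2⁻¹) * (a * 2⁻¹) := by ring
      _ = _ := by rw [ENNReal.mul_inv_cancel (by simp) (by simp), one_mul]
  rw [k4] at k3
  exact absurd (ENNReal.half_lt_self ha ha') (not_lt.2 k3)

/-! ### Bounds on products of correlations -/

theorem sum_pow_le_inv {x : ℝ} (hx0 : 0 ≤ x) (hx1 : x < 1) (s : Finset ℕ) :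
    ∑ k ∈ s, x ^ k ≤ (1 - x)⁻¹ := by
  rw [← tsum_geometric_of_lt_one hx0 hx1]
  exact (summable_geometric_of_lt_one hx0 hx1).sum_le_tsum s fun k _ => by positivity

theorem prod_le_exp_sum {r y : ℕ → ℝ} {s : Finset ℕ} (hr : ∀ k ∈ s, 0 ≤ r k)
    (hry : ∀ k ∈ s, r k ≤ 1 + y k) : ∏ k ∈ s, r k ≤ Real.exp (∑ k ∈ s, y k) := by
  rw [Real.exp_sum]
  exact Finset.prod_le_prod hr fun k hk => (hry k hk).trans (by
    rw [add_comm]; exact Real.add_one_le_exp _)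

theorem rpow_mul_pow {δ γ : ℝ} (hδ : 0 < δ) (hγ : 0 < γ) (k : ℕ) :
    (δ * γ ^ k) ^ (-(1 / 3) : ℝ) = δ ^ (-(1 / 3) : ℝ) * (γ ^ (-(1 / 3) : ℝ)) ^ k := by
  rw [Real.mul_rpow hδ.le (by positivity), ← Real.rpow_natCast, ← Real.rpow_natCast,
    ← Real.rpow_mul hγ.le, ← Real.rpow_mul hγ.le, mul_comm (k : ℝ)]

theorem prod_le_of_one_le {γ C : ℝ} (hγ : 1 < γ) (hC : 0 ≤ C) :
    ∃ A, 0 ≤ A ∧ ∀ (r : ℕ → ℝ) (δ : ℝ) (n : ℕ), 1 ≤ δ → (∀ k, 0 ≤ r k) →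
      (∀ k, r k ≤ 1 + C * (δ * γ ^ k) ^ (-(1 / 3) : ℝ)) →
      ∏ k ∈ Finset.range n, r k ≤ 1 + A * δ ^ (-(1 / 3) : ℝ) := by
  have hγ0 : 0 < γ := by linarith
  set x : ℝ := γ ^ (-(1 / 3) : ℝ) with hx
  have hx0 : 0 < x := Real.rpow_pos_of_pos hγ0 _
  have hx1 : x < 1 := Real.rpow_lt_one_of_one_lt_of_neg hγ (by norm_num)
  set B : ℝ := C * (1 - x)⁻¹ with hB
  have hB0 : 0 ≤ B := mul_nonneg hC (inv_nonneg.2 (by linarith))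
  refine ⟨B * Real.exp B, by positivity, fun r δ n hδ hr0 hr => ?_⟩
  have hδ0 : 0 < δ := by linarith
  set y : ℝ := δ ^ (-(1 / 3) : ℝ) with hy
  have hy0 : 0 < y := Real.rpow_pos_of_pos hδ0 _
  have hy1 : y ≤ 1 := Real.rpow_le_one_of_one_le_of_nonpos hδ (by norm_num)
  have h1 : ∏ k ∈ Finset.range n, r k ≤ Real.exp (∑ k ∈ Finset.range n, C * (y * x ^ k)) := by
    refine prod_le_exp_sum (fun k _ => hr0 k) fun k _ => ?_
    have := hr k
    rwa [rpow_mul_pow hδ0 hγ0] at this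
  have h2 : ∑ k ∈ Finset.range n, C * (y * x ^ k) ≤ B * y := by
    rw [← Finset.mul_sum, ← Finset.mul_sum]
    have := sum_pow_le_inv hx0.le hx1 (Finset.range n)
    calc C * (y * ∑ k ∈ Finset.range n, x ^ k) ≤ C * (y * (1 - x)⁻¹) := by gcongr
      _ = B * y := by rw [hB]; ring
  -- Since y ≤ 1 the exponential may be linearized; this preserves the constant 1, which the
  -- variance estimate needs.
  have h3 : Real.exp (B * y) ≤ 1 + B * Real.exp B * y := by
    have e1 : Real.exp (B * y) * (1 - B * y) ≤ 1 := by
      have := Real.add_one_le_exp (-(B * y))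
      calc Real.exp (B * y) * (1 - B * y) ≤ Real.exp (B * y) * Real.exp (-(B * y)) := by
            gcongr; linarith
        _ = 1 := by rw [← Real.exp_add]; simp
    have e2 : Real.exp (B * y) ≤ Real.exp B := Real.exp_le_exp.2 (by nlinarith)
    have e3 : Real.exp (B * y) * (B * y) ≤ Real.exp B * (B * y) := by gcongr
    linarith
  exact h1.trans ((Real.exp_le_exp.2 h2).trans h3)

theorem prod_le_of_lt_one {γ C G : ℝ} (hγ : 1 < γ) (hC : 0 ≤ C) (hG : 1 ≤ G) :
    ∃ A, 0 ≤ A ∧ ∀ (r : ℕ → ℝ) (δ : ℝ) (n : ℕ), 0 < δ → δ < 1 → (∀ k, 0 ≤ r k) →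
      (∀ k, r k ≤ G) → (∀ k, r k ≤ 1 + C * (δ * γ ^ k) ^ (-(1 / 3) : ℝ)) →
      ∏ k ∈ Finset.range n, r k ≤ A * δ ^ (-(Real.log G / Real.log γ)) := by
  have hγ0 : 0 < γ := by linarith
  have hlog : 0 < Real.log γ := Real.log_pos hγ
  set x : ℝ := γ ^ (-(1 / 3) : ℝ) with hx
  have hx0 : 0 < x := Real.rpow_pos_of_pos hγ0 _
  have hx1 : x < 1 := Real.rpow_lt_one_of_one_lt_of_neg hγ (by norm_num)
  set B : ℝ := C * (1 - x)⁻¹ with hB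
  refine ⟨G * Real.exp B, by positivity, fun r δ n hδ0 hδ1 hr0 hrG hr => ?_⟩
  -- The first index with δ γ^m ≥ 1. Each earlier factor costs G, and the later ones have
  -- geometrically summable errors.
  set m : ℕ := ⌈Real.log (1 / δ) / Real.log γ⌉₊ with hm
  have hlδ : 0 < Real.log (1 / δ) := Real.log_pos (by rw [lt_div_iff₀ hδ0]; linarith)
  have hmle : (m : ℝ) ≤ Real.log (1 / δ) / Real.log γ + 1 :=
    (Nat.ceil_lt_add_one (by positivity)).le
  have hmγ : 1 ≤ δ * γ ^ m := by
    have h1 : Real.log (1 / δ) ≤ m * Real.log γ := by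
      have := Nat.le_ceil (Real.log (1 / δ) / Real.log γ)
      rwa [div_le_iff₀ hlog] at this
    rw [← Real.log_pow] at h1
    have h2 := (Real.log_le_log_iff (by positivity) (by positivity)).1 h1
    rw [div_le_iff₀ hδ0] at h2
    linarith
  have hbig : ∀ j : ℕ, r (m + j) ≤ 1 + C * x ^ j := by
    intro j
    refine (hr (m + j)).trans ?_
    gcongr
    calc (δ * γ ^ (m + j)) ^ (-(1 / 3) : ℝ) ≤ (γ ^ j) ^ (-(1 / 3) : ℝ) := by
          refine Real.rpow_le_rpow_of_nonpos (by positivity) ?_ (by norm_num)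
          rw [pow_add, ← mul_assoc]
          exact le_mul_of_one_le_left (by positivity) hmγ
      _ = x ^ j := by
          rw [hx, ← Real.rpow_natCast, ← Real.rpow_natCast, ← Real.rpow_mul hγ0.le,
            ← Real.rpow_mul hγ0.le, mul_comm]
  have hprod : ∏ k ∈ Finset.range n, r k ≤ G ^ m * Real.exp B := by
    rcases le_total n m with hnm | hnm
    · calc ∏ k ∈ Finset.range n, r k ≤ ∏ _k ∈ Finset.range n, G :=
            Finset.prod_le_prod (fun k _ => hr0 k) fun k _ => hrG k
        _ = G ^ n := by simp
        _ ≤ G ^ m := pow_le_pow_right₀ hG hnm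
        _ ≤ G ^ m * Real.exp B := by
          refine le_mul_of_one_le_right (by positivity) (Real.one_le_exp ?_)
          exact mul_nonneg hC (inv_nonneg.2 (by linarith))
    · obtain ⟨l, rfl⟩ := Nat.exists_eq_add_of_le hnm
      rw [Finset.prod_range_add]
      have h1 : ∏ k ∈ Finset.range m, r k ≤ G ^ m := by
        calc ∏ k ∈ Finset.range m, r k ≤ ∏ _k ∈ Finset.range m, G :=
              Finset.prod_le_prod (fun k _ => hr0 k) fun k _ => hrG k
          _ = G ^ m := by simp
      have h2 : ∏ k ∈ Finset.range l, r (m + k) ≤ Real.exp B := by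
        refine (prod_le_exp_sum (y := fun j => C * x ^ j) (fun k _ => hr0 _)
          fun k _ => hbig k).trans (Real.exp_le_exp.2 ?_)
        rw [← Finset.mul_sum]
        exact mul_le_mul_of_nonneg_left (sum_pow_le_inv hx0.le hx1 (Finset.range l)) hC
      exact mul_le_mul h1 h2 (Finset.prod_nonneg fun k _ => hr0 _) (by positivity)
  have hGm : G ^ m ≤ G * δ ^ (-(Real.log G / Real.log γ)) := by
    have hG0 : 0 < G := by linarith
    rw [← Real.rpow_natCast]
    calc G ^ (m : ℝ) ≤ G ^ (Real.log (1 / δ) / Real.log γ + 1) :=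
          Real.rpow_le_rpow_of_exponent_le hG hmle
      _ = G * G ^ (Real.log (1 / δ) / Real.log γ) := by
        rw [Real.rpow_add hG0, Real.rpow_one, mul_comm]
      _ = _ := by
        congr 1
        rw [Real.rpow_def_of_pos hG0, Real.rpow_def_of_pos hδ0, one_div, Real.log_inv]
        congr 1
        ring
  calc _ ≤ G ^ m * Real.exp B := hprod
    _ ≤ (G * δ ^ (-(Real.log G / Real.log γ))) * Real.exp B := by gcongr
    _ = _ := by ring

/-- The two bounds on the correlations that are used below. -/
theorem exists_prod_bounds {γ C G : ℝ} (hγ : 1 < γ) (hC : 0 ≤ C) (hG : 1 ≤ G) :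
    ∃ A, 0 ≤ A ∧ ∀ (r : ℕ → ℝ) (δ : ℝ) (n : ℕ), 0 < δ → (∀ k, 0 ≤ r k) →
      (∀ k, r k ≤ G) → (∀ k, r k ≤ 1 + C * (δ * γ ^ k) ^ (-(1 / 3) : ℝ)) →
      ∏ k ∈ Finset.range n, r k ≤ A * (1 + δ ^ (-(Real.log G / Real.log γ))) ∧
      ∏ k ∈ Finset.range n, r k ≤
        1 + A * (δ ^ (-(Real.log G / Real.log γ)) + δ ^ (-(1 / 3) : ℝ)) := by
  obtain ⟨A₁, hA₁, h₁⟩ := prod_le_of_one_le hγ hC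
  obtain ⟨A₂, hA₂, h₂⟩ := prod_le_of_lt_one hγ hC hG
  refine ⟨1 + A₁ + A₂, by positivity, fun r δ n hδ hr0 hrG hr => ?_⟩
  set u := δ ^ (-(Real.log G / Real.log γ)) with hu
  set v := δ ^ (-(1 / 3) : ℝ) with hv
  have hu0 : 0 < u := Real.rpow_pos_of_pos hδ _
  have hv0 : 0 < v := Real.rpow_pos_of_pos hδ _
  rcases lt_or_ge δ 1 with h | h
  · have := h₂ r δ n hδ h hr0 hrG hr
    have e1 : 0 ≤ A₁ * u := by positivity
    have e2 : 0 ≤ A₁ * v := by positivity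
    have e3 : 0 ≤ A₂ * v := by positivity
    constructor <;> nlinarith
  · have := h₁ r δ n h hr0 hr
    have hv1 : v ≤ 1 := Real.rpow_le_one_of_one_le_of_nonpos h (by norm_num)
    have e1 : 0 ≤ A₁ * u := by positivity
    have e2 : 0 ≤ A₂ * u := by positivity
    have e3 : 0 ≤ A₂ * v := by positivity
    constructor <;> nlinarith

/-! ### Integrals of the Riesz kernel -/

theorem edist_rpow_eq {x y : ℝ} (hxy : x ≠ y) (β : ℝ) :
    edist x y ^ (-β) = ENNReal.ofReal (|x - y| ^ (-β)) := by
  rw [edist_dist, Real.dist_eq, ENNReal.ofReal_rpow_of_pos (abs_pos.2 (sub_ne_zero.2 hxy))]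

theorem lintegral_rpow_Ioc {β L : ℝ} (hβ : β < 1) (hL : 0 ≤ L) :
    ∫⁻ u in Set.Ioc 0 L, ENNReal.ofReal (|u| ^ (-β)) = ENNReal.ofReal (L ^ (1 - β) / (1 - β)) := by
  have h1 : ∫⁻ u in Set.Ioc 0 L, ENNReal.ofReal (|u| ^ (-β)) =
      ∫⁻ u in Set.Ioc 0 L, ENNReal.ofReal (u ^ (-β)) :=
    setLIntegral_congr_fun measurableSet_Ioc fun u hu => by
      rw [abs_of_pos hu.1]
  have hlow : IntegrableOn (fun u : ℝ => u ^ (-β)) (Set.Ioc 0 L) :=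
    (intervalIntegrable_iff_integrableOn_Ioc_of_le hL).1
      (intervalIntegral.intervalIntegrable_rpow' (by linarith))
  rw [h1, ← ofReal_integral_eq_lintegral_ofReal hlow]
  · rw [← intervalIntegral.integral_of_le hL, integral_rpow (Or.inl (by linarith)),
      Real.zero_rpow (by linarith), sub_zero]
    congr 2 <;> ring_nf
  · filter_upwards [ae_restrict_mem measurableSet_Ioc] with u hu
    exact Real.rpow_nonneg hu.1.le _

theorem lintegral_edist_rpow_le {β L x : ℝ} (hβ : β < 1) (hL : 0 ≤ L) (hx : x ∈ Set.Icc 0 L) :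
    ∫⁻ y in Set.Icc 0 L, edist x y ^ (-β) ≤ ENNReal.ofReal (2 * (L ^ (1 - β) / (1 - β))) := by
  set g : ℝ → ℝ≥0∞ := fun u => (Set.Ioc 0 L).indicator (fun u => ENNReal.ofReal (|u| ^ (-β))) u
    with hg
  have hgm : Measurable g :=
    (ENNReal.measurable_ofReal.comp (measurable_norm.pow_const _)).indicator measurableSet_Ioc
  have hI : ∫⁻ u, g u = ENNReal.ofReal (L ^ (1 - β) / (1 - β)) := by
    rw [hg, lintegral_indicator measurableSet_Ioc, lintegral_rpow_Ioc hβ hL]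
  rw [← lintegral_indicator measurableSet_Icc]
  -- Both sides of x are translated or reflected into (0, L]; the diagonal, where the kernel may be
  -- infinite, is null.
  have hle : ∀ᵐ y, (Set.Icc 0 L).indicator (fun y => edist x y ^ (-β)) y ≤ g (y - x) + g (x - y) := by
    have hne : ∀ᵐ y : ℝ, y ≠ x := by
      simp [ae_iff]
    filter_upwards [hne] with y hy
    by_cases hyI : y ∈ Set.Icc 0 L
    · rw [Set.indicator_of_mem hyI, edist_rpow_eq hy.symm]
      rcases lt_or_gt_of_ne hy with h | h
      · have : x - y ∈ Set.Ioc 0 L := ⟨by linarith, by linarith [hyI.1, hx.2]⟩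
        simp only [hg, Set.indicator_of_mem this]
        exact le_add_self
      · have : y - x ∈ Set.Ioc 0 L := ⟨by linarith, by linarith [hx.1, hyI.2]⟩
        simp only [hg, Set.indicator_of_mem this]
        rw [abs_sub_comm]
        exact le_self_add
    · rw [Set.indicator_of_notMem hyI]
      exact zero_le
  refine (lintegral_mono_ae hle).trans (le_of_eq ?_)
  have hgx : Measurable fun y => g (y - x) := hgm.comp (measurable_id.sub_const x)
  rw [lintegral_add_left hgx, lintegral_sub_right_eq_self g x,
    lintegral_sub_left_eq_self g x, hI, ← two_mul, ENNReal.ofReal_mul (by norm_num)]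
  simp

theorem lintegral_lintegral_edist_rpow_le {β L : ℝ} (hβ : β < 1) (hL : 0 ≤ L) :
    ∫⁻ x in Set.Icc 0 L, ∫⁻ y in Set.Icc 0 L, edist x y ^ (-β) ≤
      ENNReal.ofReal (2 * (L ^ (1 - β) / (1 - β)) * L) := by
  calc ∫⁻ x in Set.Icc 0 L, ∫⁻ y in Set.Icc 0 L, edist x y ^ (-β)
      ≤ ∫⁻ _ in Set.Icc 0 L, ENNReal.ofReal (2 * (L ^ (1 - β) / (1 - β))) :=
        setLIntegral_mono' measurableSet_Icc fun x hx => lintegral_edist_rpow_le hβ hL hx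
    _ = _ := by
      rw [setLIntegral_const, Real.volume_Icc, sub_zero, ← ENNReal.ofReal_mul]
      exact mul_nonneg (by norm_num) (div_nonneg (Real.rpow_nonneg hL _) (by linarith))

/-! ### Probabilities of the box events -/

/-- The probability of the `k`-th box event. -/
def boxProb (γ : ℝ) (k : ℕ) : ℝ :=
  surv (2 * (boxSize γ k).toNat) ((boxSize γ k).toNat ^ 2) (boxSize γ k).toNat

/-- The probability that the `k`-th box event occurs at two times whose arrows have correlation
`ρ`. -/
def boxPairProb (γ ρ : ℝ) (k : ℕ) : ℝ :=
  pairSurv ρ (2 * (boxSize γ k).toNat) ((boxSize γ k).toNat ^ 2) (boxSize γ k).toNat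
    (boxSize γ k).toNat

theorem le_boxProb {γ : ℝ} (hγ : 0 < γ) (k : ℕ) : Real.exp (-8) / 3 ≤ boxProb γ k := by
  have h1 := boxSize_eq_toNat hγ k
  obtain ⟨e, he⟩ : ∃ e : ℕ, (boxSize γ k).toNat = 2 * e := by
    refine ⟨(⌊γ ^ k / 2⌋ + 1).toNat, ?_⟩
    have h0 : 0 ≤ ⌊γ ^ k / 2⌋ := Int.floor_nonneg.2 (by positivity)
    simp only [boxSize]
    lia
  have := le_surv e (by lia)
  unfold boxProb
  rw [he]
  push_cast
  exact this

theorem boxProb_pos {γ : ℝ} (hγ : 0 < γ) (k : ℕ) : 0 < boxProb γ k :=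
  lt_of_lt_of_le (by positivity) (le_boxProb hγ k)

theorem boxProb_zero (γ : ℝ) : boxProb γ 0 = 1 / 16 := by
  have : (boxSize γ 0).toNat = 2 := by rw [boxSize_zero]; rfl
  simp only [boxProb, this]
  norm_num [surv]

section

variable {Ω : Type*} {W : Site → ℕ → Ω → ℝ} {ε : Site → ℕ → Ω → Bool}

theorem siteAlg_measurableSet_boxSurvives {γ : ℝ} (hγ : 0 < γ) (k : ℕ) (τ : ℝ) :
    MeasurableSet[siteAlg W ε (rows (boxT γ k) (boxT γ (k + 1)))]
      {ω | BoxSurvives γ k (arrows W ε τ ω)} := by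
  rw [boxT_succ' hγ]
  exact siteAlg_measurableSet_survives τ _ _ _ (boxBase γ k)

theorem boxT_mono {γ : ℝ} : Monotone (boxT γ) :=
  monotone_nat_of_le_succ fun k => by
    rw [boxT_succ]
    nlinarith [sq_nonneg (boxSize γ k)]

/-- The set of times in `[0, L]` at which the first `n` box events occur. -/
def boxTimes (W : Site → ℕ → Ω → ℝ) (ε : Site → ℕ → Ω → Bool) (γ L : ℝ) (n : ℕ) (ω : Ω) : Set ℝ :=
  {τ | τ ∈ Set.Icc 0 L ∧ ∀ k < n, BoxSurvives γ k (arrows W ε τ ω)}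

theorem boxTimes_anti (γ L : ℝ) (ω : Ω) : Antitone fun n => boxTimes W ε γ L n ω :=
  fun _ _ hmn _ hτ => ⟨hτ.1, fun k hk => hτ.2 k (hk.trans_le hmn)⟩

theorem iInter_boxTimes_subset {γ : ℝ} (hγ : 4 ≤ γ) (L : ℝ) (ω : Ω) :
    ⋂ n, boxTimes W ε γ L n ω ⊆ exceptionalTimes W ε (kOf γ) ω := by
  intro τ hτ
  rw [Set.mem_iInter] at hτ
  exact ⟨(hτ 0).1.1, fun t ht => neg_kOf_mul_sqrt_le_path hγ
    (fun k => (hτ (k + 1)).2 k (Nat.lt_succ_self k)) ht⟩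

/-! ### Limit points and measurability of the approximating sets. -/

theorem GoodClocks.eventually_rings_eq {ω : Ω} (hω : GoodClocks W ω) (z : Site) {τ : ℝ}
    (hτ : ∀ n, ringTime W z n ω ≠ τ) : ∀ᶠ σ in 𝓝 τ, rings W σ ω z = rings W τ ω z := by
  obtain ⟨N, hN⟩ := (hω z).2 (τ + 1)
  have h1 : ∀ᶠ σ in 𝓝 τ, ∀ n ∈ Finset.range N,
      (ringTime W z (n + 1) ω ≤ σ ↔ ringTime W z (n + 1) ω ≤ τ) := by
    rw [Filter.eventually_all_finset]
    intro n _
    rcases lt_or_gt_of_ne (hτ (n + 1)) with h | h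
    · filter_upwards [lt_mem_nhds h] with σ hσ
      exact ⟨fun _ => h.le, fun _ => hσ.le⟩
    · filter_upwards [gt_mem_nhds h] with σ hσ
      exact ⟨fun h' => absurd h' (not_le.2 hσ), fun h' => absurd h' (not_le.2 h)⟩
  filter_upwards [h1, gt_mem_nhds (show τ < τ + 1 by linarith)] with σ h2 h3
  rw [rings_eq, rings_eq]
  congr 1
  ext n
  simp only [Set.mem_ofPred_eq]
  by_cases hn : n < N
  · exact h2 n (Finset.mem_range.2 hn)
  · have h4 : ringTime W z N ω ≤ ringTime W z (n + 1) ω :=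
      (hω.strictMono z).monotone (by lia)
    exact ⟨fun h' => by linarith, fun h' => by linarith⟩

theorem eventually_survives_iff {ω : Ω} {τ : ℝ}
    (h : ∀ z, ∀ᶠ σ in 𝓝 τ, rings W σ ω z = rings W τ ω z) (lo hi : ℤ) (n : ℕ) (z : Site) :
    ∀ᶠ σ in 𝓝 τ, (Survives (arrows W ε σ ω) lo hi n z ↔ Survives (arrows W ε τ ω) lo hi n z) := by
  induction n generalizing z with
  | zero => exact Filter.Eventually.of_forall fun σ => Iff.rfl
  | succ n ih =>
    filter_upwards [h z, ih (step (arrows W ε τ ω) z)] with σ h1 h2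
    have h3 : step (arrows W ε σ ω) z = step (arrows W ε τ ω) z := by
      simp only [step_eq_nbr, arrows, h1]
    simp only [Survives, h3, h2]

/-- Finitely many box events read finitely many arrows along the paths, so away from the countably
many ring times membership is locally constant. -/
theorem GoodClocks.countable_closure_sdiff {ω : Ω} (hω : GoodClocks W ω) (γ L : ℝ) (n : ℕ) :
    (closure (boxTimes W ε γ L n ω) \ boxTimes W ε γ L n ω).Countable := by
  refine (Set.countable_range fun p : Site × ℕ => ringTime W p.1 p.2 ω).mono ?_
  rintro τ ⟨h1, h2⟩
  by_contra hc
  have h3 : ∀ z, ∀ᶠ σ in 𝓝 τ, rings W σ ω z = rings W τ ω z := fun z =>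
    hω.eventually_rings_eq z fun n hn => hc ⟨(z, n), hn⟩
  have h4 : ∀ᶠ σ in 𝓝 τ, ∀ k ∈ Finset.range n,
      (BoxSurvives γ k (arrows W ε σ ω) ↔ BoxSurvives γ k (arrows W ε τ ω)) := by
    rw [Filter.eventually_all_finset]
    exact fun k _ => eventually_survives_iff h3 _ _ _ _
  have h5 : τ ∈ Set.Icc 0 L :=
    closure_minimal (fun σ hσ => hσ.1) isClosed_Icc h1
  obtain ⟨σ, hσ, hσ'⟩ := ((mem_closure_iff_frequently.1 h1).and_eventually h4).exists
  exact h2 ⟨h5, fun k hk => (hσ' k (Finset.mem_range.2 hk)).1 (hσ.2 k hk)⟩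

variable [mΩ : MeasurableSpace Ω] {P : Measure Ω}

theorem measurableSet_boxTimes_prod (h : IsWebNoise P W ε) (γ L : ℝ) (n : ℕ) :
    MeasurableSet {p : ℝ × Ω | p.1 ∈ boxTimes W ε γ L n p.2} := by
  have h1 : {p : ℝ × Ω | p.1 ∈ boxTimes W ε γ L n p.2} =
      (Prod.fst ⁻¹' Set.Icc 0 L) ∩
        ⋂ k ∈ Finset.range n, {p : ℝ × Ω | BoxSurvives γ k (arrows W ε p.1 p.2)} := by
    ext p
    simp [boxTimes]
  rw [h1]
  refine (measurable_fst measurableSet_Icc).inter (Finset.measurableSet_biInter _ fun k _ => ?_)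
  exact measurableSet_survives _ _ _ _ fun y _ _ => measurable_arrows_prod h y

theorem measurableSet_boxTimes (h : IsWebNoise P W ε) (γ L : ℝ) (n : ℕ) (ω : Ω) :
    MeasurableSet (boxTimes W ε γ L n ω) :=
  measurable_prodMk_right (measurableSet_boxTimes_prod h γ L n)

theorem IsWebNoise.measurable_volume_boxTimes (h : IsWebNoise P W ε) (γ L : ℝ) (n : ℕ) :
    Measurable fun ω => volume (boxTimes W ε γ L n ω) :=
  measurable_measure_prodMk_right (measurableSet_boxTimes_prod h γ L n)

theorem energy_eq_lintegral (s : ℝ) {E : Set ℝ} (hE : MeasurableSet E) :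
    energy s E = ∫⁻ x, ∫⁻ y, E.indicator 1 x * E.indicator 1 y * edist x y ^ (-s) := by
  unfold energy
  rw [← lintegral_indicator hE]
  refine lintegral_congr fun x => ?_
  by_cases hx : x ∈ E
  · rw [Set.indicator_of_mem hx, ← lintegral_indicator hE]
    refine lintegral_congr fun y => ?_
    by_cases hy : y ∈ E <;> simp [hx, hy]
  · simp [hx]

theorem measurable_edist_rpow (s : ℝ) : Measurable fun p : ℝ × ℝ => edist p.1 p.2 ^ (-s) :=
  (measurable_fst.edist measurable_snd).pow_const _

theorem IsWebNoise.measurable_energy_integrand (h : IsWebNoise P W ε) (γ L s : ℝ) (n : ℕ) :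
    Measurable fun q : (Ω × ℝ) × ℝ => (boxTimes W ε γ L n q.1.1).indicator 1 q.1.2 *
      (boxTimes W ε γ L n q.1.1).indicator 1 q.2 * edist q.1.2 q.2 ^ (-s) := by
  have hJ := measurableSet_boxTimes_prod h γ L n
  have hind : Measurable fun p : ℝ × Ω => (boxTimes W ε γ L n p.2).indicator (1 : ℝ → ℝ≥0∞) p.1 :=
    (measurable_const (a := (1 : ℝ≥0∞))).indicator hJ
  refine ((hind.comp (measurable_fst.snd.prodMk measurable_fst.fst)).mul
    (hind.comp (measurable_snd.prodMk measurable_fst.fst))).mul ?_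
  exact (measurable_edist_rpow s).comp (measurable_fst.snd.prodMk measurable_snd)

theorem IsWebNoise.measurable_energy (h : IsWebNoise P W ε) (γ L s : ℝ) (n : ℕ) :
    Measurable fun ω => energy s (boxTimes W ε γ L n ω) := by
  have : (fun ω => energy s (boxTimes W ε γ L n ω)) = fun ω => ∫⁻ x, ∫⁻ y,
      (boxTimes W ε γ L n ω).indicator 1 x * (boxTimes W ε γ L n ω).indicator 1 y *
        edist x y ^ (-s) :=
    funext fun ω => energy_eq_lintegral s (measurableSet_boxTimes h γ L n ω)
  rw [this]
  exact (h.measurable_energy_integrand γ L s n).lintegral_prod_right'.lintegral_prod_right'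

variable [IsProbabilityMeasure P]

theorem IsWebNoise.real_boxSurvives (h : IsWebNoise P W ε) {γ : ℝ} (hγ : 0 < γ) (k : ℕ) {τ : ℝ}
    (hτ : 0 ≤ τ) : P.real {ω | BoxSurvives γ k (arrows W ε τ ω)} = boxProb γ k := by
  have h1 := h.survives_prob hτ (boxX γ k - boxSize γ k) (boxX γ (k + 1))
    ((boxSize γ k).toNat ^ 2) (boxBase γ k)
  refine h1.trans ?_
  have e1 : boxX γ (k + 1) - (boxX γ k - boxSize γ k) = 2 * (boxSize γ k).toNat := by
    rw [(boxSize_eq_toNat hγ k).1, boxX_succ]; ring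
  have e2 : (boxBase γ k).1.1 - (boxX γ k - boxSize γ k) = (boxSize γ k).toNat := by
    rw [(boxSize_eq_toNat hγ k).1]; simp [boxBase]
  rw [e1, e2, boxProb]

theorem IsWebNoise.real_boxSurvives_pair (h : IsWebNoise P W ε) {γ : ℝ} (hγ : 0 < γ) (k : ℕ)
    {τ δ : ℝ} (hτ : 0 ≤ τ) (hδ : 0 ≤ δ) :
    P.real ({ω | BoxSurvives γ k (arrows W ε τ ω)} ∩
      {ω | BoxSurvives γ k (arrows W ε (τ + δ) ω)}) = boxPairProb γ (Real.exp (-δ)) k := by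
  have h1 := h.survives_pair_prob hτ hδ (boxX γ k - boxSize γ k) (boxX γ (k + 1))
    ((boxSize γ k).toNat ^ 2) (boxBase γ k) (boxBase γ k) rfl
  refine h1.trans ?_
  have e1 : boxX γ (k + 1) - (boxX γ k - boxSize γ k) = 2 * (boxSize γ k).toNat := by
    rw [(boxSize_eq_toNat hγ k).1, boxX_succ]; ring
  have e2 : (boxBase γ k).1.1 - (boxX γ k - boxSize γ k) = (boxSize γ k).toNat := by
    rw [(boxSize_eq_toNat hγ k).1]; simp [boxBase]
  rw [e1, e2, boxPairProb]

theorem IsWebNoise.boxPairProb_le_boxProb (h : IsWebNoise P W ε) {γ : ℝ} (hγ : 0 < γ) (k : ℕ)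
    {δ : ℝ} (hδ : 0 ≤ δ) : boxPairProb γ (Real.exp (-δ)) k ≤ boxProb γ k := by
  rw [← h.real_boxSurvives_pair hγ k le_rfl hδ, ← h.real_boxSurvives hγ k le_rfl]
  exact measureReal_mono Set.inter_subset_left

/-- Box k uses only rows from t_k up to t_{k+1}, so events attached to different boxes are
independent. Stated for general events to serve one and two dynamical times alike. -/
theorem IsWebNoise.real_forall_lt (h : IsWebNoise P W ε) {γ : ℝ} {B : ℕ → Set Ω}
    (hB : ∀ k, MeasurableSet[siteAlg W ε (rows (boxT γ k) (boxT γ (k + 1)))] (B k)) (n : ℕ) :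
    P.real {ω | ∀ k < n, ω ∈ B k} = ∏ k ∈ Finset.range n, P.real (B k) := by
  have hsucc : ∀ n, {ω | ∀ k < n + 1, ω ∈ B k} = {ω | ∀ k < n, ω ∈ B k} ∩ B n := by
    intro n
    ext ω
    simp only [Set.mem_ofPred_eq, Set.mem_inter_iff, Nat.lt_succ_iff_lt_or_eq]
    exact ⟨fun h => ⟨fun k hk => h k (Or.inl hk), h n (Or.inr rfl)⟩,
      fun h k hk => hk.elim (h.1 k) fun e => e ▸ h.2⟩
  have hm : ∀ n, MeasurableSet[siteAlg W ε (rows 0 (boxT γ n))] {ω | ∀ k < n, ω ∈ B k} := by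
    intro n
    induction n with
    | zero => simp
    | succ n ih =>
      rw [hsucc]
      refine MeasurableSet.inter (siteAlg_mono ?_ _ ih) (siteAlg_mono ?_ _ (hB n))
      · exact fun z hz => ⟨hz.1, hz.2.trans_le (boxT_mono (Nat.le_succ n))⟩
      · refine fun z hz => ⟨le_trans ?_ hz.1, hz.2⟩
        exact Finset.sum_nonneg fun i _ => sq_nonneg _
  induction n with
  | zero => simp
  | succ n ih =>
    rw [hsucc, Finset.prod_range_succ, ← ih]
    exact h.real_inter_of_disjoint_sites (rows_disjoint le_rfl) (hm n) (hB n)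

theorem IsWebNoise.real_mem_boxTimes (h : IsWebNoise P W ε) {γ : ℝ} (hγ : 0 < γ) {L τ : ℝ}
    (hτ : τ ∈ Set.Icc 0 L) (n : ℕ) :
    P.real {ω | τ ∈ boxTimes W ε γ L n ω} = ∏ k ∈ Finset.range n, boxProb γ k := by
  have h1 : {ω | τ ∈ boxTimes W ε γ L n ω} =
      {ω | ∀ k < n, ω ∈ {ω | BoxSurvives γ k (arrows W ε τ ω)}} := by
    ext ω
    simp [boxTimes, hτ.1, hτ.2]
  rw [h1, h.real_forall_lt fun k => siteAlg_measurableSet_boxSurvives hγ k τ]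
  exact Finset.prod_congr rfl fun k _ => h.real_boxSurvives hγ k hτ.1

theorem IsWebNoise.real_mem_boxTimes_pair (h : IsWebNoise P W ε) {γ : ℝ} (hγ : 0 < γ) {L τ σ : ℝ}
    (hτ : τ ∈ Set.Icc 0 L) (hσ : σ ∈ Set.Icc 0 L) (n : ℕ) :
    P.real {ω | τ ∈ boxTimes W ε γ L n ω ∧ σ ∈ boxTimes W ε γ L n ω} =
      ∏ k ∈ Finset.range n, boxPairProb γ (Real.exp (-|τ - σ|)) k := by
  wlog hle : τ ≤ σ generalizing τ σ
  · have := this hσ hτ (by linarith)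
    rw [abs_sub_comm, ← this]
    congr 1
    ext ω
    exact and_comm
  have h1 : {ω | τ ∈ boxTimes W ε γ L n ω ∧ σ ∈ boxTimes W ε γ L n ω} =
      {ω | ∀ k < n, ω ∈ {ω | BoxSurvives γ k (arrows W ε τ ω)} ∩
        {ω | BoxSurvives γ k (arrows W ε σ ω)}} := by
    ext ω
    simp only [boxTimes, Set.mem_ofPred_eq, Set.mem_inter_iff, hτ, hσ, true_and]
    exact ⟨fun h k hk => ⟨h.1 k hk, h.2 k hk⟩, fun h => ⟨fun k hk => (h k hk).1,
      fun k hk => (h k hk).2⟩⟩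
  rw [h1, h.real_forall_lt fun k => MeasurableSet.inter
    (siteAlg_measurableSet_boxSurvives hγ k τ) (siteAlg_measurableSet_boxSurvives hγ k σ)]
  refine Finset.prod_congr rfl fun k _ => ?_
  obtain ⟨δ, rfl⟩ : ∃ δ, σ = τ + δ := ⟨σ - τ, by ring⟩
  have hδ : 0 ≤ δ := by linarith
  rw [h.real_boxSurvives_pair hγ k hτ.1 hδ, show τ - (τ + δ) = -δ by ring, abs_neg,
    abs_of_nonneg hδ]

/-! ### Moments -/

/-- The normalization of Lebesgue measure on `boxTimes`. -/
def boxNorm (γ : ℝ) (n : ℕ) : ℝ≥0∞ := ENNReal.ofReal (∏ k ∈ Finset.range n, (boxProb γ k)⁻¹)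

theorem boxNorm_mul {γ : ℝ} (hγ : 0 < γ) (n : ℕ) :
    boxNorm γ n * ENNReal.ofReal (∏ k ∈ Finset.range n, boxProb γ k) = 1 := by
  have h0 := fun k => boxProb_pos hγ k
  rw [boxNorm, ← ENNReal.ofReal_mul (Finset.prod_nonneg fun k _ => (inv_pos.2 (h0 k)).le),
    ← Finset.prod_mul_distrib, Finset.prod_congr rfl fun k _ => inv_mul_cancel₀ (h0 k).ne']
  simp

theorem IsWebNoise.lintegral_volume (h : IsWebNoise P W ε) {γ L : ℝ} (hγ : 0 < γ) (n : ℕ) :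
    ∫⁻ ω, boxNorm γ n * volume (boxTimes W ε γ L n ω) ∂P = ENNReal.ofReal L := by
  have hJ := measurableSet_boxTimes_prod h γ L n
  have h1 : ∫⁻ ω, volume (boxTimes W ε γ L n ω) ∂P =
      ∫⁻ τ, P {ω | τ ∈ boxTimes W ε γ L n ω} := by
    have a1 := Measure.prod_apply (μ := (volume : Measure ℝ)) (ν := P) hJ
    have a2 := Measure.prod_apply_symm (μ := (volume : Measure ℝ)) (ν := P) hJ
    exact a2.symm.trans a1
  have h2 : ∀ τ, boxNorm γ n * P {ω | τ ∈ boxTimes W ε γ L n ω} =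
      (Set.Icc 0 L).indicator (fun _ => 1) τ := by
    intro τ
    by_cases hτ : τ ∈ Set.Icc 0 L
    · rw [Set.indicator_of_mem hτ, ← boxNorm_mul hγ n, ← h.real_mem_boxTimes hγ hτ n,
        ofReal_measureReal]
    · have : {ω | τ ∈ boxTimes W ε γ L n ω} = ∅ := by
        ext ω
        simp only [Set.mem_ofPred_eq, Set.mem_empty_iff_false, iff_false]
        exact fun h => hτ h.1
      rw [this, Set.indicator_of_notMem hτ]
      simp
  rw [lintegral_const_mul _ (h.measurable_volume_boxTimes γ L n), h1,
    ← lintegral_const_mul' _ _ (by simp [boxNorm]), lintegral_congr h2,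
    lintegral_indicator measurableSet_Icc]
  simp

theorem IsWebNoise.lintegral_energy (h : IsWebNoise P W ε) (γ L s : ℝ) (n : ℕ) :
    ∫⁻ ω, energy s (boxTimes W ε γ L n ω) ∂P =
      ∫⁻ x, ∫⁻ y, P {ω | x ∈ boxTimes W ε γ L n ω ∧ y ∈ boxTimes W ε γ L n ω} *
        edist x y ^ (-s) := by
  have hset : ∀ z, MeasurableSet {ω | z ∈ boxTimes W ε γ L n ω} := fun z =>
    measurable_prodMk_left (measurableSet_boxTimes_prod h γ L n)
  have h1 := fun ω => energy_eq_lintegral s (measurableSet_boxTimes h γ L n ω)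
  have hm := h.measurable_energy_integrand γ L s n
  simp only [h1]
  generalize hE : boxTimes W ε γ L n = E at hset hm ⊢
  have hswap :
      ∫⁻ ω, (∫⁻ x, ∫⁻ y, (E ω).indicator 1 x * (E ω).indicator 1 y * edist x y ^ (-s)) ∂P =
      ∫⁻ x, ∫⁻ ω, (∫⁻ y, (E ω).indicator 1 x * (E ω).indicator 1 y * edist x y ^ (-s)) ∂P :=
    lintegral_lintegral_swap
      (f := fun ω x => ∫⁻ y, (E ω).indicator 1 x * (E ω).indicator 1 y * edist x y ^ (-s))
      hm.lintegral_prod_right'.aemeasurable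
  rw [hswap]
  refine lintegral_congr fun x => ?_
  have hmx : Measurable fun q : Ω × ℝ => (E q.1).indicator (1 : ℝ → ℝ≥0∞) x *
      (E q.1).indicator 1 q.2 * edist x q.2 ^ (-s) :=
    hm.comp ((measurable_fst.prodMk measurable_const).prodMk measurable_snd)
  rw [lintegral_lintegral_swap
    (f := fun ω y => (E ω).indicator 1 x * (E ω).indicator 1 y * edist x y ^ (-s))
    hmx.aemeasurable]
  refine lintegral_congr fun y => ?_
  have hxy : MeasurableSet {ω | x ∈ E ω ∧ y ∈ E ω} := (hset x).inter (hset y)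
  have h2 : ∀ ω, (E ω).indicator (1 : ℝ → ℝ≥0∞) x * (E ω).indicator 1 y * edist x y ^ (-s) =
      {ω | x ∈ E ω ∧ y ∈ E ω}.indicator (fun _ => edist x y ^ (-s)) ω := by
    intro ω
    by_cases hx : x ∈ E ω <;> by_cases hy : y ∈ E ω <;> simp [hx, hy]
  rw [lintegral_congr h2, lintegral_indicator hxy, setLIntegral_const, mul_comm]

/-- Fubini reduces expected energy to the two-point function. The diagonal is null, so the bound Φ
is only required off it. -/
theorem IsWebNoise.lintegral_energy_le (h : IsWebNoise P W ε) {γ L s : ℝ} {n : ℕ}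
    {Φ : ℝ → ℝ → ℝ≥0∞} (hΦ : ∀ x ∈ Set.Icc 0 L, ∀ y ∈ Set.Icc 0 L, x ≠ y →
      boxNorm γ n ^ 2 * P {ω | x ∈ boxTimes W ε γ L n ω ∧ y ∈ boxTimes W ε γ L n ω} ≤ Φ x y) :
    ∫⁻ ω, boxNorm γ n ^ 2 * energy s (boxTimes W ε γ L n ω) ∂P ≤
      ∫⁻ x in Set.Icc 0 L, ∫⁻ y in Set.Icc 0 L, Φ x y * edist x y ^ (-s) := by
  have hc : boxNorm γ n ^ 2 ≠ ⊤ := ENNReal.pow_ne_top (by simp [boxNorm])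
  rw [lintegral_const_mul _ (h.measurable_energy γ L s n), h.lintegral_energy,
    ← lintegral_const_mul' _ _ hc, ← lintegral_indicator measurableSet_Icc]
  refine lintegral_mono fun x => ?_
  rw [← lintegral_const_mul' _ _ hc]
  by_cases hx : x ∈ Set.Icc 0 L
  · simp only [Set.indicator_of_mem hx]
    rw [← lintegral_indicator measurableSet_Icc]
    refine lintegral_mono_ae ?_
    have hne : ∀ᵐ y : ℝ, y ≠ x := by simp [ae_iff]
    filter_upwards [hne] with y hy
    by_cases hyI : y ∈ Set.Icc 0 L
    · rw [Set.indicator_of_mem hyI, ← mul_assoc]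
      gcongr
      exact hΦ x hx y hyI hy.symm
    · have : {ω | x ∈ boxTimes W ε γ L n ω ∧ y ∈ boxTimes W ε γ L n ω} = ∅ := by
        ext ω
        simp only [Set.mem_ofPred_eq, Set.mem_empty_iff_false, iff_false]
        exact fun h => hyI h.2.1
      simp [this]
  · have : ∀ y, {ω | x ∈ boxTimes W ε γ L n ω ∧ y ∈ boxTimes W ε γ L n ω} = ∅ := by
      intro y
      ext ω
      simp only [Set.mem_ofPred_eq, Set.mem_empty_iff_false, iff_false]
      exact fun h => hx h.1.1
    simp [this]

/-- The normalized two-point function. -/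
theorem IsWebNoise.boxNorm_sq_mul (h : IsWebNoise P W ε) {γ : ℝ} (hγ : 0 < γ) {L τ σ : ℝ}
    (hτ : τ ∈ Set.Icc 0 L) (hσ : σ ∈ Set.Icc 0 L) (n : ℕ) :
    boxNorm γ n ^ 2 * P {ω | τ ∈ boxTimes W ε γ L n ω ∧ σ ∈ boxTimes W ε γ L n ω} =
      ENNReal.ofReal (∏ k ∈ Finset.range n,
        boxPairProb γ (Real.exp (-|τ - σ|)) k / boxProb γ k ^ 2) := by
  have h0 := fun k => boxProb_pos hγ k
  have hp : 0 ≤ ∏ k ∈ Finset.range n, (boxProb γ k)⁻¹ :=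
    Finset.prod_nonneg fun k _ => (inv_pos.2 (h0 k)).le
  rw [← ofReal_measureReal, h.real_mem_boxTimes_pair hγ hτ hσ, boxNorm, ← ENNReal.ofReal_pow hp,
    ← ENNReal.ofReal_mul (by positivity), ← Finset.prod_pow, ← Finset.prod_mul_distrib]
  congr 1
  refine Finset.prod_congr rfl fun k _ => ?_
  rw [inv_pow]
  ring

end

/-! ### Conclusion -/

theorem measure_eventually_le {Ω : Type*} [MeasurableSpace Ω] {P : Measure Ω} {B : ℕ → Set Ω}
    {q : ℝ≥0∞} (h : ∀ n, P (B n) ≤ q) : P {ω | ∀ᶠ n in Filter.atTop, ω ∈ B n} ≤ q := by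
  have h1 : {ω | ∀ᶠ n in Filter.atTop, ω ∈ B n} = ⋃ N, {ω | ∀ n ≥ N, ω ∈ B n} := by
    ext ω
    simp [Filter.eventually_atTop]
  have h2 : Monotone fun N => {ω | ∀ n ≥ N, ω ∈ B n} :=
    fun M N hMN ω hω n hn => hω n (le_trans hMN hn)
  rw [h1, h2.measure_iUnion]
  exact iSup_le fun N => (measure_mono
    (show {ω | ∀ n ≥ N, ω ∈ B n} ⊆ B N from fun ω hω => hω N le_rfl)).trans (h N)

/-- Chebyshev's inequality, arranged without subtraction in [0, ∞]. -/
theorem measure_lt_half_le {Ω : Type*} [MeasurableSpace Ω] {P : Measure Ω} [IsProbabilityMeasure P]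
    {X : Ω → ℝ≥0∞} (hX : Measurable X) {L ψ : ℝ} (hL : 0 < L) (hψ : 0 ≤ ψ)
    (h1 : ∫⁻ ω, X ω ∂P = ENNReal.ofReal L)
    (h2 : ∫⁻ ω, X ω ^ 2 ∂P ≤ ENNReal.ofReal (L ^ 2 + L ^ 2 * ψ)) :
    P {ω | X ω < ENNReal.ofReal (L / 2)} ≤ ENNReal.ofReal (4 * ψ) := by
  set S := {ω | X ω < ENNReal.ofReal (L / 2)} with hS
  have hSm : MeasurableSet S := measurableSet_lt hX measurable_const
  -- This says (X - L)² ≥ 0, and (X - L)² ≥ L²/4 when X < L/2.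
  have hpt : ∀ ω, ENNReal.ofReal (2 * L) * X ω + S.indicator (fun _ => ENNReal.ofReal (L ^ 2 / 4)) ω
      ≤ X ω ^ 2 + ENNReal.ofReal (L ^ 2) := by
    intro ω
    by_cases htop : X ω = ⊤
    · simp [htop]
    obtain ⟨x, hx0, hx⟩ : ∃ x : ℝ, 0 ≤ x ∧ X ω = ENNReal.ofReal x :=
      ⟨(X ω).toReal, ENNReal.toReal_nonneg, (ENNReal.ofReal_toReal htop).symm⟩
    by_cases hω : ω ∈ S
    · rw [Set.indicator_of_mem hω]
      have hlt : x < L / 2 := by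
        have : X ω < ENNReal.ofReal (L / 2) := hω
        rw [hx] at this
        exact (ENNReal.ofReal_lt_ofReal_iff (by linarith)).1 this
      rw [hx, ← ENNReal.ofReal_mul (by linarith), ← ENNReal.ofReal_pow hx0,
        ← ENNReal.ofReal_add (by positivity) (by positivity),
        ← ENNReal.ofReal_add (by positivity) (by positivity)]
      exact ENNReal.ofReal_le_ofReal (by nlinarith)
    · rw [Set.indicator_of_notMem hω, add_zero, hx, ← ENNReal.ofReal_mul (by linarith),
        ← ENNReal.ofReal_pow hx0, ← ENNReal.ofReal_add (by positivity) (by positivity)]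
      exact ENNReal.ofReal_le_ofReal (by nlinarith [sq_nonneg (x - L)])
  have hlow := lintegral_mono (μ := P) hpt
  rw [lintegral_add_left (hX.const_mul _), lintegral_const_mul _ hX, h1,
    lintegral_indicator hSm, setLIntegral_const, lintegral_add_right _ measurable_const,
    lintegral_const, measure_univ, mul_one] at hlow
  have h3 := hlow.trans (add_le_add_left h2 (ENNReal.ofReal (L ^ 2)))
  have hPS : P S = ENNReal.ofReal (P.real S) := (ofReal_measureReal).symm
  rw [hPS] at h3 ⊢
  have hp0 : 0 ≤ P.real S := measureReal_nonneg
  rw [← ENNReal.ofReal_mul (by linarith), ← ENNReal.ofReal_mul (by positivity),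
    ← ENNReal.ofReal_add (by positivity) (by positivity),
    ← ENNReal.ofReal_add (by positivity) (by positivity),
    ENNReal.ofReal_le_ofReal_iff (by positivity)] at h3
  refine ENNReal.ofReal_le_ofReal ?_
  have h4 : L ^ 2 * P.real S ≤ L ^ 2 * (4 * ψ) := by nlinarith
  exact le_of_mul_le_mul_left h4 (by positivity)

theorem boxPairProb_ratio_le {γ G : ℝ} (hγ : 0 < γ) (hG : ∀ k, (boxProb γ k)⁻¹ ≤ G) {δ : ℝ}
    (hδ : 0 < δ) (k : ℕ) :
    boxPairProb γ (Real.exp (-δ)) k / boxProb γ k ^ 2 ≤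
      1 + 30 * G ^ 2 * (δ * γ ^ k) ^ (-(1 / 3) : ℝ) := by
  have hd := boxSize_eq_toNat hγ k
  have hp := boxProb_pos hγ k
  have hρ : Real.exp (-δ) * (1 + δ) ≤ 1 := by
    have := Real.add_one_le_exp δ
    calc Real.exp (-δ) * (1 + δ) ≤ Real.exp (-δ) * Real.exp δ := by gcongr; linarith
      _ = 1 := by rw [← Real.exp_add]; simp
  have key := pairSurv_le (Real.exp_pos (-δ)).le hδ hρ
    (h := 2 * (boxSize γ k).toNat) (by positivity) (boxSize γ k).toNat hd.2 (boxSize γ k).toNat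
  change boxPairProb γ (Real.exp (-δ)) k ≤ boxProb γ k ^ 2 + _ at key
  have hdγ : γ ^ k ≤ ((boxSize γ k).toNat : ℝ) := by
    have h1 := (boxSize_bounds γ k).1
    have h2 : (((boxSize γ k).toNat : ℕ) : ℝ) = boxSize γ k := by exact_mod_cast hd.1
    rw [h2]
    exact h1.le
  have hmono : (δ * (boxSize γ k).toNat) ^ (-(1 / 3) : ℝ) ≤ (δ * γ ^ k) ^ (-(1 / 3) : ℝ) :=
    Real.rpow_le_rpow_of_nonpos (by positivity) (by gcongr) (by norm_num)
  have hy : 0 ≤ (δ * γ ^ k) ^ (-(1 / 3) : ℝ) := by positivity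
  have hG2 : 1 ≤ G ^ 2 * boxProb γ k ^ 2 := by
    have h1 : 1 ≤ G * boxProb γ k := by
      have := mul_le_mul_of_nonneg_right (hG k) hp.le
      rwa [inv_mul_cancel₀ hp.ne'] at this
    rw [← mul_pow]
    exact one_le_pow₀ h1
  rw [div_le_iff₀ (by positivity)]
  nlinarith [mul_le_mul_of_nonneg_left hG2 hy]

section

variable {Ω : Type*} {W : Site → ℕ → Ω → ℝ} {ε : Site → ℕ → Ω → Bool}

theorem exceptionalTimes_mono (ω : Ω) : Monotone fun K => exceptionalTimes W ε K ω :=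
  fun K K' hKK' τ hτ => ⟨hτ.1, fun t ht => le_trans (by
    have := Real.sqrt_nonneg t
    nlinarith) (hτ.2 t ht)⟩

variable [mΩ : MeasurableSpace Ω] {P : Measure Ω} [IsProbabilityMeasure P]

/-- The first bound serves the energy. The second has leading constant exactly 1 and serves the
variance, where the square of the mean must cancel. The constant A depends on neither L nor n. -/
theorem IsWebNoise.exists_two_point_bounds (h : IsWebNoise P W ε) {γ G : ℝ} (hγ : 1 < γ)
    (hG1 : 1 ≤ G) (hG : ∀ k, (boxProb γ k)⁻¹ ≤ G) :
    ∃ A, 0 ≤ A ∧ ∀ (L : ℝ) (n : ℕ), ∀ x ∈ Set.Icc 0 L, ∀ y ∈ Set.Icc 0 L, x ≠ y →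
      boxNorm γ n ^ 2 * P {ω | x ∈ boxTimes W ε γ L n ω ∧ y ∈ boxTimes W ε γ L n ω} ≤
        ENNReal.ofReal A * (1 + edist x y ^ (-(Real.log G / Real.log γ))) ∧
      boxNorm γ n ^ 2 * P {ω | x ∈ boxTimes W ε γ L n ω ∧ y ∈ boxTimes W ε γ L n ω} ≤
        1 + ENNReal.ofReal A *
          (edist x y ^ (-(Real.log G / Real.log γ)) + edist x y ^ (-(1 / 3) : ℝ)) := by
  have hγ0 : 0 < γ := by linarith
  obtain ⟨A, hA, hAb⟩ := exists_prod_bounds (C := 30 * G ^ 2) hγ (by positivity) hG1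
  refine ⟨A, hA, fun L n x hx y hy hxy => ?_⟩
  have hδ : 0 < |x - y| := abs_pos.2 (sub_ne_zero.2 hxy)
  have hρ1 : Real.exp (-|x - y|) ≤ 1 := Real.exp_le_one_iff.2 (by linarith)
  obtain ⟨b1, b2⟩ := hAb (fun k => boxPairProb γ (Real.exp (-|x - y|)) k / boxProb γ k ^ 2)
    |x - y| n hδ
    (fun k => div_nonneg (pairSurv_mem_Icc (Real.exp_pos _).le hρ1 _ _ _ _).1 (sq_nonneg _))
    (fun k => by
      have hp := boxProb_pos hγ0 k
      refine le_trans ?_ (hG k)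
      rw [div_le_iff₀ (by positivity), pow_two, inv_mul_cancel_left₀ hp.ne']
      exact h.boxPairProb_le_boxProb hγ0 k hδ.le)
    (fun k => boxPairProb_ratio_le hγ0 hG hδ k)
  rw [h.boxNorm_sq_mul hγ0 hx hy, edist_rpow_eq hxy, edist_rpow_eq hxy]
  have r1 : 0 ≤ |x - y| ^ (-(Real.log G / Real.log γ)) := by positivity
  have r2 : 0 ≤ |x - y| ^ (-(1 / 3) : ℝ) := by positivity
  constructor
  · rw [← ENNReal.ofReal_one, ← ENNReal.ofReal_add zero_le_one r1, ← ENNReal.ofReal_mul hA]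
    exact ENNReal.ofReal_le_ofReal b1
  · rw [← ENNReal.ofReal_add r1 r2, ← ENNReal.ofReal_mul hA, ← ENNReal.ofReal_one,
      ← ENNReal.ofReal_add zero_le_one (by positivity)]
    exact ENNReal.ofReal_le_ofReal b2

theorem edist_rpow_mul (x y : ℝ) {α s : ℝ} (hα : 0 < α) (hs : 0 < s) :
    edist x y ^ (-α) * edist x y ^ (-s) = edist x y ^ (-(α + s)) := by
  rcases eq_or_ne x y with rfl | hxy
  · rw [edist_self, ENNReal.zero_rpow_of_neg (by linarith), ENNReal.zero_rpow_of_neg (by linarith),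
      ENNReal.zero_rpow_of_neg (by linarith), ENNReal.top_mul_top]
  · rw [neg_add, ENNReal.rpow_add _ _ (by simpa using hxy) (edist_ne_top x y)]

theorem IsWebNoise.exists_energy_bound (h : IsWebNoise P W ε) {γ G s : ℝ} (hγ : 1 < γ)
    (hG1 : 1 < G) (hG : ∀ k, (boxProb γ k)⁻¹ ≤ G) (hs : 0 < s)
    (hs1 : Real.log G / Real.log γ + s < 1) {L : ℝ} (hL : 0 < L) :
    ∃ B : ℝ≥0∞, B ≠ ⊤ ∧
      ∀ n, ∫⁻ ω, boxNorm γ n ^ 2 * energy s (boxTimes W ε γ L n ω) ∂P ≤ B := by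
  obtain ⟨A, hA, hAb⟩ := h.exists_two_point_bounds hγ hG1.le hG
  set α := Real.log G / Real.log γ with hα
  have hα0 : 0 < α := div_pos (Real.log_pos hG1) (Real.log_pos hγ)
  refine ⟨ENNReal.ofReal A * (ENNReal.ofReal (2 * (L ^ (1 - s) / (1 - s)) * L) +
    ENNReal.ofReal (2 * (L ^ (1 - (α + s)) / (1 - (α + s))) * L)),
    ENNReal.mul_ne_top ENNReal.ofReal_ne_top
      (ENNReal.add_ne_top.2 ⟨ENNReal.ofReal_ne_top, ENNReal.ofReal_ne_top⟩), fun n => ?_⟩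
  refine (h.lintegral_energy_le fun x hx y hy hxy => (hAb L n x hx y hy hxy).1).trans ?_
  have hm : ∀ β x : ℝ, Measurable fun y : ℝ => edist x y ^ (-β) := fun β x =>
    (measurable_edist_rpow β).comp measurable_prodMk_left
  have hm2 : ∀ β : ℝ, Measurable fun x : ℝ => ∫⁻ y in Set.Icc 0 L, edist x y ^ (-β) := fun β =>
    (measurable_edist_rpow β).lintegral_prod_right'
  have e1 : ∀ x y : ℝ, ENNReal.ofReal A * (1 + edist x y ^ (-α)) * edist x y ^ (-s) =
      ENNReal.ofReal A * (edist x y ^ (-s) + edist x y ^ (-(α + s))) := by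
    intro x y
    rw [mul_assoc, add_mul, one_mul, edist_rpow_mul x y hα0 hs]
  simp only [e1]
  simp only [lintegral_const_mul' _ _ ENNReal.ofReal_ne_top, lintegral_add_left (hm s _)]
  rw [lintegral_add_left (hm2 s)]
  gcongr
  · exact lintegral_lintegral_edist_rpow_le (by linarith) hL.le
  · exact lintegral_lintegral_edist_rpow_le (by linarith) hL.le

theorem energy_zero (E : Set ℝ) : energy 0 E = volume E ^ 2 := by
  simp [energy, pow_two]

theorem IsWebNoise.exists_second_moment_bound (h : IsWebNoise P W ε) {γ G : ℝ} (hG1 : 1 < G)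
    (hGγ : G < γ) (hG : ∀ k, (boxProb γ k)⁻¹ ≤ G) :
    ∃ ψ : ℝ → ℝ, Filter.Tendsto ψ Filter.atTop (𝓝 0) ∧ ∀ L, 0 < L → 0 ≤ ψ L ∧
      ∀ n, ∫⁻ ω, (boxNorm γ n * volume (boxTimes W ε γ L n ω)) ^ 2 ∂P ≤
        ENNReal.ofReal (L ^ 2 + L ^ 2 * ψ L) := by
  have hγ : 1 < γ := hG1.trans hGγ
  obtain ⟨A, hA, hAb⟩ := h.exists_two_point_bounds hγ hG1.le hG
  set α := Real.log G / Real.log γ with hα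
  have hα0 : 0 < α := div_pos (Real.log_pos hG1) (Real.log_pos hγ)
  have hα1 : α < 1 := (div_lt_one (Real.log_pos hγ)).2 (Real.log_lt_log (by linarith) hGγ)
  have h1α : 0 < 1 - α := by linarith
  -- Integrating |x - y|^(-β) over [0, L]² gives at most 2L^(2-β)/(1 - β); the 3 is 2/(1 - 1/3).
  refine ⟨fun L => A * (2 / (1 - α) * L ^ (-α) + 3 * L ^ (-(1 / 3) : ℝ)), ?_, fun L hL => ?_⟩
  · have t1 := tendsto_rpow_neg_atTop hα0
    have t2 := tendsto_rpow_neg_atTop (show (0 : ℝ) < 1 / 3 by norm_num)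
    have := ((t1.const_mul (2 / (1 - α))).add (t2.const_mul 3)).const_mul A
    simpa using this
  refine ⟨by positivity, fun n => ?_⟩
  have hsq : ∀ ω, (boxNorm γ n * volume (boxTimes W ε γ L n ω)) ^ 2 =
      boxNorm γ n ^ 2 * energy 0 (boxTimes W ε γ L n ω) := fun ω => by
    rw [energy_zero, mul_pow]
  rw [lintegral_congr hsq]
  refine (h.lintegral_energy_le fun x hx y hy hxy => (hAb L n x hx y hy hxy).2).trans ?_
  have hm : ∀ β x : ℝ, Measurable fun y : ℝ => edist x y ^ (-β) := fun β x =>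
    (measurable_edist_rpow β).comp measurable_prodMk_left
  have hm2 : ∀ β : ℝ, Measurable fun x : ℝ => ∫⁻ y in Set.Icc 0 L, edist x y ^ (-β) := fun β =>
    (measurable_edist_rpow β).lintegral_prod_right'
  simp only [neg_zero, ENNReal.rpow_zero, mul_one]
  simp only [lintegral_add_left measurable_const, lintegral_const_mul' _ _ ENNReal.ofReal_ne_top,
    lintegral_add_left (hm α _)]
  rw [lintegral_add_left (hm2 α)]
  have i1 := lintegral_lintegral_edist_rpow_le (β := α) hα1 hL.le
  have i2 := lintegral_lintegral_edist_rpow_le (β := 1 / 3) (by norm_num) hL.le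
  have i3 : ∫⁻ _ in Set.Icc (0 : ℝ) L, ∫⁻ _ in Set.Icc (0 : ℝ) L, (1 : ℝ≥0∞) =
      ENNReal.ofReal (L ^ 2) := by
    simp only [setLIntegral_const, Real.volume_Icc, sub_zero, one_mul]
    rw [← ENNReal.ofReal_mul hL.le, pow_two]
  have e : ∀ β : ℝ, L ^ (1 - β) * L = L ^ 2 * L ^ (-β) := by
    intro β
    rw [sub_eq_add_neg, Real.rpow_add hL, Real.rpow_one]
    ring
  rw [i3]
  have n1 : 0 ≤ 2 * (L ^ (1 - α) / (1 - α)) * L := by positivity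
  have n2 : 0 ≤ 2 * (L ^ (1 - 1 / 3 : ℝ) / (1 - 1 / 3)) * L := by
    have : (0 : ℝ) < 1 - 1 / 3 := by norm_num
    positivity
  calc _ ≤ ENNReal.ofReal (L ^ 2) + ENNReal.ofReal A *
        (ENNReal.ofReal (2 * (L ^ (1 - α) / (1 - α)) * L) +
          ENNReal.ofReal (2 * (L ^ (1 - 1 / 3 : ℝ) / (1 - 1 / 3)) * L)) := by gcongr
    _ = ENNReal.ofReal (L ^ 2 + A * (2 * (L ^ (1 - α) / (1 - α)) * L +
          2 * (L ^ (1 - 1 / 3 : ℝ) / (1 - 1 / 3)) * L)) := by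
      rw [← ENNReal.ofReal_add n1 n2, ← ENNReal.ofReal_mul hA, ← ENNReal.ofReal_add]
      · positivity
      · exact mul_nonneg hA (add_nonneg n1 n2)
    _ = _ := by
      congr 2
      have c1 : 2 * (L ^ (1 - α) / (1 - α)) * L = 2 / (1 - α) * (L ^ (1 - α) * L) := by ring
      have c2 : 2 * (L ^ (1 - 1 / 3 : ℝ) / (1 - 1 / 3)) * L = 3 * (L ^ (1 - 1 / 3 : ℝ) * L) := by
        norm_num
        ring
      rw [c1, c2, e α, e (1 / 3)]
      ring

theorem IsWebNoise.ae_le_dimH (h : IsWebNoise P W ε) {γ G s : ℝ} (hγ : 4 ≤ γ) (hG1 : 1 < G)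
    (hGγ : G < γ) (hG : ∀ k, (boxProb γ k)⁻¹ ≤ G) (hs : 0 < s)
    (hs1 : Real.log G / Real.log γ + s < 1) :
    ∀ᵐ ω ∂P, ENNReal.ofReal s ≤ dimH (exceptionalTimes W ε (kOf γ) ω) := by
  have hγ0 : 0 < γ := by linarith
  obtain ⟨ψ, hψ, hmom⟩ := h.exists_second_moment_bound hG1 hGγ hG
  rw [ae_iff]
  set N : Set Ω := {ω | ¬ENNReal.ofReal s ≤ dimH (exceptionalTimes W ε (kOf γ) ω)} with hN
  by_contra hne
  have hPtop : P N ≠ ⊤ := measure_ne_top P N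
  -- A quarter of the supposed positive probability of failure is allotted to small volume and a
  -- quarter to large energy.
  set η : ℝ≥0∞ := P N / 2 / 2 with hη
  have hη0 : η ≠ 0 :=
    ENNReal.div_ne_zero.2 ⟨ENNReal.div_ne_zero.2 ⟨hne, by simp⟩, by simp⟩
  have hηtop : η ≠ ⊤ := ENNReal.div_ne_top (ENNReal.div_ne_top hPtop (by simp)) (by simp)
  have hlim : Filter.Tendsto (fun L => ENNReal.ofReal (4 * ψ L)) Filter.atTop (𝓝 0) := by
    have := ENNReal.tendsto_ofReal (hψ.const_mul 4)
    simpa using this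
  -- The window comes first; the energy bound B depends on L, and M is then fixed by Markov's
  -- inequality.
  obtain ⟨L, hLη, hL⟩ := ((hlim.eventually (gt_mem_nhds (pos_iff_ne_zero.2 hη0))).and
    (Filter.eventually_gt_atTop 0)).exists
  obtain ⟨B, hB, hEB⟩ := h.exists_energy_bound (hG1.trans hGγ) hG1 hG hs hs1 hL
  set M : ℝ≥0∞ := B / η + 1 with hM
  have hMtop : M ≠ ⊤ := ENNReal.add_ne_top.2 ⟨ENNReal.div_ne_top hB hη0, by simp⟩
  have hM0 : M ≠ 0 := by simp [hM]
  set X : ℕ → Ω → ℝ≥0∞ := fun n ω => boxNorm γ n * volume (boxTimes W ε γ L n ω) with hX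
  set I : ℕ → Ω → ℝ≥0∞ := fun n ω => boxNorm γ n ^ 2 * energy s (boxTimes W ε γ L n ω) with hI
  have hXm : ∀ n, Measurable (X n) := fun n => (h.measurable_volume_boxTimes γ L n).const_mul _
  have hIm : ∀ n, Measurable (I n) := fun n => (h.measurable_energy γ L s n).const_mul _
  set bad : ℕ → Set Ω := fun n => {ω | X n ω < ENNReal.ofReal (L / 2)} ∪ {ω | M ≤ I n ω} with hbad
  have hbadle : ∀ n, P (bad n) ≤ P N / 2 := by
    intro n
    have b1 : P {ω | X n ω < ENNReal.ofReal (L / 2)} ≤ η :=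
      (measure_lt_half_le (hXm n) hL (hmom L hL).1 (h.lintegral_volume hγ0 n)
        ((hmom L hL).2 n)).trans hLη.le
    have b2 : P {ω | M ≤ I n ω} ≤ η := by
      refine (meas_ge_le_lintegral_div (hIm n).aemeasurable hM0 hMtop).trans ?_
      rw [ENNReal.div_le_iff hM0 hMtop]
      refine (hEB n).trans ?_
      rw [hM, mul_add, ENNReal.mul_div_cancel hη0 hηtop]
      exact le_self_add
    calc P (bad n) ≤ η + η := (measure_union_le _ _).trans (add_le_add b1 b2)
      _ = P N / 2 := ENNReal.add_halves _
  -- If infinitely many stages are not bad, the energy method applies. So N lies almost surely in an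
  -- event of probability at most P N / 2, a contradiction.
  have hsub : ∀ᵐ ω ∂P, ω ∈ N → ω ∈ {ω | ∀ᶠ n in Filter.atTop, ω ∈ bad n} := by
    filter_upwards [h.ae_goodClocks] with ω hω hωN
    by_contra hc
    have hfreq : ∃ᶠ n in Filter.atTop, ω ∉ bad n := Filter.not_eventually.1 hc
    refine hωN ((ofReal_le_dimH_iInter hs (boxTimes_anti γ L ω) (fun n τ hτ => hτ.1)
      (fun n => measurableSet_boxTimes h γ L n ω) (fun n => hω.countable_closure_sdiff γ L n)
      (c := boxNorm γ) (a := ENNReal.ofReal (L / 2)) (M := M) ?_ ENNReal.ofReal_ne_top hMtop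
      (hfreq.mono fun n hn => ?_)).trans (dimH_mono (iInter_boxTimes_subset hγ L ω)))
    · simpa using hL
    · simp only [hbad, Set.mem_union, Set.mem_ofPred_eq, not_or, not_lt, not_le] at hn
      exact ⟨hn.1, hn.2.le⟩
  have hfinal : P N ≤ P N / 2 :=
    (measure_mono_ae hsub).trans (measure_eventually_le hbadle)
  exact absurd (ENNReal.half_lt_self hne hPtop) (not_lt.2 hfinal)

/-! ### The constant γ₀ and the dependence on K. -/

theorem IsWebNoise.measure_boxEvent (h : IsWebNoise P W ε) {γ : ℝ} (hγ : 0 < γ) (k : ℕ) :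
    P (boxEvent W ε γ k 0) = ENNReal.ofReal (boxProb γ k) := by
  have h1 : boxEvent W ε γ k 0 = {ω | BoxSurvives γ k (arrows W ε 0 ω)} :=
    Set.ext fun ω => mem_boxEvent_iff W ε hγ k 0 ω
  rw [h1, ← h.real_boxSurvives hγ k le_rfl, ofReal_measureReal]

/-- The box k = 0 has half-width 2 for every γ and is good with probability 1/16. Besides 2 < γ₀
this yields γ(K) > 4, which the geometric part requires. -/
theorem IsWebNoise.sixteen_le_gammaZero (h : IsWebNoise P W ε) : 16 ≤ gammaZero P W ε := by
  have h1 : (P (boxEvent W ε (gammaOf 1) 0 0))⁻¹ ≤ gammaZero P W ε :=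
    le_iSup_of_le 0 (le_iSup_of_le 1 (le_iSup_of_le one_pos le_rfl))
  rw [h.measure_boxEvent (by linarith [(gammaOf_spec one_pos).1]), boxProb_zero,
    ← ENNReal.ofReal_inv_of_pos (by norm_num)] at h1
  norm_num at h1
  exact h1

theorem IsWebNoise.gammaZero_lt_top (h : IsWebNoise P W ε) : gammaZero P W ε < ⊤ := by
  refine lt_of_le_of_lt (b := (ENNReal.ofReal (Real.exp (-8) / 3))⁻¹) ?_ ?_
  · refine iSup_le fun k => iSup_le fun K => iSup_le fun hK => ?_
    have hγ : 0 < gammaOf K := by linarith [(gammaOf_spec hK).1]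
    rw [h.measure_boxEvent hγ]
    exact ENNReal.inv_le_inv.2 (ENNReal.ofReal_le_ofReal (le_boxProb hγ k))
  · rw [ENNReal.inv_lt_top]
    exact ENNReal.ofReal_pos.2 (by positivity)

theorem IsWebNoise.inv_boxProb_le (h : IsWebNoise P W ε) {K : ℝ} (hK : 0 < K) (k : ℕ) :
    (boxProb (gammaOf K) k)⁻¹ ≤ (gammaZero P W ε).toReal := by
  have hγ : 0 < gammaOf K := by linarith [(gammaOf_spec hK).1]
  have h1 : (P (boxEvent W ε (gammaOf K) k 0))⁻¹ ≤ gammaZero P W ε :=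
    le_iSup_of_le k (le_iSup_of_le K (le_iSup_of_le hK le_rfl))
  rw [h.measure_boxEvent hγ, ← ENNReal.ofReal_inv_of_pos (boxProb_pos hγ k)] at h1
  exact (ENNReal.ofReal_le_iff_le_toReal h.gammaZero_lt_top.ne).1 h1

theorem IsWebNoise.sixteen_le_toReal (h : IsWebNoise P W ε) :
    16 ≤ (gammaZero P W ε).toReal := by
  have := ENNReal.toReal_mono h.gammaZero_lt_top.ne h.sixteen_le_gammaZero
  simpa using this

theorem lt_gammaOf {g K : ℝ} (hg : 2 < g) (hK : kOf g < K) : 0 < K ∧ g < gammaOf K := by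
  have h0 : 0 ≤ kOf g := mul_nonneg (by linarith) (Real.sqrt_nonneg _)
  have hK0 : 0 < K := h0.trans_lt hK
  refine ⟨hK0, ?_⟩
  have := gammaOf_spec hK0
  by_contra hc
  have := kOf_strictMonoOn.monotoneOn (show gammaOf K ∈ Set.Ioi 2 from this.1) hg (not_lt.1 hc)
  linarith

theorem IsWebNoise.ae_le_dimH_exceptionalTimes (h : IsWebNoise P W ε) {K : ℝ}
    (hK : kOf (gammaZero P W ε).toReal < K) :
    ∀ᵐ ω ∂P,
      ENNReal.ofReal (1 - Real.log (gammaZero P W ε).toReal / Real.log (gammaOf K)) ≤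
        dimH (exceptionalTimes W ε K ω) := by
  set G := (gammaZero P W ε).toReal with hG
  have hG16 : 16 ≤ G := h.sixteen_le_toReal
  obtain ⟨hK0, hGγ⟩ := lt_gammaOf (by linarith) hK
  set α := Real.log G / Real.log (gammaOf K) with hα
  have hlog : 0 < Real.log (gammaOf K) := Real.log_pos (by linarith)
  have hα1 : α < 1 := (div_lt_one hlog).2 (Real.log_lt_log (by linarith) hGγ)
  -- The critical exponent 1 - α itself is not reached by the energy bound; it is approached along
  -- countably many smaller ones.
  have key : ∀ n : ℕ, ∀ᵐ ω ∂P,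
      ENNReal.ofReal ((1 - α) * (1 - 1 / ((n : ℝ) + 2))) ≤ dimH (exceptionalTimes W ε K ω) := by
    intro n
    have h1 : 1 / ((n : ℝ) + 2) < 1 := by
      rw [div_lt_one (by positivity)]
      have : (0 : ℝ) ≤ n := by positivity
      linarith
    have h2 : 0 < 1 / ((n : ℝ) + 2) := by positivity
    have := h.ae_le_dimH (γ := gammaOf K) (G := G) (s := (1 - α) * (1 - 1 / ((n : ℝ) + 2)))
      (by linarith) (by linarith) hGγ (fun k => h.inv_boxProb_le hK0 k)
      (mul_pos (by linarith) (by linarith)) (by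
        change α + _ < 1
        nlinarith)
    rwa [(gammaOf_spec hK0).2] at this
  filter_upwards [ae_all_iff.2 key] with ω hω
  have ht : Filter.Tendsto (fun n : ℕ => (1 - α) * (1 - 1 / ((n : ℝ) + 2))) Filter.atTop
      (𝓝 ((1 - α) * (1 - 0))) := by
    refine Filter.Tendsto.const_mul _ (tendsto_const_nhds.sub ?_)
    have h3 := (tendsto_one_div_add_atTop_nhds_zero_nat (𝕜 := ℝ)).comp (Filter.tendsto_add_atTop_nat 1)
    refine h3.congr fun n => ?_
    simp only [Function.comp]
    push_cast
    ring_nf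
  rw [sub_zero, mul_one] at ht
  exact le_of_tendsto' (ENNReal.tendsto_ofReal ht) hω

theorem IsWebNoise.ae_tendsto_dimH (h : IsWebNoise P W ε) :
    ∀ᵐ ω ∂P, Filter.Tendsto (fun K : ℝ => dimH (exceptionalTimes W ε K ω)) Filter.atTop (𝓝 1) := by
  set G := (gammaZero P W ε).toReal with hG
  have hG16 : 16 ≤ G := h.sixteen_le_toReal
  have key : ∀ᵐ ω ∂P, ∀ n : ℕ, kOf G < n → ENNReal.ofReal
      (1 - Real.log G / Real.log (gammaOf n)) ≤ dimH (exceptionalTimes W ε n ω) := by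
    rw [ae_all_iff]
    intro n
    by_cases hn : kOf G < n
    · filter_upwards [h.ae_le_dimH_exceptionalTimes hn] with ω hω _
      exact hω
    · exact Filter.Eventually.of_forall fun ω h' => absurd h' hn
  filter_upwards [key] with ω hω
  have hle : ∀ K, dimH (exceptionalTimes W ε K ω) ≤ 1 := fun K =>
    (dimH_mono (Set.subset_univ _)).trans Real.dimH_univ.le
  have hγlim : Filter.Tendsto (fun n : ℕ => gammaOf n) Filter.atTop Filter.atTop := by
    rw [Filter.tendsto_atTop]
    intro b
    have h1 := Filter.eventually_gt_atTop (kOf (max b 3))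
    filter_upwards [(tendsto_natCast_atTop_atTop (R := ℝ)).eventually h1] with n hn
    exact (le_max_left b 3).trans (lt_gammaOf (by
      have := le_max_right b 3
      linarith) hn).2.le
  have hlow : Filter.Tendsto (fun n : ℕ => ENNReal.ofReal
      (1 - Real.log G / Real.log (gammaOf n))) Filter.atTop (𝓝 1) := by
    have h2 : Filter.Tendsto (fun n : ℕ => 1 - Real.log G / Real.log (gammaOf n)) Filter.atTop
        (𝓝 (1 - 0)) :=
      tendsto_const_nhds.sub ((Real.tendsto_log_atTop.comp hγlim).const_div_atTop _)
    have := ENNReal.tendsto_ofReal h2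
    simpa using this
  -- The exceptional sets increase with K, so integer values of K, for which one null set suffices,
  -- control all real ones.
  have hfloor := hlow.comp (tendsto_nat_floor_atTop (α := ℝ))
  refine tendsto_of_tendsto_of_tendsto_of_le_of_le' hfloor tendsto_const_nhds ?_
    (Filter.Eventually.of_forall hle)
  have h3 : ∀ᶠ K : ℝ in Filter.atTop, kOf G < ((⌊K⌋₊ : ℕ) : ℝ) :=
    (tendsto_natCast_atTop_atTop.comp (tendsto_nat_floor_atTop (α := ℝ))).eventually
      (Filter.eventually_gt_atTop (kOf G))
  filter_upwards [h3, Filter.eventually_ge_atTop 0] with K hK hK0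
  exact (hω _ hK).trans (dimH_mono (exceptionalTimes_mono ω (Nat.floor_le hK0)))

end

end

end DynWeb

theorem proposition4 {Ω : Type*} [MeasurableSpace Ω] (P : Measure Ω) [IsProbabilityMeasure P]
    (W : DynWeb.Site → ℕ → Ω → ℝ) (ε : DynWeb.Site → ℕ → Ω → Bool)
    (h : DynWeb.IsWebNoise P W ε) :
    (2 < DynWeb.gammaZero P W ε ∧ DynWeb.gammaZero P W ε < ⊤) ∧
    (∀ K : ℝ, DynWeb.kOf (DynWeb.gammaZero P W ε).toReal < K →
      ∀ᵐ ω ∂P,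
        ENNReal.ofReal
            (1 - Real.log (DynWeb.gammaZero P W ε).toReal / Real.log (DynWeb.gammaOf K)) ≤
          dimH (DynWeb.exceptionalTimes W ε K ω)) ∧
    (∀ᵐ ω ∂P,
      Filter.Tendsto (fun K : ℝ => dimH (DynWeb.exceptionalTimes W ε K ω)) Filter.atTop (𝓝 1)) :=
  ⟨⟨lt_of_lt_of_le (by norm_num) h.sixteen_le_gammaZero, h.gammaZero_lt_top⟩,
    fun _ hK => h.ae_le_dimH_exceptionalTimes hK, h.ae_tendsto_dimH⟩
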